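/- **Model.** A topology $(G,s)$ is a finite connected undirected graph $G$ with $n$ nodes and a source node $s$. In each synchronous round every node is silent or broadcasts one packet to all its neighbours. A node that is silent and has exactly one broadcasting neighbour receives that neighbour's packet, except that with probability $p$, independently over nodes and rounds, it receives noise instead (receiver fault); in all other cases a node receives nothing, and noise is never mistaken for a packet. Here $p\in(0,1)$ is a constant. Initially only $s$ knows $k$ messages; the goal is that all nodes know all $k$ messages. *Adaptive routing:* for each round $r$, a fixed function of the set of all pairs $(u,i)$ such that node $u$ received message $i$ before round $r$ prescribes for every node whether it is silent or which single message it broadcasts (a node told to broadcast a message it does not know is silent). *Coding:* messages have $\lceil a\log_2(nk)\rceil$ bits and packets have $\lceil b\log_2(nk)\rceil$ bits for constants $0<a\le b$; in each round a node is silent or broadcasts an arbitrary packet, as a fixed function of the node, the round, the messages (if the node is $s$), and the history of what the node has received so far; after the last round each node decodes the messages from this information. Schedules are chosen knowing $(G,s)$. Let $T^{R}_k$ (resp. $T^{NC}_k$) be the least number of rounds $T$ for which some adaptive routing (resp. coding) schedule of $T$ rounds succeeds with probability at least $1-1/k$ over the faults (for coding: for every choice of the contents of the messages). The throughputs are $$\tau^{R}(G,s)=\limsup_{k\to\infty}\frac{k}{T^{R}_k},\qquad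 \tau^{NC}(G,s)=\limsup_{k\to\infty}\frac{k}{T^{NC}_k}.$$ **The network WCT.** For $m\ge 4$ let $L=\lfloor\tfrac12\lfloor\log_2 m\rfloor\rfloor$. Take $m$ senders and $L$ classes of $m$ receivers each; each receiver of class $i\in\{1,\dots,L\}$ is adjacent to each sender independently with probability $2^{-i}$. Replace every receiver by a cluster of $\lfloor m/L\rfloor$ nodes, each adjacent to exactly the senders adjacent to that receiver, and add a source adjacent to all senders. Let $N=1+m+mL\lfloor m/L\rfloor$ be the number of nodes of the resulting random graph $\mathrm{WCT}_m$. **Theorem.** Fix $p\in(0,1)$ and $0<a\le b$. All minima are over all topologies $(G,s)$ with $n$ nodes, and the constants hidden in $\Theta$ depend only on $p,a,b$. As $n\to\infty$, $$\min_{(G,s)}\tau^{NC}(G,s)=\Theta\!\left(\frac1{\log n}\right),\qquad \min_{(G,s)}\tau^{R}(G,s)=\Theta\!\left(\frac1{\log^2 n}\right).$$ Both orders are attained on WCT: there are constants $0<c\le C$ such that, with probability tending to $1$ as $m\to\infty$, $\mathrm{WCT}_m$ is connected and $$\frac{c}{\log^2 N}\le\tau^{R}(\mathrm{WCT}_m)\le\frac{C}{\log^2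 N},\qquad \frac{c}{\log N}\le\tau^{NC}(\mathrm{WCT}_m)\le\frac{C}{\log N}.$$ Hence the worst case topology gap satisfies $$\frac{\min_{(G,s)}\tau^{NC}(G,s)}{\min_{(G,s)}\tau^{R}(G,s)}=\Theta(\log n).$$ -/

import Mathlib

open Filter Topology
open scoped ENNReal

noncomputable section

namespace NoisyRadio

/-! ### Independent Bernoulli families -/

open Classical in
/-- The probability of the event `E` when the bits `ω i`, `i : ι`, are independent and
`ω i` is `true` with probability `q i`. -/
def bernoulliProb {ι : Type} [Fintype ι] (q : ι → ℝ) (E : Set (ι → Bool)) : ℝ :=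
  ∑ ω : ι → Bool, if ω ∈ E then ∏ i, (if ω i then q i else 1 - q i) else 0

/-! ### The radio network model with receiver faults -/

section Model

variable {V : Type}

open Classical in
/-- One faultless round: `tx u` is the packet broadcast by `u` (`none` if `u` is silent).
A silent node with exactly one broadcasting neighbour receives that neighbour's packet,
any other node receives nothing. -/
def receive {α : Type} (G : SimpleGraph V) (tx : V → Option α) (v : V) : Option α :=
  if h : tx v = none ∧ ∃! u, G.Adj v u ∧ (tx u).isSome then tx h.2.choose else none

/-- One round with receiver faults: a node `v` with `fault v = true` hears noise in place of the
packet that it would otherwise have received. -/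
def noisyReceive {α : Type} (G : SimpleGraph V) (tx : V → Option α) (fault : V → Bool) (v : V) :
    Option α :=
  if fault v then none else receive G tx v

/-- A fault pattern for the first `T` rounds: whether `v` has a fault in round `r`. -/
abbrev Faults (V : Type) (T : ℕ) := Fin T × V → Bool

/-- The faults of the first `T` out of `T + 1` rounds. -/
def Faults.init {T : ℕ} (ω : Faults V (T + 1)) : Faults V T := fun x => ω (x.1.castSucc, x.2)

/-- The faults of the last out of `T + 1` rounds. -/
def Faults.last {T : ℕ} (ω : Faults V (T + 1)) : V → Bool := fun v => ω (Fin.last T, v)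

/-- Probability of an event when all faults are independent and have probability `p`. -/
def faultProb [Fintype V] (p : ℝ) {T : ℕ} (E : Set (Faults V T)) : ℝ :=
  bernoulliProb (fun _ => p) E

/-! ### Adaptive routing -/

/-- An adaptive routing schedule for `k` messages: in round `r`, the set of all pairs `(u, i)` such
that `u` received message `i` before round `r` determines for each node whether it stays silent or
which message it broadcasts. -/
abbrev AdaptiveSchedule (V : Type) (k : ℕ) := ℕ → Set (V × Fin k) → V → Option (Fin k)

/-- `u` knows message `i` if `u` is the source or has received message `i`. -/
def Knows {k : ℕ} (s : V) (R : Set (V × Fin k)) (u : V) (i : Fin k) : Prop :=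
  u = s ∨ (u, i) ∈ R

open Classical in
/-- The broadcasts of a round; a node that is told to broadcast a message that it does not know
stays silent. -/
def routingTx {k : ℕ} (s : V) (b : Set (V × Fin k) → V → Option (Fin k)) (R : Set (V × Fin k))
    (u : V) : Option (Fin k) :=
  (b R u).filter (fun i => decide (Knows s R u i))

/-- The pairs `(u, i)` such that `u` received message `i` during the first `T` rounds. -/
def received {k : ℕ} (G : SimpleGraph V) (s : V) (b : AdaptiveSchedule V k) :
    (T : ℕ) → Faults V T → Set (V × Fin k)
  | 0, _ => ∅
  | T + 1, ω =>
      received G s b T ω.init ∪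
        {x | noisyReceive G (routingTx s (b T) (received G s b T ω.init)) ω.last x.1 = some x.2}

variable [Fintype V]

/-- Some adaptive routing schedule broadcasts `k` messages from `s` to all nodes within `T` rounds
with probability at least `1 - 1 / k`. -/
def RoutingFeasible (G : SimpleGraph V) (s : V) (p : ℝ) (k T : ℕ) : Prop :=
  ∃ b : AdaptiveSchedule V k,
    1 - 1 / (k : ℝ) ≤ faultProb p {ω : Faults V T | ∀ u i, Knows s (received G s b T ω) u i}

/-- The least number of rounds in which adaptive routing broadcasts `k` messages. -/
def routingRounds (G : SimpleGraph V) (s : V) (p : ℝ) (k : ℕ) : ℕ∞ :=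
  ⨅ (T : ℕ) (_ : RoutingFeasible G s p k T), (T : ℕ∞)

/-- The adaptive routing throughput of the topology `(G, s)` with receiver faults. -/
def routingThroughput (G : SimpleGraph V) (s : V) (p : ℝ) : ℝ≥0∞ :=
  limsup (fun k : ℕ => (k : ℝ≥0∞) / (routingRounds G s p k : ℝ≥0∞)) atTop

end Model

/-! ### Network coding -/

/-- The number of bits `⌈a log₂ (n k)⌉`. -/
def bitLength (a : ℝ) (n k : ℕ) : ℕ := ⌈a * Real.logb 2 ((n : ℝ) * (k : ℝ))⌉₊

/-- Bit strings of length `ℓ`. -/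
abbrev Bits (ℓ : ℕ) := Fin ℓ → Bool

/-- A coding schedule with messages in `M` and packets in `P`. In every round a node decides
whether to stay silent or which packet to broadcast as a function of the round, its initial
knowledge (the `k` messages at the source, `none` at any other node) and its reception history.
The history has one entry for every earlier round, the latest one first, and the entry is `none`
if no packet was received. After the last round `decode` gives the messages as a function of the
same data. -/
structure CodingSchedule (V M P : Type) (k : ℕ) where
  send : ℕ → V → Option (Fin k → M) → List (Option P) → Option P
  decode : V → Option (Fin k → M) → List (Option P) → Fin k → M

section Coding

variable {V M P : Type} {k : ℕ}

open Classical in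
/-- At the start, only the source knows the messages. -/
def initialKnowledge (s : V) (m : Fin k → M) (u : V) : Option (Fin k → M) :=
  if u = s then some m else none

/-- The reception history of every node after the first `T` rounds. -/
def history (G : SimpleGraph V) (s : V) (S : CodingSchedule V M P k) (m : Fin k → M) :
    (T : ℕ) → Faults V T → V → List (Option P)
  | 0, _ => fun _ => []
  | T + 1, ω => fun v =>
      noisyReceive G
          (fun u => S.send T u (initialKnowledge s m u) (history G s S m T ω.init u)) ω.last v
        :: history G s S m T ω.init v

variable [Fintype V]

/-- Some coding schedule, with messages of `⌈a log₂ (n k)⌉` bits and packets of `⌈b log₂ (n k)⌉`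
bits, broadcasts `k` messages from `s` to all nodes within `T` rounds with probability at least
`1 - 1 / k`, whatever the contents of the messages. -/
def CodingFeasible (G : SimpleGraph V) (s : V) (p a b : ℝ) (k T : ℕ) : Prop :=
  ∃ S : CodingSchedule V (Bits (bitLength a (Fintype.card V) k))
      (Bits (bitLength b (Fintype.card V) k)) k,
    ∀ m : Fin k → Bits (bitLength a (Fintype.card V) k),
      1 - 1 / (k : ℝ) ≤ faultProb p {ω : Faults V T |
        ∀ u, S.decode u (initialKnowledge s m u) (history G s S m T ω u) = m}

/-- The least number of rounds in which coding broadcasts `k` messages. -/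
def codingRounds (G : SimpleGraph V) (s : V) (p a b : ℝ) (k : ℕ) : ℕ∞ :=
  ⨅ (T : ℕ) (_ : CodingFeasible G s p a b k T), (T : ℕ∞)

/-- The coding throughput of the topology `(G, s)` with receiver faults. -/
def codingThroughput (G : SimpleGraph V) (s : V) (p a b : ℝ) : ℝ≥0∞ :=
  limsup (fun k : ℕ => (k : ℝ≥0∞) / (codingRounds G s p a b k : ℝ≥0∞)) atTop

end Coding

/-! ### Worst case over all topologies with `n` nodes -/

/-- A connected graph on the `n` nodes `Fin n` together with a source. -/
abbrev Topologies (n : ℕ) := {t : SimpleGraph (Fin n) × Fin n // t.1.Connected}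

/-- The smallest adaptive routing throughput of a topology with `n` nodes. There are finitely many
such topologies, hence the infimum is a minimum for `n ≥ 1`. -/
def worstRoutingThroughput (p : ℝ) (n : ℕ) : ℝ≥0∞ :=
  ⨅ t : Topologies n, routingThroughput t.1.1 t.1.2 p

/-- The smallest coding throughput of a topology with `n` nodes (a minimum for `n ≥ 1`). -/
def worstCodingThroughput (p a b : ℝ) (n : ℕ) : ℝ≥0∞ :=
  ⨅ t : Topologies n, codingThroughput t.1.1 t.1.2 p a b

/-- The worst case topology gap. -/
def worstCaseTopologyGap (p a b : ℝ) (n : ℕ) : ℝ≥0∞ :=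
  worstCodingThroughput p a b n / worstRoutingThroughput p n

/-! ### The clustered network -/

/-- The number of classes of receivers. -/
def numClasses (m : ℕ) : ℕ := Nat.log 2 m / 2

/-- The receivers of the original network, each of which is replaced by a cluster: `m` receivers in
every class. -/
abbrev Receivers (m : ℕ) := Fin (numClasses m) × Fin m

/-- The size of every cluster. -/
def clusterSize (m : ℕ) : ℕ := m / numClasses m

/-- The nodes of the clustered network: a source, `m` senders, and a cluster for each receiver. -/
abbrev WCTNode (m : ℕ) := Unit ⊕ Fin m ⊕ Receivers m × Fin (clusterSize m)

/-- The source of the clustered network. -/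
def wctSource (m : ℕ) : WCTNode m := Sum.inl ()

/-- The clustered network for a given bipartite graph `H` between receivers and senders. The source
is adjacent to all senders, and every node of the cluster of a receiver is adjacent to exactly those
senders to which the receiver is adjacent in `H`. -/
def wctGraph (m : ℕ) (H : Receivers m × Fin m → Bool) : SimpleGraph (WCTNode m) :=
  SimpleGraph.fromRel fun x y =>
    match x, y with
    | Sum.inl _, Sum.inr (Sum.inl _) => True
    | Sum.inr (Sum.inl j), Sum.inr (Sum.inr (r, _)) => H (r, j) = true
    | _, _ => False

/-- The probability of a set of bipartite graphs when every receiver of the `i`-th class,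
`i = 1, 2, …`, is independently adjacent to every sender with probability `2 ^ (-i)`. -/
def wctProb (m : ℕ) (E : Set (Receivers m × Fin m → Bool)) : ℝ :=
  bernoulliProb (fun e : Receivers m × Fin m => (1 / 2 : ℝ) ^ (e.1.1.val + 1)) E

end NoisyRadio

end

noncomputable section

namespace NoisyRadio

open scoped Classical

/-! ### Expectations over independent bits -/

section Bernoulli

variable {ι : Type} [Fintype ι]

/-! Lower bounds on the throughput. Messages are pipelined in batches through the distance layers of
the topology, with only every third layer active in a round so that layers do not interfere. If
every node is picked with probability 2^(-j), a neighbourhood whose size is about 2^j contains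
exactly one picked node with constant probability. One of about log n densities fits, so a fixed
list of sender sets isolates a sender in every nonempty neighbourhood for a fraction Ω(1/log n) of
the list (`exists_decay_family`). With coding, a batch of B messages travels as a Reed-Solomon
codeword of O(B log n) symbols. Any B of them determine the batch, and a Chernoff bound gives
failure probability 2^(-B) per node and epoch (`codingFeasible_of_layering`). With routing, the
layer picks an unfinished message and a sender set that serves a fraction Ω(1/log n) of the nodes
lacking it. The product over the batch of 1 + (number of nodes lacking the message) then shrinks in
expectation by a factor 1 - Ω(1/log n) per round. It starts at no more than (1+n)^B, so O(B log² n)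
rounds per batch suffice (`routingFeasible_of_layering`).

Upper bounds. For a fixed set of s broadcasting senders the probabilities s·2^(-i)·(1 -
2^(-i))^(s-1) that a receiver of class i hears something sum over i to at most 2. A Chernoff bound
and a union over the 2^m sender sets show that almost surely no set reaches more than 5m of the mL
receivers (`tendsto_wctProb_isGoodBipartite`). A cluster is therefore served only in a fraction
O(1/L) of the rounds, on average. For coding, counting reception histories shows that a node needs
Ω(k) receptions (`card_messages_le`), hence Ω(kL) rounds. For routing, one message must get past the
faults at all of the at least 2^L nodes of a cluster, which takes Ω(L) offers per message
(`RoutingFeasible.cluster_bound`); this is the second logarithm. Since L has order log N, both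
orders follow. Attaching spare nodes to the source gives every large n, and the gap is the quotient
of the two bounds. -/

/-- The probability of the single outcome `ω`. -/
def bernWeight (q : ι → ℝ) (ω : ι → Bool) : ℝ := ∏ i, (if ω i then q i else 1 - q i)

/-- The expectation of `f` over independent bits. -/
def bernExp (q : ι → ℝ) (f : (ι → Bool) → ℝ) : ℝ := ∑ ω, bernWeight q ω * f ω

/-- The sum in the definition uses the `Fintype` structure that comes from classical decidable
equality. Concrete index types such as products bring their own instance. -/
lemma bernExp_eq_sum [DecidableEq ι] (q : ι → ℝ) (f : (ι → Bool) → ℝ) :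
    bernExp q f = ∑ ω, bernWeight q ω * f ω := by
  unfold bernExp
  congr!

lemma bernoulliProb_eq_bernExp (q : ι → ℝ) (E : Set (ι → Bool)) :
    bernoulliProb q E = bernExp q (fun ω => if ω ∈ E then 1 else 0) := by
  simp [bernoulliProb, bernExp, bernWeight]

lemma bernWeight_nonneg {q : ι → ℝ} (h0 : ∀ i, 0 ≤ q i) (h1 : ∀ i, q i ≤ 1) (ω : ι → Bool) :
    0 ≤ bernWeight q ω := by
  refine Finset.prod_nonneg fun i _ => ?_
  split_ifs
  · exact h0 i
  · linarith [h1 i]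

lemma bernExp_mono {q : ι → ℝ} (h0 : ∀ i, 0 ≤ q i) (h1 : ∀ i, q i ≤ 1) {f g : (ι → Bool) → ℝ}
    (h : ∀ ω, f ω ≤ g ω) : bernExp q f ≤ bernExp q g :=
  Finset.sum_le_sum fun ω _ => mul_le_mul_of_nonneg_left (h ω) (bernWeight_nonneg h0 h1 ω)

lemma bernExp_nonneg {q : ι → ℝ} (h0 : ∀ i, 0 ≤ q i) (h1 : ∀ i, q i ≤ 1) {f : (ι → Bool) → ℝ}
    (h : ∀ ω, 0 ≤ f ω) : 0 ≤ bernExp q f :=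
  Finset.sum_nonneg fun ω _ => mul_nonneg (bernWeight_nonneg h0 h1 ω) (h ω)

lemma bernExp_add (q : ι → ℝ) (f g : (ι → Bool) → ℝ) :
    bernExp q (fun ω => f ω + g ω) = bernExp q f + bernExp q g := by
  simp [bernExp, mul_add, Finset.sum_add_distrib]

lemma bernExp_const_mul (q : ι → ℝ) (c : ℝ) (f : (ι → Bool) → ℝ) :
    bernExp q (fun ω => c * f ω) = c * bernExp q f := by
  simp only [bernExp, Finset.mul_sum]
  exact Finset.sum_congr rfl fun ω _ => by ring

lemma bernExp_sum {α : Type*} (q : ι → ℝ) (s : Finset α) (f : α → (ι → Bool) → ℝ) :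
    bernExp q (fun ω => ∑ a ∈ s, f a ω) = ∑ a ∈ s, bernExp q (f a) := by
  simp only [bernExp, Finset.mul_sum]
  exact Finset.sum_comm

/-- Independence of the bits, obtained by expanding a product of two-term sums into a sum over all
outcomes. -/
lemma bernExp_prod (q : ι → ℝ) (g : ι → Bool → ℝ) :
    bernExp q (fun ω => ∏ i, g i (ω i)) = ∏ i, (q i * g i true + (1 - q i) * g i false) := by
  have := Finset.prod_univ_sum (fun _ : ι => (Finset.univ : Finset Bool))
    (fun i c => (if c then q i else 1 - q i) * g i c)
  simp only [Fintype.piFinset_univ, Fintype.sum_bool, if_true, Bool.false_eq_true, if_false] at this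
  rw [this]
  simp only [bernExp, bernWeight, Finset.prod_mul_distrib]

lemma bernExp_const (q : ι → ℝ) (c : ℝ) : bernExp q (fun _ => c) = c := by
  have h1 : bernExp q (fun _ => 1) = 1 := by
    simpa using bernExp_prod q (fun _ _ => 1)
  simpa [h1] using bernExp_const_mul q c (fun _ => 1)

lemma bernExp_prod_finset (q : ι → ℝ) (s : Finset ι) (g : ι → Bool → ℝ) :
    bernExp q (fun ω => ∏ i ∈ s, g i (ω i)) =
      ∏ i ∈ s, (q i * g i true + (1 - q i) * g i false) := by
  have := bernExp_prod q (fun i c => if i ∈ s then g i c else 1)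
  simp only [Finset.prod_ite_mem, Finset.univ_inter] at this
  rw [this, ← Finset.prod_subset (Finset.subset_univ s)]
  · exact Finset.prod_congr rfl fun i hi => by simp [hi]
  · intro i _ hi
    simp [hi]

lemma bernExp_coord (q : ι → ℝ) (i : ι) (g : Bool → ℝ) :
    bernExp q (fun ω => g (ω i)) = q i * g true + (1 - q i) * g false := by
  simpa using bernExp_prod_finset q {i} (fun _ => g)

/-- Independence of whole rows: the same expansion after currying an outcome on `α × β` into a
family of rows. -/
lemma bernExp_prod_block {α β : Type} [Fintype α] [Fintype β] (q : α × β → ℝ)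
    (g : α → (β → Bool) → ℝ) :
    bernExp q (fun ω => ∏ a, g a (fun b => ω (a, b))) =
      ∏ a, bernExp (fun b => q (a, b)) (g a) := by
  have := Finset.prod_univ_sum (fun _ : α => (Finset.univ : Finset (β → Bool)))
    (fun a η => bernWeight (fun b => q (a, b)) η * g a η)
  simp only [Fintype.piFinset_univ] at this
  simp only [bernExp_eq_sum]
  rw [this, ← (Equiv.curry α β Bool).sum_comp]
  refine Finset.sum_congr rfl fun ω _ => ?_
  rw [Finset.prod_mul_distrib]
  simp only [bernWeight, Fintype.prod_prod_type]
  rfl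

lemma bernoulliProb_mono {q : ι → ℝ} (h0 : ∀ i, 0 ≤ q i) (h1 : ∀ i, q i ≤ 1)
    {E F : Set (ι → Bool)} (h : E ⊆ F) : bernoulliProb q E ≤ bernoulliProb q F := by
  rw [bernoulliProb_eq_bernExp, bernoulliProb_eq_bernExp]
  refine bernExp_mono h0 h1 fun ω => ?_
  by_cases hE : ω ∈ E
  · simp [hE, h hE]
  · simp only [hE, if_false]
    split_ifs <;> norm_num

lemma bernoulliProb_le_one {q : ι → ℝ} (h0 : ∀ i, 0 ≤ q i) (h1 : ∀ i, q i ≤ 1)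
    (E : Set (ι → Bool)) : bernoulliProb q E ≤ 1 := by
  rw [bernoulliProb_eq_bernExp]
  refine (bernExp_mono h0 h1 (g := fun _ => 1) fun ω => ?_).trans (bernExp_const q 1).le
  split_ifs <;> norm_num

lemma bernoulliProb_compl (q : ι → ℝ) (E : Set (ι → Bool)) :
    bernoulliProb q E = 1 - bernoulliProb q Eᶜ := by
  rw [eq_sub_iff_add_eq, bernoulliProb_eq_bernExp, bernoulliProb_eq_bernExp, ← bernExp_add]
  refine Eq.trans ?_ (bernExp_const q 1)
  congr 1
  ext ω
  by_cases h : ω ∈ E <;> simp [h]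

/-- The union bound. -/
lemma bernoulliProb_iUnion_le {α : Type*} {q : ι → ℝ} (h0 : ∀ i, 0 ≤ q i) (h1 : ∀ i, q i ≤ 1)
    (s : Finset α) {E : Set (ι → Bool)} (F : α → Set (ι → Bool))
    (h : ∀ ω ∈ E, ∃ a ∈ s, ω ∈ F a) : bernoulliProb q E ≤ ∑ a ∈ s, bernoulliProb q (F a) := by
  simp only [bernoulliProb_eq_bernExp]
  rw [← bernExp_sum]
  refine bernExp_mono h0 h1 fun ω => ?_
  have hnn : ∀ a ∈ s, (0 : ℝ) ≤ if ω ∈ F a then 1 else 0 := fun a _ => by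
    split_ifs <;> norm_num
  by_cases hE : ω ∈ E
  · obtain ⟨a, ha, hF⟩ := h ω hE
    calc (if ω ∈ E then (1 : ℝ) else 0) = if ω ∈ F a then 1 else 0 := by simp [hE, hF]
      _ ≤ _ := Finset.single_le_sum hnn ha
  · rw [if_neg hE]
    exact Finset.sum_nonneg hnn

/-- Markov's inequality in the form of a domination by a nonnegative function. -/
lemma bernoulliProb_le_bernExp {q : ι → ℝ} (h0 : ∀ i, 0 ≤ q i) (h1 : ∀ i, q i ≤ 1)
    {E : Set (ι → Bool)} {f : (ι → Bool) → ℝ} (hf : ∀ ω, 0 ≤ f ω) (h : ∀ ω ∈ E, 1 ≤ f ω) :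
    bernoulliProb q E ≤ bernExp q f := by
  rw [bernoulliProb_eq_bernExp]
  refine bernExp_mono h0 h1 fun ω => ?_
  split_ifs with hE
  · exact h ω hE
  · exact hf ω

end Bernoulli

/-! ### Conditioning on the faults of all rounds but the last -/

section Faults

variable {V : Type}

/-- Append the faults of one more round. -/
def Faults.snoc {T : ℕ} (ω : Faults V T) (η : V → Bool) : Faults V (T + 1) :=
  fun x => if h : x.1.val < T then ω (⟨x.1.val, h⟩, x.2) else η x.2

@[simp] lemma Faults.init_snoc {T : ℕ} (ω : Faults V T) (η : V → Bool) :
    (ω.snoc η).init = ω := by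
  ext ⟨r, v⟩
  simp [Faults.init, Faults.snoc]

@[simp] lemma Faults.last_snoc {T : ℕ} (ω : Faults V T) (η : V → Bool) :
    (ω.snoc η).last = η := by
  ext v
  simp [Faults.last, Faults.snoc]

/-- A fault pattern of `T + 1` rounds consists of one of `T` rounds and the faults of a round. -/
def Faults.equiv (V : Type) (T : ℕ) : Faults V (T + 1) ≃ Faults V T × (V → Bool) where
  toFun ω := (ω.init, ω.last)
  invFun x := x.1.snoc x.2
  left_inv ω := by
    ext ⟨r, v⟩
    simp only [Faults.snoc, Faults.init, Faults.last]
    split_ifs with h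
    · rfl
    · congr 2
      exact Fin.ext (by simp; omega)
  right_inv x := by simp

/-- Fubini: the faults of the last round can be averaged out first, with the past held fixed. -/
lemma bernExp_faults_succ [Fintype V] (p : ℝ) {T : ℕ} (f : Faults V T → (V → Bool) → ℝ) :
    bernExp (fun _ => p) (fun ω : Faults V (T + 1) => f ω.init ω.last) =
      bernExp (fun _ => p) (fun ω : Faults V T => bernExp (fun _ => p) (fun η => f ω η)) := by
  simp only [bernExp_eq_sum, Finset.mul_sum]
  rw [← Fintype.sum_prod_type', ← (Faults.equiv V T).sum_comp]
  refine Finset.sum_congr rfl fun (ω : Faults V (T + 1)) _ => ?_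
  have : bernWeight (fun _ => p) ω =
      bernWeight (fun _ => p) ω.init * bernWeight (fun _ => p) ω.last := by
    simp only [bernWeight, Fintype.prod_prod_type, Fin.prod_univ_castSucc, Faults.init,
      Faults.last]
    rfl
  simp only [Faults.equiv, Equiv.coe_fn_mk, this]
  ring

end Faults
/-! ### A family of sender sets that isolates a sender in every neighbourhood -/

/-- Under a uniform `f` the nodes with `(f u).val < K` are independent picks of probability `K / M`.
The events that `u` is the only pick in `A` are disjoint for different `u`, and each is a product
set. Counting functions derandomizes the picks: all outcomes are listed instead of sampled. -/
lemma card_isolating_functions {V : Type} [Fintype V] (M K : ℕ) (hKM : K ≤ M) (hM : 0 < M)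
    (A : Finset V) :
    ((Finset.univ.filter fun f : V → Fin M => ∃! u, u ∈ A ∧ (f u).val < K).card : ℝ) =
      (M : ℝ) ^ Fintype.card V * (A.card * (K / M : ℝ) * (1 - K / M : ℝ) ^ (A.card - 1)) := by
  have hM' : (M : ℝ) ≠ 0 := by positivity
  let c : V → V → Finset (Fin M) := fun u w =>
    if w = u then Finset.univ.filter fun x => x.val < K
    else if w ∈ A then Finset.univ.filter fun x => ¬ x.val < K else Finset.univ
  have hlt : ((Finset.univ.filter fun x : Fin M => x.val < K).card : ℝ) = M * (K / M) := by
    rw [Fin.card_filter_val_lt, min_eq_right hKM]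
    field_simp
  have hge : ((Finset.univ.filter fun x : Fin M => ¬ x.val < K).card : ℝ) = M * (1 - K / M) := by
    have h := Finset.card_filter_add_card_filter_not (s := (Finset.univ : Finset (Fin M)))
      (fun x => x.val < K)
    have h' : ((Finset.univ.filter fun x : Fin M => x.val < K).card : ℝ) +
        ((Finset.univ.filter fun x : Fin M => ¬ x.val < K).card : ℝ) = M := by
      rw [← Nat.cast_add, h]; simp
    rw [hlt] at h'
    linarith
  have hunion : (Finset.univ.filter fun f : V → Fin M => ∃! u, u ∈ A ∧ (f u).val < K) =
      A.biUnion fun u => Fintype.piFinset (c u) := by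
    ext f
    simp only [Finset.mem_filter, Finset.mem_univ, true_and, Finset.mem_biUnion,
      Fintype.mem_piFinset, c]
    constructor
    · rintro ⟨u, ⟨hu, hfu⟩, huniq⟩
      refine ⟨u, hu, fun w => ?_⟩
      by_cases hw : w = u
      · simpa [hw] using hfu
      · by_cases hwA : w ∈ A
        · simp only [hw, hwA, if_true, if_false, Finset.mem_filter, Finset.mem_univ, true_and]
          exact fun h => hw (huniq w ⟨hwA, h⟩)
        · simp [hw, hwA]
    · rintro ⟨u, hu, h⟩
      refine ⟨u, ⟨hu, by simpa using h u⟩, ?_⟩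
      rintro w ⟨hwA, hw⟩
      by_contra hne
      have := h w
      simp [hne, hwA] at this
      omega
  have hdisj : ∀ u ∈ A, ∀ u' ∈ A, u ≠ u' →
      Disjoint (Fintype.piFinset (c u)) (Fintype.piFinset (c u')) := by
    intro u _ u' hu' hne
    rw [Finset.disjoint_left]
    intro f hf hf'
    rw [Fintype.mem_piFinset] at hf hf'
    have h1 := hf u'
    have h2 := hf' u'
    simp [c, hne.symm, hu'] at h1 h2
    omega
  have hcard : ∀ u ∈ A, ((Fintype.piFinset (c u)).card : ℝ) =
      (M : ℝ) ^ Fintype.card V * ((K / M : ℝ) * (1 - K / M : ℝ) ^ (A.card - 1)) := by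
    intro u hu
    rw [Fintype.card_piFinset, Nat.cast_prod]
    have : ∀ w, ((c u w).card : ℝ) = M * ((if w ∈ ({u} : Finset V) then (K / M : ℝ) else 1) *
        (if w ∈ A.erase u then (1 - K / M : ℝ) else 1)) := by
      intro w
      by_cases hw : w = u
      · subst hw
        simpa [c] using hlt
      · by_cases hwA : w ∈ A
        · simpa [c, hw, hwA] using hge
        · simp [c, hw, hwA]
    simp only [this, Finset.prod_mul_distrib, Finset.prod_ite_mem, Finset.univ_inter,
      Finset.prod_const, Finset.card_singleton, Finset.card_erase_of_mem hu, Finset.card_univ,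
      pow_one]
  rw [hunion, Finset.card_biUnion hdisj, Nat.cast_sum, Finset.sum_congr rfl hcard]
  simp only [Finset.sum_const, nsmul_eq_mul]
  ring

/-- The reciprocal of the fraction of rounds in which a neighbourhood is isolated. -/
def decayConst (n : ℕ) : ℕ := 8 * (Nat.log 2 n + 1)

/-- The list runs through all pairs of a density exponent and a picking function. Only the exponent
`Nat.log 2 |A|` is exploited: its density `q` satisfies 1/4 ≤ |A|q ≤ 1/2, which isolates a node with
probability at least 1/8. The other factor of `decayConst` is the number of exponents. -/
theorem exists_decay_family (V : Type) [Fintype V] [Nonempty V] :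
    ∃ (Q : ℕ) (S : ℕ → Set V), 0 < Q ∧ ∀ A : Set V, A.Nonempty →
      Q ≤ decayConst (Fintype.card V) *
        ((Finset.range Q).filter fun w => ∃! u, u ∈ A ∧ u ∈ S w).card := by
  set lg := Nat.log 2 (Fintype.card V) with hlg
  -- A common denominator of all densities: `2 ^ (lg - i) / M` equals `1 / (4 * 2 ^ i)`.
  set M := 2 ^ (lg + 2) with hM
  have hMpos : 0 < M := by positivity
  let Om := Fin (lg + 1) × (V → Fin M)
  let S0 : Om → Set V := fun x => {v | (x.2 v).val < 2 ^ (lg - x.1.val)}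
  have : Nonempty (Fin M) := ⟨⟨0, hMpos⟩⟩
  let e := Fintype.equivFin Om
  have hcardOm : Fintype.card Om = (lg + 1) * M ^ Fintype.card V := by simp [Om]
  refine ⟨Fintype.card Om, fun w => if h : w < Fintype.card Om then S0 (e.symm ⟨w, h⟩) else ∅,
    Fintype.card_pos, fun A hA => ?_⟩
  have hcount : ((Finset.range (Fintype.card Om)).filter fun w => ∃! u, u ∈ A ∧
      u ∈ (if h : w < Fintype.card Om then S0 (e.symm ⟨w, h⟩) else ∅)).card =
      (Finset.univ.filter fun x : Om => ∃! u, u ∈ A ∧ u ∈ S0 x).card := by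
    symm
    refine Finset.card_bij (fun x _ => (e x).val) ?_ ?_ ?_
    · intro x hx
      simpa using hx
    · intro x _ y _ h
      exact e.injective (Fin.ext h)
    · intro w hw
      simp only [Finset.mem_filter, Finset.mem_range] at hw
      obtain ⟨hlt, h⟩ := hw
      simp only [hlt, dif_pos] at h
      exact ⟨e.symm ⟨w, hlt⟩, by simpa using h, by simp⟩
  rw [hcount]
  set a := A.toFinset.card with ha
  have hapos : 1 ≤ a := by
    rw [ha, Nat.one_le_iff_ne_zero, Finset.card_ne_zero]
    simpa using hA
  have hale : a ≤ Fintype.card V := Finset.card_le_univ _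
  set i := Nat.log 2 a with hi
  have hilg : i ≤ lg := Nat.log_mono_right hale
  have h1 : 2 ^ i ≤ a := Nat.pow_log_le_self 2 (by omega)
  have h2 : a < 2 ^ (i + 1) := Nat.lt_pow_succ_log_self (by norm_num) a
  have hsub : (Finset.univ.filter fun f : V → Fin M =>
      ∃! u, u ∈ A.toFinset ∧ (f u).val < 2 ^ (lg - i)).card ≤
      (Finset.univ.filter fun x : Om => ∃! u, u ∈ A ∧ u ∈ S0 x).card := by
    refine Finset.card_le_card_of_injOn (fun f => (⟨i, by omega⟩, f)) ?_ ?_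
    · intro f hf
      simpa [S0] using hf
    · intro f _ g _ h
      exact (Prod.ext_iff.mp h).2
  have hKM : 2 ^ (lg - i) ≤ M := Nat.pow_le_pow_right (by norm_num) (by omega)
  have hc := card_isolating_functions M (2 ^ (lg - i)) hKM hMpos A.toFinset
  rw [← ha] at hc
  set q : ℝ := ((2 ^ (lg - i) : ℕ) : ℝ) / (M : ℝ) with hq
  have hq' : q * (4 * 2 ^ i) = 1 := by
    rw [hq, hM]
    push_cast
    have : (2 : ℝ) ^ (lg + 2) = 2 ^ (lg - i) * (4 * 2 ^ i) := by
      rw [show (4 : ℝ) = 2 ^ 2 by norm_num, ← pow_add, ← pow_add]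
      congr 1; omega
    rw [this]
    field_simp
  have hq0 : 0 < q := by positivity
  have hq1 : q ≤ 1 := by
    have : (1 : ℝ) ≤ 2 ^ i := one_le_pow₀ (by norm_num)
    nlinarith
  have h1' : (2 : ℝ) ^ i ≤ a := by exact_mod_cast h1
  have h2' : (a : ℝ) ≤ 2 * 2 ^ i := by
    have : (a : ℝ) ≤ 2 ^ (i + 1) := by exact_mod_cast h2.le
    rw [pow_succ] at this; linarith
  have haq1 : 1 / 4 ≤ a * q := by nlinarith
  have haq2 : a * q ≤ 1 / 2 := by nlinarith
  -- Bernoulli's inequality together with `a * q ≤ 1 / 2`.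
  have hbern : 1 / 2 ≤ (1 - q) ^ (a - 1) := by
    have := one_add_mul_le_pow (a := -q) (by linarith) (a - 1)
    rw [← sub_eq_add_neg, Nat.cast_sub hapos] at this
    push_cast at this
    nlinarith
  have hmain : (1 / 8 : ℝ) ≤ a * q * (1 - q) ^ (a - 1) := by
    calc (1 / 8 : ℝ) = 1 / 4 * (1 / 2) := by norm_num
      _ ≤ _ := mul_le_mul haq1 hbern (by norm_num) (by linarith)
  have hlow : (M : ℝ) ^ Fintype.card V ≤ 8 * ((Finset.univ.filter fun f : V → Fin M =>
      ∃! u, u ∈ A.toFinset ∧ (f u).val < 2 ^ (lg - i)).card : ℝ) := by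
    rw [hc]
    have : (0 : ℝ) < (M : ℝ) ^ Fintype.card V := by positivity
    nlinarith
  have hlow' : M ^ Fintype.card V ≤ 8 * (Finset.univ.filter fun f : V → Fin M =>
      ∃! u, u ∈ A.toFinset ∧ (f u).val < 2 ^ (lg - i)).card := by
    exact_mod_cast hlow
  rw [hcardOm, decayConst]
  calc (lg + 1) * M ^ Fintype.card V ≤ (lg + 1) * (8 * _) := Nat.mul_le_mul_left _ hlow'
    _ ≤ (lg + 1) * (8 * (Finset.univ.filter fun x : Om => ∃! u, u ∈ A ∧ u ∈ S0 x).card) := by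
        gcongr
    _ = _ := by ring

/-! ### Layers -/

section Layers

variable {V : Type}

/-- The distance from the source, as far as broadcasting is concerned. -/
structure IsLayering (G : SimpleGraph V) (s : V) (lay : V → ℕ) : Prop where
  eq_source : ∀ u, lay u = 0 → u = s
  adj : ∀ u v, G.Adj u v → lay u ≤ lay v + 1
  pred : ∀ v, v ≠ s → ∃ u, G.Adj v u ∧ lay u + 1 = lay v

lemma isLayering_dist {G : SimpleGraph V} (hG : G.Connected) (s : V) :
    IsLayering G s (G.dist s) := by
  have hadj : ∀ u v, G.Adj u v → G.dist s u ≤ G.dist s v + 1 := by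
    intro u v h
    have h1 := hG.dist_triangle (u := s) (v := v) (w := u)
    have h2 : G.dist v u = 1 := SimpleGraph.dist_eq_one_iff_adj.mpr h.symm
    omega
  refine ⟨fun u h => ((hG.dist_eq_zero_iff).mp h).symm, hadj, fun v hv => ?_⟩
  obtain ⟨w, hw⟩ := hG.exists_walk_length_eq_dist v s
  cases w with
  | nil => exact absurd rfl hv
  | cons h w' =>
    rename_i u
    refine ⟨u, h, ?_⟩
    have h1 := hadj v u h
    have h2 := SimpleGraph.dist_le w'
    rw [SimpleGraph.Walk.length_cons, SimpleGraph.dist_comm] at hw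
    rw [SimpleGraph.dist_comm] at h2
    omega

/-- Exactly one node of `S` is a neighbour of `v` in the preceding layer. -/
def Isolated (G : SimpleGraph V) (lay : V → ℕ) (S : Set V) (v : V) : Prop :=
  ∃! u, (G.Adj v u ∧ lay u + 1 = lay v) ∧ u ∈ S

lemma receive_eq_some {α : Type} {G : SimpleGraph V} {tx : V → Option α} {v u : V} {x : α}
    (hv : tx v = none) (hadj : G.Adj v u) (hu : tx u = some x)
    (huniq : ∀ w, G.Adj v w → (tx w).isSome → w = u) : receive G tx v = some x := by
  have h : tx v = none ∧ ∃! u, G.Adj v u ∧ (tx u).isSome :=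
    ⟨hv, u, ⟨hadj, by simp [hu]⟩, fun w hw => huniq w hw.1 hw.2⟩
  have hc : h.2.choose = u := huniq _ h.2.choose_spec.1.1 h.2.choose_spec.1.2
  rw [receive, dif_pos h, hc, hu]

lemma exists_of_receive_eq_some {α : Type} {G : SimpleGraph V} {tx : V → Option α} {v : V} {x : α}
    (h : receive G tx v = some x) :
    tx v = none ∧ ∃ u, G.Adj v u ∧ tx u = some x ∧
      ∀ w, G.Adj v w → (tx w).isSome → w = u := by
  unfold receive at h
  split_ifs at h with h'
  exact ⟨h'.1, h'.2.choose, h'.2.choose_spec.1.1, h,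
    fun w h1 h2 => h'.2.choose_spec.2 w ⟨h1, h2⟩⟩

variable {G : SimpleGraph V} {s : V} {lay : V → ℕ}

/-- If only every third layer broadcasts, the layers do not interfere. -/
lemma IsLayering.lay_eq_of_adj (hl : IsLayering G s lay) {α : Type} {tx : V → Option α} {v w : V}
    {d : ℕ} (hv : lay v = d + 1) (htx : ∀ u, lay u % 3 ≠ d % 3 → tx u = none)
    (hadj : G.Adj v w) (hw : (tx w).isSome) : lay w = d := by
  -- Adjacent layers differ by at most one, so `w` lies in layer d, d+1 or d+2, and these have
  -- distinct residues modulo 3.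
  have h1 := hl.adj v w hadj
  have h2 := hl.adj w v hadj.symm
  have h3 : lay w % 3 = d % 3 := by
    by_contra h
    simp [htx w h] at hw
  omega

end Layers

/-! ### Timing: epochs, and rounds within an epoch -/

/-- The round in which a layer `d` performs the `τ`-th step of epoch `e`, when an epoch has `ℓ`
steps. -/
def roundOf (ℓ e τ d : ℕ) : ℕ := 3 * (e * ℓ + τ) + d % 3

lemma roundOf_div {ℓ e τ d : ℕ} (hτ : τ < ℓ) : roundOf ℓ e τ d / 3 / ℓ = e := by
  have h : roundOf ℓ e τ d / 3 = τ + ℓ * e := by unfold roundOf; rw [mul_comm ℓ e]; omega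
  rw [h, Nat.add_mul_div_left _ _ (by omega), Nat.div_eq_of_lt hτ, zero_add]

lemma roundOf_mod {ℓ e τ d : ℕ} (hτ : τ < ℓ) : roundOf ℓ e τ d / 3 % ℓ = τ := by
  have h : roundOf ℓ e τ d / 3 = τ + ℓ * e := by unfold roundOf; rw [mul_comm ℓ e]; omega
  rw [h, Nat.add_mul_mod_self_left, Nat.mod_eq_of_lt hτ]

lemma roundOf_mod_three (ℓ e τ d : ℕ) : roundOf ℓ e τ d % 3 = d % 3 := by
  unfold roundOf; omega

lemma le_roundOf (ℓ e τ d : ℕ) : 3 * (e * ℓ) ≤ roundOf ℓ e τ d := by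
  unfold roundOf; omega

lemma roundOf_lt {ℓ e τ : ℕ} (d : ℕ) (hτ : τ < ℓ) : roundOf ℓ e τ d < 3 * ((e + 1) * ℓ) := by
  have h : (e + 1) * ℓ = e * ℓ + ℓ := by ring
  unfold roundOf; omega

/-! ### A maximum distance separable code -/

/-- Reed-Solomon codes: codewords of different messages agree in less than `B` positions. -/
lemma exists_mds_code {L B ℓ : ℕ} (hL : L ≠ 0) (hℓ : ℓ ≤ 2 ^ L) :
    ∃ enc : (Fin B → Bits L) → ℕ → Bits L, ∀ x y,
      B ≤ ((Finset.range ℓ).filter fun τ => enc x τ = enc y τ).card → x = y := by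
  have : Fact (Nat.Prime 2) := ⟨Nat.prime_two⟩
  -- A block is read as the coefficients of a polynomial of degree less than `B` over the field with
  -- 2^L elements. Symbol `τ` is its value at the point `α τ`; these points are distinct for `τ < ℓ`
  -- because `ℓ ≤ 2 ^ L`.
  let F := GaloisField 2 L
  have : Fintype F := Fintype.ofFinite F
  have hcard : Fintype.card F = 2 ^ L := by
    rw [← Nat.card_eq_fintype_card]; exact GaloisField.card 2 L hL
  let e : Bits L ≃ F := Fintype.equivOfCardEq (by rw [hcard]; simp)
  let α : ℕ → F := fun τ =>
    if h : τ < Fintype.card F then (Fintype.equivFin F).symm ⟨τ, h⟩ else 0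
  have hα : ∀ i < ℓ, ∀ j < ℓ, α i = α j → i = j := by
    intro i hi j hj h
    have hi' : i < Fintype.card F := by omega
    have hj' : j < Fintype.card F := by omega
    simp only [α, hi', hj', dif_pos] at h
    simpa using (Fintype.equivFin F).symm.injective h
  refine ⟨fun x τ => e.symm (∑ i : Fin B, α τ ^ (i : ℕ) * e (x i)), fun x y h => ?_⟩
  let g := Finset.orderEmbOfCardLe _ h
  have hg : ∀ i, g i < ℓ ∧ (∑ k : Fin B, α (g i) ^ (k : ℕ) * e (x k)) =
      ∑ k : Fin B, α (g i) ^ (k : ℕ) * e (y k) := by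
    intro i
    have := Finset.orderEmbOfCardLe_mem _ h i
    rw [Finset.mem_filter, Finset.mem_range] at this
    exact ⟨this.1, e.symm.injective this.2⟩
  -- The difference polynomial vanishes at `B` distinct points, so the Vandermonde determinant
  -- forces it to be zero.
  have hv := Matrix.eq_zero_of_forall_index_sum_pow_mul_eq_zero (R := F)
    (f := fun i => α (g i)) (v := fun i => e (x i) - e (y i))
    (fun i j hij => g.injective (hα _ (hg i).1 _ (hg j).1 hij))
    (fun i => by simp only [mul_sub, Finset.sum_sub_distrib, (hg i).2, sub_self])
  ext1 i
  exact e.injective (sub_eq_zero.mp (congrFun hv i))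

/-! ### The coding schedule -/

section CodingSchedule

/-- Histories list the latest round first, so position `r` of the reversed list is round `r`. Faults
are given by a function `F` on all rounds, which lets histories of different lengths share one fault
pattern. -/
lemma history_reverse_getElem? {V M P : Type} {k : ℕ} (G : SimpleGraph V) (s : V)
    (S : CodingSchedule V M P k)
    (m : Fin k → M) (F : ℕ → V → Bool) (T r : ℕ) (hr : r < T) (v : V) :
    (history G s S m T (fun x => F x.1 x.2) v).reverse[r]? =
      some (noisyReceive G (fun u => S.send r u (initialKnowledge s m u)
        (history G s S m r (fun x => F x.1 x.2) u)) (F r) v) := by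
  have hlen : ∀ T, (history G s S m T (fun x => F x.1 x.2) v).length = T := by
    intro T
    induction T with
    | zero => rfl
    | succ T ih => exact congrArg (· + 1) ih
  induction T with
  | zero => omega
  | succ T ih =>
    have hstep : history G s S m (T + 1) (fun x => F x.1 x.2) v =
        noisyReceive G (fun u => S.send T u (initialKnowledge s m u)
          (history G s S m T (fun x => F x.1 x.2) u)) (F T) v ::
          history G s S m T (fun x => F x.1 x.2) v := rfl
    rw [hstep, List.reverse_cons]
    rcases Nat.lt_succ_iff_lt_or_eq.mp hr with h | h
    · rw [List.getElem?_append_left (by simpa [hlen] using h), ih h]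
    · subst h
      rw [List.getElem?_append_right (by simp [hlen])]
      simp [hlen]

variable {V M P : Type} {k : ℕ} [Inhabited M]

/-- The `j`-th batch of `B` messages. -/
def batchOf (B : ℕ) (m : Fin k → M) (j : ℕ) : Fin B → M :=
  fun t => if h : j * B + t.val < k then m ⟨j * B + t.val, h⟩ else default

/-- The `j`-th batch is consistent with the packets that a node of layer `d + 1` has received in
epoch `j + d`. -/
def Consistent {B : ℕ} (ℓ d j : ℕ) (enc : (Fin B → M) → ℕ → M) (emb : M → P)
    (h : List (Option P)) (x : Fin B → M) : Prop :=
  ∀ τ < ℓ, ∀ y : P, h.reverse[roundOf ℓ (j + d) τ d]? = some (some y) → y = emb (enc x τ)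

/-- What a node of layer `d` takes to be the `j`-th batch. -/
def batchEstimate {B : ℕ} (ℓ d : ℕ) (enc : (Fin B → M) → ℕ → M) (emb : M → P)
    (m : Option (Fin k → M)) (h : List (Option P)) (j : ℕ) : Fin B → M :=
  match m with
  | some m => batchOf B m j
  | none => if hx : ∃ x, Consistent ℓ (d - 1) j enc emb h x then hx.choose else default

/-- In epoch `e` the layer `d` sends the codeword of batch `e - d`, restricted to a prescribed
sequence `S` of sender sets. -/
def layeredCoding {B : ℕ} (hB : 0 < B) (ℓ : ℕ) (lay : V → ℕ) (S : ℕ → Set V)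
    (enc : (Fin B → M) → ℕ → M) (emb : M → P) : CodingSchedule V M P k where
  send r u m h :=
    if lay u % 3 = r % 3 ∧ u ∈ S (r / 3 % ℓ) then
      -- The subtraction truncates: before epoch `lay u` the node sends an unfounded estimate of
      -- batch 0. This is harmless, because layer `d + 1` evaluates only epochs `j + d` with `j ≥
      -- 0`.
      some (emb (enc (batchEstimate ℓ (lay u) enc emb m h (r / 3 / ℓ - lay u)) (r / 3 % ℓ)))
    else none
  decode u m h i :=
    batchEstimate ℓ (lay u) enc emb m h (i.val / B) ⟨i.val % B, Nat.mod_lt _ hB⟩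

variable {G : SimpleGraph V} {s : V} {lay : V → ℕ}

/-- The estimates of the layered schedule are correct if every node of a layer hears at least `B`
symbols of the preceding layer in every epoch. -/
lemma batchEstimate_eq (hl : IsLayering G s lay) {B ℓ E J : ℕ} (hB : 0 < B) (S : ℕ → Set V)
    (enc : (Fin B → M) → ℕ → M)
    (henc : ∀ x y, B ≤ ((Finset.range ℓ).filter fun τ => enc x τ = enc y τ).card → x = y)
    (emb : M → P) (hemb : Function.Injective emb) (m : Fin k → M) (F : ℕ → V → Bool)
    (hF : ∀ v, v ≠ s → ∀ e < E, B ≤ ((Finset.range ℓ).filter fun τ =>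
      Isolated G lay (S τ) v ∧ F (roundOf ℓ e τ (lay v - 1)) v = false).card)
    (hE : ∀ v, J + lay v ≤ E) (d : ℕ) :
    ∀ u, lay u = d → ∀ j < J, ∀ T, 3 * ((j + d) * ℓ) ≤ T →
      batchEstimate ℓ d enc emb (initialKnowledge s m u)
        (history G s (layeredCoding hB ℓ lay S enc emb) m T (fun x => F x.1 x.2) u) j =
        batchOf B m j := by
  induction d with
  | zero =>
    intro u hu j _ T _
    simp [initialKnowledge, hl.eq_source u hu, batchEstimate]
  | succ d ih =>
    intro v hv j hj T hT
    -- `IsLayering` does not place the source in layer 0, so the source has to be treated separately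
    -- in positive layers.
    have hvs : v ≠ s ∨ v = s := by tauto
    rcases hvs with hvs | hvs
    swap
    · simp [initialKnowledge, hvs, batchEstimate]
    set C : CodingSchedule V M P k := layeredCoding hB ℓ lay S enc emb with hC
    have hlt : ∀ τ < ℓ, roundOf ℓ (j + d) τ d < T := fun τ hτ =>
      lt_of_lt_of_le (roundOf_lt d hτ) (by rw [add_assoc]; exact hT)
    let tx : ℕ → V → Option P := fun r u => C.send r u (initialKnowledge s m u)
        (history G s C m r (fun x => F x.1 x.2) u)
    have htx : ∀ r u, tx r u = if lay u % 3 = r % 3 ∧ u ∈ S (r / 3 % ℓ) then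
        some (emb (enc (batchEstimate ℓ (lay u) enc emb (initialKnowledge s m u)
          (history G s C m r (fun x => F x.1 x.2) u) (r / 3 / ℓ - lay u)) (r / 3 % ℓ)))
        else none := fun _ _ => rfl
    have hsilent : ∀ τ, ∀ u, lay u % 3 ≠ d % 3 → tx (roundOf ℓ (j + d) τ d) u = none := by
      intro τ u hu
      rw [htx, roundOf_mod_three, if_neg (fun h => hu h.1)]
    have hsend : ∀ τ < ℓ, ∀ u, lay u = d → u ∈ S τ →
        tx (roundOf ℓ (j + d) τ d) u = some (emb (enc (batchOf B m j) τ)) := by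
      intro τ hτ u hu huS
      have hest := ih u hu j hj (roundOf ℓ (j + d) τ d) (le_roundOf _ _ _ _)
      rw [htx, roundOf_mod_three, roundOf_mod hτ, roundOf_div hτ, if_pos ⟨by rw [hu], huS⟩, hu,
        Nat.add_sub_cancel, hest]
    have hmem : ∀ τ < ℓ, ∀ u, lay u = d → (tx (roundOf ℓ (j + d) τ d) u).isSome → u ∈ S τ := by
      intro τ hτ u hu h
      by_contra hn
      rw [htx, roundOf_mod hτ, if_neg (fun h => hn h.2)] at h
      simp at h
    have hget : ∀ τ < ℓ,
        (history G s C m T (fun x => F x.1 x.2) v).reverse[roundOf ℓ (j + d) τ d]? =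
        some (noisyReceive G (tx (roundOf ℓ (j + d) τ d)) (F (roundOf ℓ (j + d) τ d)) v) :=
      fun τ hτ => history_reverse_getElem? G s C m F T _ (hlt τ hτ) v
    -- Whatever `v` hears in these rounds comes from layer `d`, which by induction already encodes
    -- the true batch.
    have htrue : Consistent ℓ d j enc emb (history G s C m T (fun x => F x.1 x.2) v)
        (batchOf B m j) := by
      intro τ hτ y hy
      rw [hget τ hτ, Option.some_inj, noisyReceive] at hy
      split_ifs at hy
      obtain ⟨-, u, hadj, hu, -⟩ := exists_of_receive_eq_some hy
      have hlu : lay u = d := hl.lay_eq_of_adj hv (hsilent τ) hadj (by simp [hu])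
      have := hsend τ hτ u hlu (hmem τ hτ u hlu (by simp [hu]))
      rw [hu] at this
      exact Option.some_inj.mp this
    -- In each isolated, fault-free step `v` hears the true symbol. A consistent `x` therefore
    -- agrees with the true codeword in at least `B` positions, and the code separates the two
    -- otherwise.
    have huniq : ∀ x, Consistent ℓ d j enc emb (history G s C m T (fun x => F x.1 x.2) v) x →
        x = batchOf B m j := by
      intro x hx
      refine henc _ _ ((hF v hvs (j + d) (by have := hE v; omega)).trans
        (Finset.card_le_card ?_))
      intro τ hτ
      simp only [Finset.mem_filter, Finset.mem_range, hv, Nat.add_sub_cancel] at hτ ⊢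
      obtain ⟨hτ, ⟨u, ⟨⟨hadj, hlu⟩, huS⟩, hu⟩, hfault⟩ := hτ
      have hlu : lay u = d := by omega
      have hrec : receive G (tx (roundOf ℓ (j + d) τ d)) v =
          some (emb (enc (batchOf B m j) τ)) := by
        refine receive_eq_some (hsilent τ v (by omega)) hadj (hsend τ hτ u hlu huS) ?_
        intro w hw hws
        have hlw := hl.lay_eq_of_adj hv (hsilent τ) hw hws
        exact hu w ⟨⟨hw, by omega⟩, hmem τ hτ w hlw hws⟩
      refine ⟨hτ, hemb ?_⟩
      refine (hx τ hτ _ ?_).symm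
      rw [hget τ hτ, noisyReceive, hfault, hrec]
      simp
    have hex : ∃ x, Consistent ℓ (d + 1 - 1) j enc emb
        (history G s C m T (fun x => F x.1 x.2) v) x := ⟨_, htrue⟩
    simp only [initialKnowledge, hvs, if_false, batchEstimate]
    rw [dif_pos hex]
    exact huniq _ hex.choose_spec

lemma layeredCoding_decode (hl : IsLayering G s lay) {B ℓ E J : ℕ} (hB : 0 < B) (S : ℕ → Set V)
    (enc : (Fin B → M) → ℕ → M)
    (henc : ∀ x y, B ≤ ((Finset.range ℓ).filter fun τ => enc x τ = enc y τ).card → x = y)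
    (emb : M → P) (hemb : Function.Injective emb) (m : Fin k → M) (F : ℕ → V → Bool)
    (hF : ∀ v, v ≠ s → ∀ e < E, B ≤ ((Finset.range ℓ).filter fun τ =>
      Isolated G lay (S τ) v ∧ F (roundOf ℓ e τ (lay v - 1)) v = false).card)
    (hE : ∀ v, J + lay v ≤ E) (hk : k ≤ J * B) (u : V) :
    (layeredCoding hB ℓ lay S enc emb).decode u (initialKnowledge s m u)
      (history G s (layeredCoding hB ℓ lay S enc emb) m (3 * (E * ℓ))
        (fun x => F x.1 x.2) u) = m := by
  ext1 i
  have hi : i.val / B < J := by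
    rw [Nat.div_lt_iff_lt_mul hB]; omega
  have h := batchEstimate_eq hl hB S enc henc emb hemb m F hF hE (lay u) u rfl (i.val / B) hi
    (3 * (E * ℓ)) (by
      have := hE u
      exact Nat.mul_le_mul_left _ (Nat.mul_le_mul_right _ (by omega)))
  change batchEstimate ℓ (lay u) enc emb _ _ (i.val / B) ⟨i.val % B, Nat.mod_lt _ hB⟩ = m i
  rw [h, batchOf]
  have hdm : i.val / B * B + i.val % B = i.val := Nat.div_add_mod' _ _
  simp only [hdm]
  rw [dif_pos i.isLt]

end CodingSchedule
/-! ### Feasibility of layered coding -/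

/-- Chernoff bound: give every fault-free trial the weight 1/2. One trial has mean weight p +
(1-p)/2 = (1+p)/2, and fewer than `B` fault-free trials leave a product of at least 2^(-B). -/
lemma bernoulliProb_few_false {ι : Type} [Fintype ι] {p : ℝ} (hp0 : 0 ≤ p) (hp1 : p ≤ 1)
    (s : Finset ι) (B : ℕ) :
    bernoulliProb (fun _ => p) {ω : ι → Bool | (s.filter fun x => ω x = false).card < B} ≤
      2 ^ B * ((1 + p) / 2) ^ s.card := by
  have h := bernExp_prod_finset (fun _ : ι => p) s (fun _ c => if c then (1 : ℝ) else 1 / 2)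
  have h' : ((1 + p) / 2) ^ s.card =
      bernExp (fun _ : ι => p) (fun ω => ∏ i ∈ s, if ω i then (1 : ℝ) else 1 / 2) := by
    rw [h, Finset.prod_const]
    congr 1
    simp
    ring
  rw [h', ← bernExp_const_mul]
  refine bernoulliProb_le_bernExp (fun _ => hp0) (fun _ => hp1) (fun ω => ?_) (fun ω hω => ?_)
  · refine mul_nonneg (by positivity) (Finset.prod_nonneg fun i _ => ?_)
    split_ifs <;> norm_num
  · have hprod : ∏ i ∈ s, (if ω i then (1 : ℝ) else 1 / 2) =
        (1 / 2) ^ (s.filter fun x => ω x = false).card := by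
      rw [← Finset.prod_const, Finset.prod_filter]
      refine Finset.prod_congr rfl fun i _ => ?_
      cases ω i <;> simp
    rw [hprod]
    set c := (s.filter fun x => ω x = false).card with hc
    have hcB : c ≤ B := le_of_lt hω
    calc (1 : ℝ) = 2 ^ c * (1 / 2) ^ c := by rw [← mul_pow]; norm_num
      _ ≤ 2 ^ B * (1 / 2) ^ c := by
        gcongr
        norm_num

lemma card_filter_periodic (Q w : ℕ) (φ : ℕ → Prop) :
    ((Finset.range (Q * w)).filter fun τ => φ (τ % Q)).card =
      w * ((Finset.range Q).filter φ).card := by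
  induction w with
  | zero => simp
  | succ w ih =>
    simp only [Finset.card_filter] at ih ⊢
    rw [mul_add, mul_one, Finset.sum_range_add, ih, add_mul, one_mul]
    congr 1
    refine Finset.sum_congr rfl fun τ hτ => ?_
    rw [Nat.mul_add_mod, Nat.mod_eq_of_lt (Finset.mem_range.mp hτ)]

/-- Repeating a family of sender sets isolates every node sufficiently often. -/
lemma exists_isolating_sequence {V : Type} [Fintype V] [Nonempty V] (G : SimpleGraph V) (s : V)
    {lay : V → ℕ} (hl : IsLayering G s lay) :
    ∃ (Q : ℕ) (S : ℕ → Set V), 0 < Q ∧ ∀ c t : ℕ, ∀ v, v ≠ s →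
      c * (Q * t) ≤ ((Finset.range (c * decayConst (Fintype.card V) * (Q * t))).filter fun τ =>
        Isolated G lay (S τ) v).card := by
  obtain ⟨Q, S, hQ, hS⟩ := exists_decay_family V
  refine ⟨Q, fun τ => S (τ % Q), hQ, fun c t v hv => ?_⟩
  have h := hS {u | G.Adj v u ∧ lay u + 1 = lay v} (hl.pred v hv)
  have hc := card_filter_periodic Q (c * decayConst (Fintype.card V) * t)
    (fun τ => Isolated G lay (S τ) v)
  rw [show c * decayConst (Fintype.card V) * (Q * t) =
    Q * (c * decayConst (Fintype.card V) * t) by ring, hc]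
  calc c * (Q * t) = c * t * Q := by ring
    _ ≤ c * t * (decayConst (Fintype.card V) *
        ((Finset.range Q).filter fun w => Isolated G lay (S w) v).card) :=
      Nat.mul_le_mul_left _ h
    _ = _ := by ring

lemma exists_bits_embedding {L L' : ℕ} (h : L ≤ L') :
    ∃ emb : Bits L → Bits L', Function.Injective emb := by
  have : Fintype.card (Bits L) ≤ Fintype.card (Bits L') := by
    simpa using Nat.pow_le_pow_right (by norm_num) h
  exact ⟨_, (Function.Embedding.nonempty_of_card_le this).some.injective⟩

/-- With batches of size B = Qt and `c * decayConst * B` steps per epoch, every node other than the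
source is isolated at least cB times per epoch. It gets fewer than B symbols with probability at
most 2^B (1/4)^B = 2^(-B). The union bound runs over the nodes and the J + D epochs that J batches
need to traverse D layers. The condition on `2 ^ bitLength` provides enough evaluation points for
the code. -/
theorem codingFeasible_of_layering {V : Type} [Fintype V] [Nonempty V] {G : SimpleGraph V} {s : V}
    {lay : V → ℕ} (hl : IsLayering G s lay) {D : ℕ} (hD : ∀ v, lay v ≤ D)
    {p a b : ℝ} (hp0 : 0 ≤ p) (hp1 : p ≤ 1) (hab : a ≤ b)
    {c : ℕ} (hc : ((1 + p) / 2) ^ c ≤ 1 / 4) :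
    ∃ Q : ℕ, 0 < Q ∧ ∀ t J : ℕ, 0 < t →
      bitLength a (Fintype.card V) (J * (Q * t)) ≠ 0 →
      c * decayConst (Fintype.card V) * (Q * t) ≤
        2 ^ bitLength a (Fintype.card V) (J * (Q * t)) →
      (Fintype.card V * (J + D) : ℝ) * (1 / 2) ^ (Q * t) ≤ 1 / ((J * (Q * t) : ℕ) : ℝ) →
      CodingFeasible G s p a b (J * (Q * t))
        (3 * ((J + D) * (c * decayConst (Fintype.card V) * (Q * t)))) := by
  obtain ⟨Q, S, hQ, hS⟩ := exists_isolating_sequence G s hl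
  refine ⟨Q, hQ, fun t J ht hbits hfield hfail => ?_⟩
  set B := Q * t with hB
  have hBpos : 0 < B := by positivity
  set k := J * B with hk
  set n := Fintype.card V with hn
  set ℓ := c * decayConst n * B with hℓ
  set T := 3 * ((J + D) * ℓ) with hT
  obtain ⟨enc, henc⟩ := exists_mds_code (B := B) hbits hfield
  have hlog : 0 ≤ Real.logb 2 ((n : ℝ) * (k : ℝ)) := by
    rcases Nat.eq_zero_or_pos (n * k) with h | h
    · have : (n : ℝ) * (k : ℝ) = 0 := by exact_mod_cast h
      simp [this]
    · exact Real.logb_nonneg (by norm_num) (by exact_mod_cast h)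
  obtain ⟨emb, hemb⟩ := exists_bits_embedding (L := bitLength a n k) (L' := bitLength b n k)
    (Nat.ceil_mono (mul_le_mul_of_nonneg_right hab hlog))
  refine ⟨layeredCoding hBpos ℓ lay S enc emb, fun m => ?_⟩
  -- the rounds in which `v` should receive a symbol in epoch `e`
  let U : V → ℕ → Finset (Fin T × V) := fun v e =>
    Finset.univ.filter fun x => x.2 = v ∧ ∃ τ < ℓ, Isolated G lay (S τ) v ∧
      x.1.val = roundOf ℓ e τ (lay v - 1)
  have hround : ∀ e < J + D, ∀ τ < ℓ, ∀ d, roundOf ℓ e τ d < T := fun e he τ hτ d =>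
    lt_of_lt_of_le (roundOf_lt d hτ) (Nat.mul_le_mul_left _ (Nat.mul_le_mul_right _ he))
  have hUcard : ∀ v, v ≠ s → ∀ e < J + D, c * B ≤ (U v e).card := by
    intro v hv e he
    refine (hS c t v hv).trans ?_
    refine Finset.card_le_card_of_surjOn (fun x => x.1.val / 3 % ℓ) ?_
    intro τ hτ
    simp only [Finset.coe_filter, Finset.mem_range, Set.mem_ofPred_eq] at hτ
    refine ⟨(⟨roundOf ℓ e τ (lay v - 1), hround e he τ hτ.1 _⟩, v), ?_, roundOf_mod hτ.1⟩
    simp only [U, Finset.coe_filter, Finset.mem_univ, true_and, Set.mem_ofPred_eq]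
    exact ⟨τ, hτ.1, hτ.2, rfl⟩
  rw [faultProb, bernoulliProb_compl]
  have hbad : bernoulliProb (fun _ => p) {ω : Faults V T | ∀ u,
      (layeredCoding hBpos ℓ lay S enc emb).decode u (initialKnowledge s m u)
        (history G s (layeredCoding hBpos ℓ lay S enc emb) m T ω u) = m}ᶜ ≤
      ∑ x ∈ (Finset.univ.filter fun v => v ≠ s) ×ˢ Finset.range (J + D),
        bernoulliProb (fun _ => p) {ω : Fin T × V → Bool |
          ((U x.1 x.2).filter fun y => ω y = false).card < B} := by
    refine bernoulliProb_iUnion_le (fun _ => hp0) (fun _ => hp1) _ _ fun ω hω => ?_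
    by_contra hcon
    push Not at hcon
    apply hω
    intro u
    -- Faults after round `T` play no role; the value `false` there is arbitrary.
    let F : ℕ → V → Bool := fun r v => if h : r < T then ω (⟨r, h⟩, v) else false
    have hF : ω = fun x => F x.1 x.2 := by
      ext ⟨r, v⟩
      simp [F]
    rw [hF]
    refine layeredCoding_decode hl hBpos S enc (fun x y h => henc x y (by convert h)) emb hemb m F
      ?_
      (fun v => Nat.add_le_add_left (hD v) J) le_rfl u
    intro v hv e he
    have h := hcon (v, e) (by simp [hv, he])
    simp only [Set.mem_ofPred_eq, not_lt] at h
    refine h.trans ?_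
    refine Finset.card_le_card_of_injOn
      (fun x => (x.1.val / 3 % ℓ)) ?_ ?_
    · intro x hx
      simp only [U, Finset.coe_filter, Finset.mem_filter, Finset.mem_univ, true_and,
        Set.mem_ofPred_eq] at hx
      obtain ⟨⟨hxv, τ, hτ, hiso, hr⟩, hωx⟩ := hx
      simp only [Finset.coe_filter, Finset.mem_range, Set.mem_ofPred_eq, hr, roundOf_mod hτ]
      refine ⟨hτ, hiso, ?_⟩
      simp only [F]
      rw [dif_pos (hround e he τ hτ _), ← hωx]
      congr 1
      exact Prod.ext (Fin.ext hr.symm) hxv.symm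
    · intro x hx y hy hxy
      simp only [U, Finset.coe_filter, Finset.mem_filter, Finset.mem_univ, true_and,
        Set.mem_ofPred_eq] at hx hy
      obtain ⟨⟨hxv, τ, hτ, -, hr⟩, -⟩ := hx
      obtain ⟨⟨hyv, τ', hτ', -, hr'⟩, -⟩ := hy
      simp only [hr, hr', roundOf_mod hτ, roundOf_mod hτ'] at hxy
      subst hxy
      exact Prod.ext (Fin.ext (hr.trans hr'.symm)) (hxv.trans hyv.symm)
  have hone : ∀ x ∈ (Finset.univ.filter fun v => v ≠ s) ×ˢ Finset.range (J + D),
      bernoulliProb (fun _ => p) {ω : Fin T × V → Bool |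
          ((U x.1 x.2).filter fun y => ω y = false).card < B} ≤ (1 / 2) ^ B := by
    intro x hx
    simp only [Finset.mem_product, Finset.mem_filter, Finset.mem_univ, true_and,
      Finset.mem_range] at hx
    refine (bernoulliProb_few_false hp0 hp1 _ _).trans ?_
    calc (2 : ℝ) ^ B * ((1 + p) / 2) ^ (U x.1 x.2).card
        ≤ 2 ^ B * ((1 + p) / 2) ^ (c * B) := by
          refine mul_le_mul_of_nonneg_left ?_ (by positivity)
          exact pow_le_pow_of_le_one (by linarith) (by linarith) (hUcard x.1 hx.1 x.2 hx.2)
      _ ≤ 2 ^ B * (1 / 4) ^ B := by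
          rw [pow_mul ((1 + p) / 2) c B]
          refine mul_le_mul_of_nonneg_left ?_ (by positivity)
          exact pow_le_pow_left₀ (pow_nonneg (by linarith) _) hc _
      _ = (1 / 2) ^ B := by rw [← mul_pow]; norm_num
  have hsum := hbad.trans (Finset.sum_le_sum hone)
  rw [Finset.sum_const, nsmul_eq_mul, Finset.card_product, Finset.card_range] at hsum
  have hcardle : ((Finset.univ.filter fun v => v ≠ s).card : ℝ) ≤ n := by
    exact_mod_cast Finset.card_le_univ _
  have : (((Finset.univ.filter fun v => v ≠ s).card * (J + D) : ℕ) : ℝ) * (1 / 2) ^ B ≤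
      (n * (J + D) : ℝ) * (1 / 2) ^ B := by
    push_cast
    gcongr
  linarith

/-! ### Throughput bounds from feasibility -/

/-- The throughput is a limsup, so schedules for infinitely many `k` suffice. This permits choosing
`k` as an exact multiple of a convenient batch size. -/
lemma inv_le_limsup_throughput {Feas : ℕ → ℕ → Prop} {K : ℕ} (hK : 0 < K)
    (h : ∃ᶠ k : ℕ in atTop, ∃ T, Feas k T ∧ T ≤ K * k) :
    ((K : ℝ≥0∞))⁻¹ ≤ limsup (fun k : ℕ =>
      (k : ℝ≥0∞) / ((⨅ (T : ℕ) (_ : Feas k T), (T : ℕ∞) : ℕ∞) : ℝ≥0∞)) atTop := by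
  refine le_limsup_of_frequently_le ?_
  refine (h.and_eventually (eventually_gt_atTop 0)).mono ?_
  rintro k ⟨⟨T, hT, hle⟩, hk⟩
  have hK0 : (K : ℝ≥0∞) ≠ 0 := by exact_mod_cast hK.ne'
  have hR : (⨅ (T : ℕ) (_ : Feas k T), (T : ℕ∞)) ≤ ((K * k : ℕ) : ℕ∞) :=
    (iInf₂_le T hT).trans (by exact_mod_cast hle)
  have hR' : (((⨅ (T : ℕ) (_ : Feas k T), (T : ℕ∞) : ℕ∞)) : ℝ≥0∞) ≤ (K : ℝ≥0∞) * k := by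
    refine (ENat.toENNReal_le.mpr hR).trans ?_
    simp
  have hk0 : (k : ℝ≥0∞) ≠ 0 := by exact_mod_cast hk.ne'
  rw [ENNReal.le_div_iff_mul_le (Or.inr hk0) (Or.inr (ENNReal.natCast_ne_top k))]
  calc (K : ℝ≥0∞)⁻¹ * _ ≤ (K : ℝ≥0∞)⁻¹ * ((K : ℝ≥0∞) * k) := by gcongr
    _ = k := by
      rw [← mul_assoc, ENNReal.inv_mul_cancel hK0 (ENNReal.natCast_ne_top K), one_mul]

/-- If no number of rounds is feasible for `k`, the infimum is `⊤` and the quotient is 0, so only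
feasible `T` need a bound. -/
lemma limsup_throughput_le {Feas : ℕ → ℕ → Prop} {c : ℝ} (hc : 0 < c)
    (h : ∀ᶠ k : ℕ in atTop, ∀ T, Feas k T → (k : ℝ) ≤ c * T) :
    limsup (fun k : ℕ =>
      (k : ℝ≥0∞) / ((⨅ (T : ℕ) (_ : Feas k T), (T : ℕ∞) : ℕ∞) : ℝ≥0∞)) atTop ≤
      ENNReal.ofReal c := by
  refine limsup_le_of_le (h := h.mono fun k hk => ENNReal.div_le_of_le_mul ?_)
  by_cases hex : ∃ T, Feas k T
  · have hR : ((Nat.find hex : ℕ) : ℕ∞) ≤ (⨅ (T : ℕ) (_ : Feas k T), (T : ℕ∞)) :=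
      le_iInf₂ fun T hT => by exact_mod_cast Nat.find_min' hex hT
    have h1 := hk _ (Nat.find_spec hex)
    calc (k : ℝ≥0∞) = ENNReal.ofReal k := by simp
      _ ≤ ENNReal.ofReal (c * (Nat.find hex : ℕ)) := ENNReal.ofReal_le_ofReal h1
      _ = ENNReal.ofReal c * ((Nat.find hex : ℕ) : ℝ≥0∞) := by
        rw [ENNReal.ofReal_mul hc.le, ENNReal.ofReal_natCast]
      _ ≤ _ := by
        gcongr
        have := ENat.toENNReal_le.mpr hR
        rwa [ENat.toENNReal_coe] at this
  · have hR : (⨅ (T : ℕ) (_ : Feas k T), (T : ℕ∞)) = ⊤ := by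
      simp only [iInf_eq_top]
      exact fun T hT => absurd ⟨T, hT⟩ hex
    rw [hR, ENat.toENNReal_top, ENNReal.mul_top (by simpa using hc)]
    exact le_top

/-- The failure probability of an exponential number of trials in every epoch vanishes. -/
lemma eventually_failure_le (n D h : ℕ) : ∀ᶠ B : ℕ in atTop,
    (n * ((B ^ h : ℕ) + D) : ℝ) * (1 / 2) ^ B ≤ 1 / ((B ^ h * B : ℕ) : ℝ) := by
  have h1 : ∀ j : ℕ, Tendsto (fun B : ℕ => (B : ℝ) ^ j * (1 / 2 : ℝ) ^ B) atTop (𝓝 0) := fun j =>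
    tendsto_pow_const_mul_const_pow_of_abs_lt_one j (by rw [abs_of_pos] <;> norm_num)
  have h2 : Tendsto (fun B : ℕ => n * ((B : ℝ) ^ (2 * h + 1) * (1 / 2 : ℝ) ^ B) +
      n * D * ((B : ℝ) ^ (h + 1) * (1 / 2 : ℝ) ^ B)) atTop (𝓝 (n * 0 + n * D * 0)) :=
    ((h1 _).const_mul _).add ((h1 _).const_mul _)
  rw [mul_zero, mul_zero, add_zero] at h2
  filter_upwards [h2.eventually_le_const zero_lt_one, eventually_gt_atTop 0] with B hB hpos
  have hpos' : (0 : ℝ) < B := by exact_mod_cast hpos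
  rw [le_div_iff₀ (by positivity)]
  refine le_trans (le_of_eq ?_) hB
  push_cast
  ring

/-- The coding throughput of every topology is of order at least `1 / log n`. -/
theorem exists_codingThroughput_ge {p : ℝ} (hp0 : 0 < p) (hp1 : p < 1) {a b : ℝ} (ha : 0 < a)
    (hab : a ≤ b) :
    ∃ c : ℕ, 0 < c ∧ ∀ (V : Type) [Fintype V] (G : SimpleGraph V) (s : V), G.Connected →
      ((c * decayConst (Fintype.card V) : ℕ) : ℝ≥0∞)⁻¹ ≤ codingThroughput G s p a b := by
  obtain ⟨c, hc⟩ := exists_pow_lt_of_lt_one (show (0 : ℝ) < 1 / 4 by norm_num)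
    (show (1 + p) / 2 < 1 by linarith)
  have hcpos : 0 < c := by
    rcases Nat.eq_zero_or_pos c with h | h
    · subst h; norm_num at hc
    · exact h
  -- The factor 6 is 3 for the rotation of layers times 2 from J + D ≤ 2J.
  refine ⟨6 * c, by omega, fun V _ G s hG => ?_⟩
  have : Nonempty V := ⟨s⟩
  set n := Fintype.card V with hn
  have hnpos : 1 ≤ n := Fintype.card_pos
  have hl := isLayering_dist hG s
  set D := Finset.univ.sup (G.dist s) with hD
  obtain ⟨Q, hQ, hfeas⟩ := codingFeasible_of_layering hl (D := D)
    (fun v => Finset.le_sup (Finset.mem_univ v)) hp0.le hp1.le hab hc.le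
  -- With B^h batches of size B, a message has at least a·log₂(B^(h+1)) ≥ 2 log₂ B bits. The field
  -- then has at least B² elements, which exceeds the codeword length `c * decayConst n * B` once B
  -- is large.
  set h := ⌈2 / a⌉₊ with hh
  have hha : 2 ≤ h * a := by
    have : 2 / a ≤ h := Nat.le_ceil _
    rwa [div_le_iff₀ ha] at this
  have hhpos : 1 ≤ h := Nat.one_le_ceil_iff.mpr (by positivity)
  have hdpos : 0 < decayConst n := by unfold decayConst; omega
  refine inv_le_limsup_throughput (by positivity) ?_
  have hBt : Tendsto (fun t : ℕ => Q * t) atTop atTop :=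
    tendsto_id.const_mul_atTop' hQ
  have hkt : Tendsto (fun t : ℕ => (Q * t) ^ h * (Q * t)) atTop atTop := by
    refine tendsto_atTop_mono (fun t => ?_) hBt
    rcases Nat.eq_zero_or_pos (Q * t) with h0 | h0
    · simp [h0]
    · exact Nat.le_mul_of_pos_left _ (pow_pos h0 _)
  refine hkt.frequently (Eventually.frequently ?_)
  filter_upwards [hBt.eventually (eventually_failure_le n D h), eventually_gt_atTop 0,
    hBt.eventually_ge_atTop (c * decayConst n), hBt.eventually_ge_atTop 2,
    hBt.eventually_ge_atTop D] with t hfail ht hlarge h2 hDt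
  set B := Q * t with hB
  have hB2 : (2 : ℝ) ≤ B := by exact_mod_cast h2
  have hBpos : (0 : ℝ) < B := by linarith
  have hpow : (B : ℝ) ^ 2 ≤ 2 ^ bitLength a n (B ^ h * B) := by
    have hnk : ((B ^ h * B : ℕ) : ℝ) ≤ n * ((B ^ h * B : ℕ) : ℝ) :=
      le_mul_of_one_le_left (by positivity) (by exact_mod_cast hnpos)
    have hkpos : (0 : ℝ) < ((B ^ h * B : ℕ) : ℝ) := by positivity
    have hlogB : 0 ≤ Real.logb 2 B := Real.logb_nonneg (by norm_num) (by linarith)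
    have hlog : 2 * Real.logb 2 B ≤ a * Real.logb 2 (n * ((B ^ h * B : ℕ) : ℝ)) := by
      calc 2 * Real.logb 2 B ≤ (h * a) * Real.logb 2 B :=
            mul_le_mul_of_nonneg_right hha hlogB
        _ ≤ a * Real.logb 2 ((B ^ h * B : ℕ) : ℝ) := by
            have : Real.logb 2 ((B ^ h * B : ℕ) : ℝ) = (h + 1) * Real.logb 2 B := by
              push_cast
              rw [← pow_succ, Real.logb_pow]
              push_cast; ring
            rw [this]
            nlinarith
        _ ≤ _ := mul_le_mul_of_nonneg_left
            (Real.logb_le_logb_of_le (by norm_num) hkpos hnk) ha.le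
    have hceil : 2 * Real.logb 2 B ≤ bitLength a n (B ^ h * B) := hlog.trans (Nat.le_ceil _)
    calc (B : ℝ) ^ 2 = (2 : ℝ) ^ (2 * Real.logb 2 B) := by
          rw [mul_comm, Real.rpow_mul (by norm_num), Real.rpow_logb (by norm_num) (by norm_num)
            hBpos]
          norm_cast
      _ ≤ (2 : ℝ) ^ (bitLength a n (B ^ h * B) : ℝ) :=
          Real.rpow_le_rpow_of_exponent_le (by norm_num) hceil
      _ = _ := by rw [Real.rpow_natCast]
  have hpow' : B ^ 2 ≤ 2 ^ bitLength a n (B ^ h * B) := by exact_mod_cast hpow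
  refine ⟨3 * ((B ^ h + D) * (c * decayConst n * B)), hfeas t (B ^ h) ht ?_ ?_ ?_, ?_⟩
  · intro h0
    rw [h0] at hpow'
    nlinarith
  · refine le_trans ?_ hpow'
    rw [sq]
    exact Nat.mul_le_mul_right _ hlarge
  · exact_mod_cast hfail
  · have hDB : D ≤ B ^ h := hDt.trans (Nat.le_self_pow (by omega) B)
    calc 3 * ((B ^ h + D) * (c * decayConst n * B))
        ≤ 3 * ((B ^ h + B ^ h) * (c * decayConst n * B)) := by gcongr
      _ = _ := by ring

/-! ### Routing as a Markov process -/

section RoutingProcess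

variable {V : Type} {k : ℕ}

/-- The pairs `(u, i)` such that `u` has received `i` after one more round. -/
def routingStep (G : SimpleGraph V) (s : V) (b : AdaptiveSchedule V k) (r : ℕ)
    (σ : Set (V × Fin k)) (η : V → Bool) : Set (V × Fin k) :=
  σ ∪ {x | noisyReceive G (routingTx s (b r) σ) η x.1 = some x.2}

lemma subset_routingStep (G : SimpleGraph V) (s : V) (b : AdaptiveSchedule V k) (r : ℕ)
    (σ : Set (V × Fin k)) (η : V → Bool) : σ ⊆ routingStep G s b r σ η :=
  Set.subset_union_left

lemma Knows.mono {s : V} {σ σ' : Set (V × Fin k)} (h : σ ⊆ σ') {u : V} {i : Fin k}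
    (hu : Knows s σ u i) : Knows s σ' u i :=
  hu.imp id fun hm => h hm

variable [Fintype V]

/-- The expectation of `f` after `t` rounds that start with round `r` in a given state. -/
def expectAfter (p : ℝ) (G : SimpleGraph V) (s : V) (b : AdaptiveSchedule V k) (r : ℕ) :
    ℕ → (Set (V × Fin k) → ℝ) → Set (V × Fin k) → ℝ
  | 0, f => f
  | t + 1, f => expectAfter p G s b r t fun σ =>
      bernExp (fun _ => p) fun η => f (routingStep G s b (r + t) σ η)

variable {p : ℝ} {G : SimpleGraph V} {s : V} {b : AdaptiveSchedule V k}

/-- Markov property: the next state depends on the past only through the received set and the round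
number. -/
lemma bernExp_received_add (T t : ℕ) (f : Set (V × Fin k) → ℝ) :
    bernExp (fun _ => p) (fun ω : Faults V (T + t) => f (received G s b (T + t) ω)) =
      bernExp (fun _ => p) (fun ω : Faults V T =>
        expectAfter p G s b T t f (received G s b T ω)) := by
  induction t generalizing f with
  | zero => rfl
  | succ t ih =>
    rw [expectAfter, ← ih]
    exact bernExp_faults_succ p fun (ω : Faults V (T + t)) η =>
      f (routingStep G s b (T + t) (received G s b (T + t) ω) η)

/-- Received sets only grow, so a property `K` that is closed under enlargement persists once it
holds, and `f ≤ g` is needed only where `K` holds. -/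
lemma expectAfter_mono_on (hp0 : 0 ≤ p) (hp1 : p ≤ 1) {K : Set (V × Fin k) → Prop}
    (hK : ∀ σ σ', σ ⊆ σ' → K σ → K σ') (r t : ℕ) {f g : Set (V × Fin k) → ℝ}
    (hfg : ∀ σ, K σ → f σ ≤ g σ) {σ : Set (V × Fin k)} (hσ : K σ) :
    expectAfter p G s b r t f σ ≤ expectAfter p G s b r t g σ := by
  induction t generalizing f g with
  | zero => exact hfg σ hσ
  | succ t ih =>
    exact ih fun σ' hσ' => bernExp_mono (fun _ => hp0) (fun _ => hp1) fun η =>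
      hfg _ (hK _ _ (subset_routingStep _ _ _ _ _ _) hσ')

lemma expectAfter_const (r t : ℕ) (c : ℝ) (σ : Set (V × Fin k)) :
    expectAfter p G s b r t (fun _ => c) σ = c := by
  induction t with
  | zero => rfl
  | succ t ih => simpa only [expectAfter, bernExp_const] using ih

lemma expectAfter_const_mul (r t : ℕ) (c : ℝ) (f : Set (V × Fin k) → ℝ) (σ : Set (V × Fin k)) :
    expectAfter p G s b r t (fun σ => c * f σ) σ = c * expectAfter p G s b r t f σ := by
  induction t generalizing f with
  | zero => rfl
  | succ t ih => simp only [expectAfter, bernExp_const_mul, ih]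

lemma expectAfter_sum {α : Type*} (A : Finset α) (r t : ℕ) (f : α → Set (V × Fin k) → ℝ)
    (σ : Set (V × Fin k)) :
    expectAfter p G s b r t (fun σ => ∑ a ∈ A, f a σ) σ =
      ∑ a ∈ A, expectAfter p G s b r t (f a) σ := by
  induction t generalizing f with
  | zero => rfl
  | succ t ih => simp only [expectAfter, bernExp_sum, ih]

/-- Contraction in single rounds accumulates. -/
lemma expectAfter_le_prod (hp0 : 0 ≤ p) (hp1 : p ≤ 1) {K : Set (V × Fin k) → Prop}
    (hK : ∀ σ σ', σ ⊆ σ' → K σ → K σ') (r t : ℕ) {f : Set (V × Fin k) → ℝ} {μ : ℕ → ℝ}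
    (hμ : ∀ x, 0 ≤ μ x)
    (hf : ∀ x < t, ∀ σ, K σ → bernExp (fun _ => p) (fun η => f (routingStep G s b (r + x) σ η)) ≤
      μ x * f σ) {σ : Set (V × Fin k)} (hσ : K σ) :
    expectAfter p G s b r t f σ ≤ (∏ x ∈ Finset.range t, μ x) * f σ := by
  induction t with
  | zero => simp [expectAfter]
  | succ t ih =>
    rw [Finset.prod_range_succ]
    calc expectAfter p G s b r (t + 1) f σ
        ≤ expectAfter p G s b r t (fun σ => μ t * f σ) σ :=
          expectAfter_mono_on hp0 hp1 hK r t (hf t (by omega)) hσ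
      _ = μ t * expectAfter p G s b r t f σ := expectAfter_const_mul _ _ _ _ _
      _ ≤ μ t * ((∏ x ∈ Finset.range t, μ x) * f σ) :=
          mul_le_mul_of_nonneg_left (ih fun x hx => hf x (by omega)) (hμ t)
      _ = _ := by ring

end RoutingProcess

/-! ### The layered routing schedule -/

section LayeredRouting

variable {V : Type} [Fintype V] {k : ℕ}

/-- The nodes of layer `d` that do not know message `i`. -/
def unknown (s : V) (lay : V → ℕ) (d : ℕ) (i : Fin k) (σ : Set (V × Fin k)) : Finset V :=
  Finset.univ.filter fun v => lay v = d ∧ ¬ Knows s σ v i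

/-- In epoch `e` the layer `d` looks for a message of batch `e - d` that some node of the next layer
does not know, and sends it from a set of senders that isolates many of these nodes. -/
def layeredRouting (s : V) (lay : V → ℕ) (B ℓ : ℕ) (iso : Finset V → Set V) :
    AdaptiveSchedule V k := fun r σ u =>
  if lay u % 3 = r % 3 then
    -- The condition involves only `lay u` and the global state, so all nodes of a layer choose the
    -- same message. For epochs before `lay u` the truncated difference is 0; nothing is claimed
    -- about the layer then.
    if h : ∃ i : Fin k, i.val / B = r / 3 / ℓ - lay u ∧
        (unknown s lay (lay u + 1) i σ).Nonempty then
      if u ∈ iso (unknown s lay (lay u + 1) h.choose σ) then some h.choose else none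
    else none
  else none

/-- Zero if all nodes of layer `d + 1` know batch `j`, and otherwise a product over the messages of
the batch that measures how many nodes do not know them. -/
def batchPotential (s : V) (lay : V → ℕ) (B d j : ℕ) (σ : Set (V × Fin k)) : ℝ :=
  -- The value is at least 1 as long as something is missing, so its expectation bounds the failure
  -- probability. The product form turns progress on a single message into a constant-factor
  -- decrease of the whole.
  if ∃ i : Fin k, i.val / B = j ∧ (unknown s lay (d + 1) i σ).Nonempty then
    ∏ i ∈ Finset.univ.filter (fun i : Fin k => i.val / B = j),
      (1 + ((unknown s lay (d + 1) i σ).card : ℝ))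
  else 0

variable {s : V} {lay : V → ℕ}

lemma unknown_anti {d : ℕ} {i : Fin k} {σ σ' : Set (V × Fin k)} (h : σ ⊆ σ') :
    unknown s lay d i σ' ⊆ unknown s lay d i σ := by
  intro v hv
  simp only [unknown, Finset.mem_filter, Finset.mem_univ, true_and] at hv ⊢
  exact ⟨hv.1, fun hk => hv.2 (hk.mono h)⟩

lemma batchPotential_nonneg (B d j : ℕ) (σ : Set (V × Fin k)) :
    0 ≤ batchPotential s lay B d j σ := by
  unfold batchPotential
  split_ifs
  · positivity
  · exact le_rfl

lemma batchPotential_anti {B d j : ℕ} {σ σ' : Set (V × Fin k)} (h : σ ⊆ σ') :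
    batchPotential s lay B d j σ' ≤ batchPotential s lay B d j σ := by
  by_cases h' : ∃ i : Fin k, i.val / B = j ∧ (unknown s lay (d + 1) i σ').Nonempty
  · have h'' : ∃ i : Fin k, i.val / B = j ∧ (unknown s lay (d + 1) i σ).Nonempty := by
      obtain ⟨i, hi, hne⟩ := h'
      exact ⟨i, hi, hne.mono (unknown_anti h)⟩
    rw [batchPotential, batchPotential, if_pos h', if_pos h'']
    refine Finset.prod_le_prod (fun i _ => by positivity) fun i _ => ?_
    gcongr
    exact unknown_anti h
  · rw [batchPotential, if_neg h']
    exact batchPotential_nonneg _ _ _ _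

lemma batchPotential_le {B : ℕ} (hB : 0 < B) (d j : ℕ) (σ : Set (V × Fin k)) :
    batchPotential s lay B d j σ ≤ (1 + Fintype.card V : ℝ) ^ B := by
  unfold batchPotential
  split_ifs
  · have hcard : (Finset.univ.filter (fun i : Fin k => i.val / B = j)).card ≤ B := by
      refine (Finset.card_le_card_of_injOn (t := Finset.range B) (fun i => i.val % B) ?_ ?_).trans
        (Finset.card_range B).le
      · intro i _
        simpa using Nat.mod_lt _ hB
      · intro i hi i' hi' h
        simp only [Finset.coe_filter, Finset.mem_univ, true_and, Set.mem_ofPred_eq] at hi hi'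
        have h1 := Nat.div_add_mod' i.val B
        have h2 := Nat.div_add_mod' i'.val B
        simp only at h
        rw [hi, h] at h1
        rw [hi'] at h2
        exact Fin.ext (by omega)
    calc _ ≤ ∏ i ∈ Finset.univ.filter (fun i : Fin k => i.val / B = j),
          (1 + Fintype.card V : ℝ) := by
          refine Finset.prod_le_prod (fun i _ => by positivity) fun i _ => ?_
          gcongr
          exact Finset.card_le_univ _
      _ = (1 + Fintype.card V : ℝ) ^ _ := Finset.prod_const _
      _ ≤ _ := pow_le_pow_right₀ (by simp) hcard
  · positivity

variable {G : SimpleGraph V}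

/-- A round in which layer `d` is active decreases the potential of its current batch. -/
lemma bernExp_batchPotential_le (hl : IsLayering G s lay) {p : ℝ} (hp0 : 0 ≤ p) (hp1 : p ≤ 1)
    {iso : Finset V → Set V} {c : ℕ} (hc : 0 < c)
    (hiso : ∀ R : Finset V, s ∉ R → R.card ≤ c * (R.filter fun v => Isolated G lay (iso R) v).card)
    {B ℓ d j r : ℕ} (hr : d % 3 = r % 3) (he : r / 3 / ℓ = j + d) {σ : Set (V × Fin k)}
    (hσ : ∀ i : Fin k, i.val / B = j → ∀ v, lay v = d → Knows s σ v i) :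
    bernExp (fun _ => p) (fun η => batchPotential s lay B d j
      (routingStep G s (layeredRouting s lay B ℓ iso) r σ η)) ≤
      (1 - (1 - p) / (2 * c)) * batchPotential s lay B d j σ := by
  by_cases h : ∃ i : Fin k, i.val / B = j ∧ (unknown s lay (d + 1) i σ).Nonempty
  swap
  · have h0 : batchPotential s lay B d j σ = 0 := by rw [batchPotential, if_neg h]
    rw [h0, mul_zero]
    refine (bernExp_mono (fun _ => hp0) (fun _ => hp1) (g := fun _ => 0) fun η => ?_).trans
      (bernExp_const _ 0).le
    rw [← h0]
    exact batchPotential_anti (subset_routingStep _ _ _ _ _ _)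
  set b : AdaptiveSchedule V k := layeredRouting s lay B ℓ iso with hb
  set i := h.choose with hi
  obtain ⟨hij, hne⟩ : i.val / B = j ∧ (unknown s lay (d + 1) i σ).Nonempty := h.choose_spec
  set R := unknown s lay (d + 1) i σ with hR
  have hRmem : ∀ v, v ∈ R ↔ lay v = d + 1 ∧ ¬ Knows s σ v i := by simp [hR, unknown]
  set R' := R.filter fun v => Isolated G lay (iso R) v with hR'
  have hcard : R.card ≤ c * R'.card := hiso R (fun hs => ((hRmem s).mp hs).2 (Or.inl rfl))
  have hsilent : ∀ u, lay u % 3 ≠ d % 3 → routingTx s (b r) σ u = none := by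
    intro u hu
    have : b r σ u = none := by
      rw [hb, layeredRouting, if_neg (by omega)]
    simp [routingTx, this]
  have hbd : ∀ u, lay u = d → b r σ u = if u ∈ iso R then some i else none := by
    intro u hu
    have hj : r / 3 / ℓ - lay u = j := by omega
    subst hu
    subst hj
    rw [hb, layeredRouting, if_pos hr, dif_pos h]
  have hrec : ∀ v ∈ R', receive G (routingTx s (b r) σ) v = some i := by
    intro v hv
    obtain ⟨hvR, u, ⟨⟨hadj, hlu⟩, huS⟩, huniq⟩ := Finset.mem_filter.mp hv
    have hlv := ((hRmem v).mp hvR).1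
    have hlu : lay u = d := by omega
    refine receive_eq_some (hsilent v (by omega)) hadj ?_ ?_
    · rw [routingTx, hbd u hlu, if_pos huS]
      simp [hσ i hij u hlu]
    · intro w hw hws
      have hlw := hl.lay_eq_of_adj hlv hsilent hw hws
      refine huniq w ⟨⟨hw, by omega⟩, ?_⟩
      by_contra hn
      rw [routingTx, hbd w hlw, if_neg hn] at hws
      simp at hws
  set Bt := Finset.univ.filter (fun i : Fin k => i.val / B = j) with hBt
  have hiBt : i ∈ Bt := by simp [hBt, hij]
  set W : ℝ := ∏ i' ∈ Bt.erase i, (1 + ((unknown s lay (d + 1) i' σ).card : ℝ)) with hW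
  have hW0 : 0 ≤ W := Finset.prod_nonneg fun _ _ => by positivity
  have hPhi : batchPotential s lay B d j σ = W * (1 + R.card) := by
    rw [batchPotential, if_pos h, hW, ← Finset.prod_erase_mul _ _ hiBt]
  -- Only the factor of the broadcast message `i` is followed: it loses one unit for every
  -- fault-free node of `R'`. The other factors cannot increase.
  have hpoint : ∀ η : V → Bool, batchPotential s lay B d j (routingStep G s b r σ η) ≤
      W * (1 + ((R.card : ℝ) - ∑ v ∈ R', if η v then 0 else 1)) := by
    intro η
    have hnn : (0 : ℝ) ≤ (R.card : ℝ) - ∑ v ∈ R', if η v then 0 else 1 := by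
      have h1 : (∑ v ∈ R', if η v then (0 : ℝ) else 1) ≤ ∑ v ∈ R', 1 :=
        Finset.sum_le_sum fun v _ => by split_ifs <;> norm_num
      have h2 : (R'.card : ℝ) ≤ R.card := by exact_mod_cast Finset.card_filter_le _ _
      simp only [Finset.sum_const, nsmul_eq_mul, mul_one] at h1
      linarith
    rw [batchPotential]
    split_ifs
    swap
    · exact mul_nonneg hW0 (by linarith)
    rw [← Finset.prod_erase_mul _ _ hiBt]
    refine mul_le_mul ?_ ?_ (by positivity) hW0
    · refine Finset.prod_le_prod (fun _ _ => by positivity) fun i' _ => ?_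
      gcongr
      exact unknown_anti (subset_routingStep _ _ _ _ _ _)
    · have hsub : unknown s lay (d + 1) i (routingStep G s b r σ η) ⊆
          R \ (R'.filter fun v => η v = false) := by
        intro v hv
        rw [Finset.mem_sdiff]
        refine ⟨unknown_anti (subset_routingStep _ _ _ _ _ _) hv, fun hv' => ?_⟩
        obtain ⟨hvR', hη⟩ := Finset.mem_filter.mp hv'
        simp only [unknown, Finset.mem_filter, Finset.mem_univ, true_and] at hv
        refine hv.2 (Or.inr (Or.inr ?_))
        simp [noisyReceive, hη, hrec v hvR']
      have hcard2 := Finset.card_le_card hsub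
      rw [Finset.card_sdiff_of_subset
        ((Finset.filter_subset _ _).trans (Finset.filter_subset _ _))] at hcard2
      have hle : (R'.filter fun v => η v = false).card ≤ R.card :=
        Finset.card_le_card ((Finset.filter_subset _ _).trans (Finset.filter_subset _ _))
      have hsum : (∑ v ∈ R', if η v then (0 : ℝ) else 1) =
          (R'.filter fun v => η v = false).card := by
        rw [Finset.card_filter, Nat.cast_sum]
        refine Finset.sum_congr rfl fun v _ => ?_
        cases η v <;> simp
      rw [hsum, ← Nat.cast_sub hle]
      gcongr
  have hexp : bernExp (fun _ => p) (fun η : V → Bool =>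
      W * (1 + ((R.card : ℝ) - ∑ v ∈ R', if η v then 0 else 1))) =
      W * (1 + R.card - (1 - p) * R'.card) := by
    have h1 : bernExp (fun _ => p) (fun η : V → Bool => ∑ v ∈ R', if η v then (0 : ℝ) else 1) =
        (1 - p) * R'.card := by
      rw [bernExp_sum, Finset.sum_congr rfl fun v _ =>
        bernExp_coord (fun _ : V => p) v (fun c => if c then (0 : ℝ) else 1)]
      simp only [if_true, Bool.false_eq_true, if_false, Finset.sum_const, nsmul_eq_mul]
      ring
    rw [bernExp_const_mul]
    have h2 : bernExp (fun _ => p) (fun η : V → Bool =>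
        (1 + (R.card : ℝ)) + (-1) * ∑ v ∈ R', if η v then (0 : ℝ) else 1) =
        1 + R.card - (1 - p) * R'.card := by
      rw [bernExp_add, bernExp_const_mul, bernExp_const, h1]; ring
    rw [← h2]
    congr 2
    ext η
    ring
  refine (bernExp_mono (fun _ => hp0) (fun _ => hp1) hpoint).trans ?_
  rw [hexp, hPhi, mul_left_comm]
  refine mul_le_mul_of_nonneg_left ?_ hW0
  -- Since `R` is nonempty, 1 + |R| ≤ 2|R| ≤ 2c|R'|; this is the origin of the factor 2 in the rate.
  have hR1 : (1 : ℝ) ≤ R.card := by exact_mod_cast hne.card_pos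
  have hc' : (0 : ℝ) < c := by exact_mod_cast hc
  have hcard' : (R.card : ℝ) ≤ c * R'.card := by exact_mod_cast hcard
  have h3 : (1 + (R.card : ℝ)) / (2 * c) ≤ R'.card := by
    rw [div_le_iff₀ (by positivity)]
    linarith
  have h4 := mul_le_mul_of_nonneg_left h3 (show 0 ≤ 1 - p by linarith)
  have h5 : (1 - (1 - p) / (2 * c)) * (1 + R.card) =
      1 + R.card - (1 - p) * ((1 + (R.card : ℝ)) / (2 * c)) := by ring
  rw [h5]
  linarith

end LayeredRouting
/-! ### Feasibility of layered routing -/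

/-- By averaging over a family of sender sets, some set isolates many nodes of a given set. -/
lemma exists_isolating_set {V : Type} [Fintype V] [Nonempty V] {G : SimpleGraph V} {s : V}
    {lay : V → ℕ} (hl : IsLayering G s lay) (R : Finset V) (hR : s ∉ R) :
    ∃ S : Set V, R.card ≤
      decayConst (Fintype.card V) * (R.filter fun v => Isolated G lay S v).card := by
  obtain ⟨Q, S, hQ, hS⟩ := exists_decay_family V
  by_contra! hcon
  have h1 : ∀ v ∈ R, Q ≤ decayConst (Fintype.card V) *
      ∑ w ∈ Finset.range Q, if Isolated G lay (S w) v then 1 else 0 := by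
    intro v hv
    rw [← Finset.card_filter]
    exact hS {u | G.Adj v u ∧ lay u + 1 = lay v} (hl.pred v fun h => hR (h ▸ hv))
  have h2 := Finset.sum_le_sum h1
  rw [← Finset.mul_sum, Finset.sum_comm, Finset.mul_sum, Finset.sum_const, smul_eq_mul] at h2
  have h3 : ∑ w ∈ Finset.range Q, decayConst (Fintype.card V) *
      (∑ v ∈ R, if Isolated G lay (S w) v then 1 else 0) < ∑ w ∈ Finset.range Q, R.card := by
    refine Finset.sum_lt_sum_of_nonempty (by simpa using hQ.ne') fun w _ => ?_
    rw [← Finset.card_filter]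
    exact hcon (S w)
  rw [Finset.sum_const, smul_eq_mul, Finset.card_range] at h3
  linarith [mul_comm Q R.card]

/-- An epoch lets each layer d < D, once d ≤ e, pass batch e - d to layer d + 1. A transfer fails
with probability at most the final mean potential, which is the initial bound (1+n)^B times one
contraction factor for each of the `ℓ` active rounds. The union bound runs over D layers and J + D
epochs. -/
theorem routingFeasible_of_layering {V : Type} [Fintype V] [Nonempty V] {G : SimpleGraph V} {s : V}
    {lay : V → ℕ} (hl : IsLayering G s lay) {D : ℕ} (hD : ∀ v, lay v ≤ D)
    {p : ℝ} (hp0 : 0 ≤ p) (hp1 : p ≤ 1) {k B J ℓ : ℕ} (hB : 0 < B) (hℓ : 0 < ℓ) (hk : k ≤ J * B)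
    (hfail : ((J + D : ℕ) : ℝ) * (D * ((1 - (1 - p) / (2 * decayConst (Fintype.card V))) ^ ℓ *
      (1 + Fintype.card V : ℝ) ^ B)) ≤ 1 / (k : ℝ)) :
    RoutingFeasible G s p k (3 * ((J + D) * ℓ)) := by
  choose! iso hiso using exists_isolating_set hl
  have hc : 0 < decayConst (Fintype.card V) := by unfold decayConst; omega
  set c := decayConst (Fintype.card V) with hcdef
  set n := Fintype.card V with hn
  set lam : ℝ := 1 - (1 - p) / (2 * c) with hlam
  have hc1 : (1 : ℝ) ≤ c := by exact_mod_cast hc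
  have hlam0 : 0 ≤ lam := by
    rw [hlam, sub_nonneg, div_le_one (by positivity)]
    linarith
  set b : AdaptiveSchedule V k := layeredRouting s lay B ℓ iso with hb
  refine ⟨b, ?_⟩
  set ε : ℝ := D * (lam ^ ℓ * (1 + n : ℝ) ^ B) with hε
  have hε0 : 0 ≤ ε := by positivity
  -- The pipeline invariant after `e` epochs: layer d knows all batches j with j + d ≤ e.
  let I : ℕ → Set (V × Fin k) → Prop := fun e σ =>
    ∀ v (i : Fin k), i.val / B + lay v ≤ e → Knows s σ v i
  have hImono : ∀ e σ σ', σ ⊆ σ' → I e σ → I e σ' := fun e σ σ' h hI v i hv =>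
    (hI v i hv).mono h
  -- one epoch of one layer
  have hlayer : ∀ e d, d ≤ e → ∀ σ, I e σ →
      expectAfter p G s b (3 * (e * ℓ)) (3 * ℓ) (batchPotential s lay B d (e - d)) σ ≤
        lam ^ ℓ * (1 + n : ℝ) ^ B := by
    intro e d hde σ hσ
    -- A layer is active in exactly one of three consecutive rounds.
    have hprod : ∀ t, ∏ x ∈ Finset.range (3 * t), (if x % 3 = d % 3 then lam else 1) = lam ^ t := by
      intro t
      induction t with
      | zero => simp
      | succ t ih =>
        rw [show 3 * (t + 1) = 3 * t + 1 + 1 + 1 by ring, Finset.prod_range_succ,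
          Finset.prod_range_succ, Finset.prod_range_succ, ih, pow_succ]
        have h3 : d % 3 = 0 ∨ d % 3 = 1 ∨ d % 3 = 2 := by omega
        have h0 : (3 * t) % 3 = 0 := by omega
        have h1 : (3 * t + 1) % 3 = 1 := by omega
        have h2 : (3 * t + 1 + 1) % 3 = 2 := by omega
        rcases h3 with h | h | h <;> simp [h, h0, h1, h2]
    have := expectAfter_le_prod (p := p) (G := G) (s := s) (b := b) hp0 hp1 (hImono e)
      (3 * (e * ℓ)) (3 * ℓ) (f := batchPotential s lay B d (e - d))
      (μ := fun x => if x % 3 = d % 3 then lam else 1)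
      (fun x => by
        show (0 : ℝ) ≤ if x % 3 = d % 3 then lam else 1
        split_ifs
        · exact hlam0
        · norm_num) ?_ hσ
    · rw [hprod] at this
      refine this.trans (mul_le_mul_of_nonneg_left (batchPotential_le hB _ _ _) (by positivity))
    · intro x hx σ' hσ'
      show _ ≤ (if x % 3 = d % 3 then lam else 1) * _
      split_ifs with hxd
      · refine bernExp_batchPotential_le hl hp0 hp1 hc hiso (by omega) ?_ ?_
        · have h1 : (3 * (e * ℓ) + x) / 3 = x / 3 + ℓ * e := by rw [mul_comm e ℓ]; omega
          rw [h1, Nat.add_mul_div_left _ _ hℓ, Nat.div_eq_of_lt (by omega)]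
          omega
        · intro i hi v hv
          exact hσ' v i (by omega)
      · rw [one_mul]
        exact (bernExp_mono (fun _ => hp0) (fun _ => hp1) fun η =>
          batchPotential_anti (subset_routingStep _ _ _ _ _ _)).trans (bernExp_const _ _).le
  -- one epoch of all layers
  have hepoch : ∀ e σ, expectAfter p G s b (3 * (e * ℓ)) (3 * ℓ)
      (fun σ => if I (e + 1) σ then 0 else 1) σ ≤ (if I e σ then 0 else 1) + ε := by
    intro e σ
    by_cases hσ : I e σ
    swap
    · rw [if_neg hσ]
      refine (expectAfter_mono_on hp0 hp1 (K := fun _ => True) (fun _ _ _ _ => trivial) _ _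
        (g := fun _ => 1) (fun σ' _ => ?_) trivial).trans ?_
      · split_ifs <;> norm_num
      · rw [expectAfter_const]
        linarith
    · rw [if_pos hσ, zero_add]
      refine (expectAfter_mono_on hp0 hp1 (hImono e) _ _ (g := fun σ' =>
        ∑ d ∈ (Finset.range D).filter (fun d => d ≤ e), batchPotential s lay B d (e - d) σ')
        (fun σ' hσ' => ?_) hσ).trans ?_
      · have hnn : ∀ d ∈ (Finset.range D).filter (fun d => d ≤ e),
            0 ≤ batchPotential (k := k) s lay B d (e - d) σ' := fun d _ =>
          batchPotential_nonneg _ _ _ _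
        split_ifs with hI
        · exact Finset.sum_nonneg hnn
        · simp only [I, not_forall] at hI
          obtain ⟨v, i, hvi, hkn⟩ := hI
          have hi0 : 0 ≤ i.val / B := Nat.zero_le _
          -- `I e` persists, so only a pair on the new diagonal can be missing.
          have hvi' : i.val / B + lay v = e + 1 := by
            by_contra hne
            exact hkn (hσ' v i (by omega))
          have hv0 : lay v ≠ 0 := fun h => hkn (Or.inl (hl.eq_source v h))
          obtain ⟨d, hd⟩ := Nat.exists_eq_succ_of_ne_zero hv0
          have hdD : d ∈ (Finset.range D).filter (fun d => d ≤ e) := by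
            have := hD v
            simp only [Finset.mem_filter, Finset.mem_range]
            omega
          refine le_trans ?_ (Finset.single_le_sum hnn hdD)
          have hex : ∃ i : Fin k, i.val / B = e - d ∧ (unknown s lay (d + 1) i σ').Nonempty :=
            ⟨i, by omega, v, by simp [unknown, hd, hkn]⟩
          rw [batchPotential, if_pos hex]
          exact Finset.one_le_prod fun _ _ => by simp
      · rw [expectAfter_sum]
        refine (Finset.sum_le_card_nsmul _ _ _ fun d hd =>
          hlayer e d (Finset.mem_filter.mp hd).2 σ hσ).trans ?_
        rw [nsmul_eq_mul, hε]
        have : (((Finset.range D).filter (fun d => d ≤ e)).card : ℝ) ≤ D := by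
          exact_mod_cast (Finset.card_filter_le _ _).trans (Finset.card_range D).le
        gcongr
  have hall : ∀ e, bernExp (fun _ => p) (fun ω : Faults V (3 * (e * ℓ)) =>
      if I e (received G s b (3 * (e * ℓ)) ω) then 0 else 1) ≤ e * ε := by
    intro e
    induction e with
    | zero =>
      refine (bernExp_mono (fun _ => hp0) (fun _ => hp1) (g := fun _ => 0) fun ω => ?_).trans ?_
      · rw [if_pos]
        intro v i hv
        have hi0 : 0 ≤ i.val / B := Nat.zero_le _
        exact Or.inl (hl.eq_source v (by omega))
      · rw [bernExp_const]; simp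
    | succ e ih =>
      have hT : 3 * ((e + 1) * ℓ) = 3 * (e * ℓ) + 3 * ℓ := by ring
      rw [hT, bernExp_received_add (3 * (e * ℓ)) (3 * ℓ) (fun σ => if I (e + 1) σ then 0 else 1)]
      refine (bernExp_mono (fun _ => hp0) (fun _ => hp1) fun ω => hepoch e _).trans ?_
      rw [bernExp_add, bernExp_const]
      push_cast
      linarith
  have hfinal := hall (J + D)
  rw [faultProb, bernoulliProb_compl, bernoulliProb_eq_bernExp]
  refine sub_le_sub_left (le_trans ?_ hfail) 1
  refine le_trans (bernExp_mono (fun _ => hp0) (fun _ => hp1) fun ω => ?_) hfinal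
  by_cases hI : I (J + D) (received G s b (3 * ((J + D) * ℓ)) ω)
  · rw [if_pos hI, if_neg]
    rw [Set.notMem_compl_iff]
    intro u i
    refine hI u i ?_
    have h1 : i.val / B < J := by
      rw [Nat.div_lt_iff_lt_mul hB]; omega
    have := hD u
    omega
  · rw [if_neg hI]
    split_ifs <;> norm_num

/-- The adaptive routing throughput of every topology is of order at least `1 / log² n`. -/
theorem exists_routingThroughput_ge {p : ℝ} (hp0 : 0 < p) (hp1 : p < 1) :
    ∃ c : ℕ, 0 < c ∧ ∀ (V : Type) [Fintype V] (G : SimpleGraph V) (s : V), G.Connected →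
      ((c * decayConst (Fintype.card V) ^ 2 : ℕ) : ℝ≥0∞)⁻¹ ≤ routingThroughput G s p := by
  obtain ⟨c, hc⟩ := exists_pow_lt_of_lt_one (show (0 : ℝ) < 1 / 4 by norm_num)
    (show Real.exp (-((1 - p) / 2)) < 1 by rw [Real.exp_lt_one_iff]; linarith)
  have hcpos : 0 < c := by
    rcases Nat.eq_zero_or_pos c with h | h
    · subst h; norm_num at hc
    · exact h
  refine ⟨6 * c, by omega, fun V _ G s hG => ?_⟩
  have : Nonempty V := ⟨s⟩
  set n := Fintype.card V with hn
  have hl := isLayering_dist hG s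
  set D := Finset.univ.sup (G.dist s) with hD
  set dc := decayConst n with hdc
  have hdpos : 0 < dc := by rw [hdc]; unfold decayConst; omega
  have hdc1 : (1 : ℝ) ≤ dc := by exact_mod_cast hdpos
  have hn2 : (1 + n : ℝ) ≤ 2 ^ dc := by
    have h1 : n < 2 ^ (Nat.log 2 n + 1) := Nat.lt_pow_succ_log_self (by norm_num) n
    have h2 : 2 ^ (Nat.log 2 n + 1) ≤ 2 ^ dc :=
      Nat.pow_le_pow_right (by norm_num) (by rw [hdc]; unfold decayConst; omega)
    have h3 : 1 + n ≤ 2 ^ dc := by omega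
    exact_mod_cast h3
  have hlam0 : 0 ≤ 1 - (1 - p) / (2 * (dc : ℝ)) := by
    rw [sub_nonneg, div_le_one (by positivity)]
    linarith
  have hlam : (1 - (1 - p) / (2 * (dc : ℝ))) ^ (c * dc) ≤ 1 / 4 := by
    have h1 : 1 - (1 - p) / (2 * (dc : ℝ)) ≤ Real.exp (-((1 - p) / (2 * dc))) := by
      have := Real.add_one_le_exp (-((1 - p) / (2 * (dc : ℝ))))
      linarith
    calc (1 - (1 - p) / (2 * (dc : ℝ))) ^ (c * dc)
        ≤ Real.exp (-((1 - p) / (2 * dc))) ^ (c * dc) := pow_le_pow_left₀ hlam0 h1 _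
      _ = Real.exp (-((1 - p) / 2)) ^ c := by
          rw [mul_comm c dc, pow_mul, ← Real.exp_nat_mul]
          congr 2
          field_simp
      _ ≤ 1 / 4 := hc.le
  refine inv_le_limsup_throughput (by positivity) ?_
  have hkt : Tendsto (fun B : ℕ => B ^ 1 * B) atTop atTop := by
    refine tendsto_atTop_mono (fun B => ?_) tendsto_id
    rw [pow_one]
    exact Nat.le_mul_self B
  refine hkt.frequently (Eventually.frequently ?_)
  filter_upwards [eventually_failure_le D D 1, eventually_gt_atTop 0, eventually_ge_atTop D]
    with B hfail hB hDB
  -- One factor `dc` offsets the slow contraction, as `c * dc` active rounds gain a factor 1/4. The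
  -- other offsets the initial potential, as (1+n)^B ≤ 2^(dc·B).
  refine ⟨3 * ((B ^ 1 + D) * (c * dc * (dc * B))), routingFeasible_of_layering hl
    (fun v => Finset.le_sup (Finset.mem_univ v)) hp0.le hp1.le hB (by positivity) le_rfl ?_, ?_⟩
  · refine le_trans ?_ hfail
    rw [← hn, ← hdc]
    have h1 : (1 - (1 - p) / (2 * (dc : ℝ))) ^ (c * dc * (dc * B)) * (1 + n : ℝ) ^ B ≤
        (1 / 2) ^ B := by
      calc (1 - (1 - p) / (2 * (dc : ℝ))) ^ (c * dc * (dc * B)) * (1 + n : ℝ) ^ B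
          ≤ (1 / 4) ^ (dc * B) * (2 ^ dc) ^ B := by
            rw [pow_mul]
            refine mul_le_mul (pow_le_pow_left₀ (pow_nonneg hlam0 _) hlam _)
              (pow_le_pow_left₀ (by positivity) hn2 _) (by positivity) (by positivity)
        _ = ((1 / 2) ^ dc) ^ B := by
            rw [pow_mul, ← mul_pow, ← mul_pow]
            norm_num
        _ ≤ (1 / 2) ^ B := by
            refine pow_le_pow_left₀ (by positivity) ?_ _
            exact pow_le_of_le_one (by norm_num) (by norm_num) hdpos.ne'
    calc ((B ^ 1 + D : ℕ) : ℝ) * (D * ((1 - (1 - p) / (2 * (dc : ℝ))) ^ (c * dc * (dc * B)) *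
          (1 + n : ℝ) ^ B)) ≤ ((B ^ 1 + D : ℕ) : ℝ) * (D * (1 / 2) ^ B) := by gcongr
      _ = _ := by push_cast; ring
  · have hDB : D ≤ B ^ 1 := by simpa using hDB
    calc 3 * ((B ^ 1 + D) * (c * dc * (dc * B)))
        ≤ 3 * ((B ^ 1 + B ^ 1) * (c * dc * (dc * B))) := by gcongr
      _ = _ := by ring

/-! ### Networks that contain clusters with few receptions -/

/-- The nodes `node κ q`, `q : C`, form a cluster for every `κ : K`: they have the same neighbours
`N κ`. In every round at most `β` clusters have exactly one broadcasting neighbour. -/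
structure IsClusterNetwork {V K C : Type} [Fintype K] (G : SimpleGraph V) (s : V)
    (node : K → C → V) (N : K → Set V) (β : ℕ) : Prop where
  injective : ∀ κ, Function.Injective (node κ)
  ne_source : ∀ κ q, node κ q ≠ s
  adj_iff : ∀ κ q u, G.Adj (node κ q) u ↔ u ∈ N κ
  card_le : ∀ S : Set V, (Finset.univ.filter fun κ => ∃! u, u ∈ N κ ∧ u ∈ S).card ≤ β

section RoutingUpper

variable {V K C : Type} {k : ℕ}

/-- Exactly one node of `A` broadcasts, and it broadcasts `i`. -/
def Offered (A : Set V) (tx : V → Option (Fin k)) (i : Fin k) : Prop :=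
  ∃ u ∈ A, tx u = some i ∧ ∀ w ∈ A, (tx w).isSome → w = u

/-- The number of rounds in which `i` is offered by the nodes in `A`. -/
def offers (G : SimpleGraph V) (s : V) (b : AdaptiveSchedule V k) (A : Set V) (i : Fin k) :
    (T : ℕ) → Faults V T → ℕ
  | 0, _ => 0
  | T + 1, ω => offers G s b A i T ω.init +
      if Offered A (routingTx s (b T) (received G s b T ω.init)) i then 1 else 0

/-- The probability that all nodes of a cluster receive `i` during its first `θ` offers, given that
there have been `X` offers so far and the nodes in `{v | (v, i) ∈ σ}` have received `i`. -/
def clusterPotential [Fintype C] (p : ℝ) (node : C → V) (i : Fin k) (θ X : ℕ)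
    (σ : Set (V × Fin k)) : ℝ :=
  if X ≤ θ then ∏ q, (if (node q, i) ∈ σ then 1 else 1 - p ^ (θ - X)) else 0

lemma bernExp_prod_injective {ι C : Type} [Fintype ι] [Fintype C] (p : ι → ℝ) {e : C → ι}
    (he : Function.Injective e) (g : C → Bool → ℝ) :
    bernExp p (fun ω => ∏ c, g c (ω (e c))) =
      ∏ c, (p (e c) * g c true + (1 - p (e c)) * g c false) := by
  have h := bernExp_prod_finset p (Finset.univ.map ⟨e, he⟩) (Function.extend e g fun _ _ => 1)
  simpa [he.extend_apply] using h

lemma clusterPotential_nonneg [Fintype C] {p : ℝ} (hp0 : 0 ≤ p) (hp1 : p ≤ 1) (node : C → V)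
    (i : Fin k) (θ X : ℕ) (σ : Set (V × Fin k)) : 0 ≤ clusterPotential p node i θ X σ := by
  unfold clusterPotential
  split_ifs
  · refine Finset.prod_nonneg fun q _ => ?_
    split_ifs
    · norm_num
    · linarith [pow_le_one₀ (n := θ - X) hp0 hp1]
  · exact le_rfl

variable [Fintype K] {G : SimpleGraph V} {s : V} {node : K → C → V} {N : K → Set V} {β : ℕ} {p : ℝ}

/-- A round makes an offer to at most `β` clusters, and an offer determines its message uniquely. -/
lemma sum_offers_le (hN : IsClusterNetwork G s node N β) (b : AdaptiveSchedule V k) (T : ℕ)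
    (ω : Faults V T) : ∑ x : K × Fin k, offers G s b (N x.1) x.2 T ω ≤ T * β := by
  induction T with
  | zero => simp [offers]
  | succ T ih =>
    simp only [offers, Finset.sum_add_distrib]
    rw [add_mul, one_mul]
    refine add_le_add (ih ω.init) ?_
    rw [← Finset.card_filter]
    set tx := routingTx s (b T) (received G s b T ω.init)
    refine le_trans (Finset.card_le_card_of_injOn Prod.fst ?_ ?_) (hN.card_le {u | (tx u).isSome})
    · rintro ⟨κ, i⟩ h
      simp only [Finset.coe_filter, Finset.mem_univ, true_and, Set.mem_ofPred_eq] at h ⊢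
      obtain ⟨u, hu, htx, huniq⟩ := h
      exact ⟨u, ⟨hu, by simp [htx]⟩, fun w hw => huniq w hw.1 hw.2⟩
    · rintro ⟨κ, i⟩ h ⟨κ', i'⟩ h' heq
      simp only [Finset.coe_filter, Finset.mem_univ, true_and, Set.mem_ofPred_eq] at h h' heq
      subst heq
      obtain ⟨u, hu, htx, huniq⟩ := h
      obtain ⟨u', hu', htx', -⟩ := h'
      have : u' = u := huniq u' hu' (by simp [htx'])
      rw [this, htx, Option.some_inj] at htx'
      rw [htx']

variable [Fintype V] [Fintype C]

/-- Supermartingale property. An offer leaves an uninformed node uninformed with probability p, so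
its mean factor becomes 1 - p·p^(θ-X-1) = 1 - p^(θ-X), unchanged. Faults at different nodes of the
cluster are independent, and an offer beyond the θ-th sets the potential to 0. -/
lemma bernExp_clusterPotential_le (hN : IsClusterNetwork G s node N β) (hp0 : 0 ≤ p) (hp1 : p ≤ 1)
    (b : AdaptiveSchedule V k) (κ : K) (i : Fin k) (θ T X : ℕ) (σ : Set (V × Fin k)) :
    bernExp (fun _ => p) (fun η => clusterPotential p (node κ) i θ
      (X + if Offered (N κ) (routingTx s (b T) σ) i then 1 else 0) (routingStep G s b T σ η)) ≤
      clusterPotential p (node κ) i θ X σ := by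
  have hoff : ∀ (η : V → Bool) q, (node κ q, i) ∈ routingStep G s b T σ η →
      (node κ q, i) ∈ σ ∨ (η (node κ q) = false ∧ Offered (N κ) (routingTx s (b T) σ) i) := by
    rintro η q (h | h)
    · exact Or.inl h
    · right
      simp only [Set.mem_ofPred_eq, noisyReceive] at h
      split_ifs at h with hη
      obtain ⟨-, u, hadj, hu, huniq⟩ := exists_of_receive_eq_some h
      refine ⟨by simpa using hη, u, (hN.adj_iff κ q u).mp hadj, hu, fun w hw hws => ?_⟩
      exact huniq w ((hN.adj_iff κ q w).mpr hw) hws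
  by_cases ho : Offered (N κ) (routingTx s (b T) σ) i
  swap
  · refine (bernExp_mono (fun _ => hp0) (fun _ => hp1)
      (g := fun _ => clusterPotential p (node κ) i θ X σ) fun η => ?_).trans (bernExp_const _ _).le
    rw [if_neg ho, add_zero]
    refine le_of_eq ?_
    have : ∀ q, (node κ q, i) ∈ routingStep G s b T σ η ↔ (node κ q, i) ∈ σ := fun q =>
      ⟨fun h => (hoff η q h).elim id fun h => absurd h.2 ho,
        fun h => subset_routingStep _ _ _ _ _ _ h⟩
    simp only [clusterPotential, this]
  rw [if_pos ho]
  by_cases hX : X + 1 ≤ θ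
  swap
  · refine (bernExp_mono (fun _ => hp0) (fun _ => hp1) (g := fun _ => 0) fun η => ?_).trans
      ((bernExp_const _ _).le.trans (clusterPotential_nonneg hp0 hp1 _ _ _ _ _))
    rw [clusterPotential, if_neg hX]
  have hpow : ∀ n : ℕ, 0 ≤ 1 - p ^ n ∧ 1 - p ^ n ≤ 1 := fun n =>
    ⟨by linarith [pow_le_one₀ (n := n) hp0 hp1], by linarith [pow_nonneg hp0 n]⟩
  refine (bernExp_mono (fun _ => hp0) (fun _ => hp1) (g := fun η : V → Bool => ∏ q,
    (fun q c => if (node κ q, i) ∈ σ then 1 else if c then 1 - p ^ (θ - (X + 1)) else 1) q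
      (η (node κ q))) fun η => ?_).trans ?_
  · rw [clusterPotential, if_pos hX]
    refine Finset.prod_le_prod (fun q _ => ?_) fun q _ => ?_
    · split_ifs
      · norm_num
      · exact (hpow _).1
    · by_cases hσ : (node κ q, i) ∈ σ
      · simp [hσ, subset_routingStep G s b T σ η hσ]
      · simp only [hσ, if_false]
        by_cases hη : η (node κ q) = true
        · rw [if_neg, if_pos hη]
          intro h
          rcases hoff η q h with h | h
          · exact hσ h
          · simp [hη] at h
        · rw [if_neg hη]
          split_ifs
          · exact le_rfl
          · exact (hpow _).2
  · refine (bernExp_prod_injective _ (hN.injective κ) (fun q c =>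
      if (node κ q, i) ∈ σ then 1 else if c then 1 - p ^ (θ - (X + 1)) else 1)).le.trans ?_
    rw [clusterPotential, if_pos (show X ≤ θ by omega)]
    refine le_of_eq (Finset.prod_congr rfl fun q _ => ?_)
    by_cases hσ : (node κ q, i) ∈ σ
    · simp [hσ]
    · simp only [hσ, if_false, if_true, Bool.false_eq_true]
      rw [show θ - X = θ - (X + 1) + 1 by omega, pow_succ]
      ring

lemma bernExp_clusterPotential_received_le (hN : IsClusterNetwork G s node N β) (hp0 : 0 ≤ p)
    (hp1 : p ≤ 1) (b : AdaptiveSchedule V k) (κ : K) (i : Fin k) (θ T : ℕ) :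
    bernExp (fun _ => p) (fun ω : Faults V T => clusterPotential p (node κ) i θ
      (offers G s b (N κ) i T ω) (received G s b T ω)) ≤ (1 - p ^ θ) ^ Fintype.card C := by
  induction T with
  | zero =>
    simp only [offers, received, clusterPotential, Nat.zero_le, if_true, Set.mem_empty_iff_false,
      if_false, Nat.sub_zero, Finset.prod_const, Finset.card_univ]
    exact (bernExp_const _ _).le
  | succ T ih =>
    refine le_trans (le_of_eq ?_) ((bernExp_mono (fun _ => hp0) (fun _ => hp1)
      fun ω : Faults V T => bernExp_clusterPotential_le hN hp0 hp1 b κ i θ T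
        (offers G s b (N κ) i T ω) (received G s b T ω)).trans ih)
    exact bernExp_faults_succ p (fun (ω : Faults V T) η => clusterPotential p (node κ) i θ
      (offers G s b (N κ) i T ω +
        if Offered (N κ) (routingTx s (b T) (received G s b T ω)) i then 1 else 0)
      (routingStep G s b T (received G s b T ω) η))

/-- After success, every pair of a cluster and a message either used at least θ + 1 offers or has
potential 1. Hence 1 ≤ offers/(θ+1) + potential for each pair. Summing over all pairs and taking
expectations compares their number with the supply of at most `T * β` offers. -/
theorem RoutingFeasible.cluster_bound (hN : IsClusterNetwork G s node N β) (hp0 : 0 ≤ p)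
    (hp1 : p ≤ 1) {T : ℕ} (h : RoutingFeasible G s p k T) (θ : ℕ) :
    (1 - 1 / (k : ℝ) - (1 - p ^ θ) ^ Fintype.card C) * (Fintype.card K * k * (θ + 1)) ≤ T * β := by
  obtain ⟨b, hb⟩ := h
  set W : ℝ := Fintype.card K * k with hW
  set Φ : K × Fin k → Faults V T → ℝ := fun x ω => clusterPotential p (node x.1) x.2 θ
      (offers G s b (N x.1) x.2 T ω) (received G s b T ω) with hΦ
  have hΦ0 : ∀ x ω, 0 ≤ Φ x ω := fun x ω => clusterPotential_nonneg hp0 hp1 _ _ _ _ _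
  obtain ⟨E, hE⟩ : ∃ E : Set (Faults V T),
      E = {ω : Faults V T | ∀ u i, Knows s (received G s b T ω) u i} := ⟨_, rfl⟩
  rw [faultProb, ← hE, bernoulliProb_eq_bernExp] at hb
  have hpoint : ∀ ω : Faults V T, W * (if ω ∈ E then 1 else 0) ≤
      T * β / (θ + 1) + ∑ x, Φ x ω := by
    intro ω
    have hsum0 : 0 ≤ ∑ x, Φ x ω := Finset.sum_nonneg fun x _ => hΦ0 x ω
    split_ifs with hω
    swap
    · rw [mul_zero]
      positivity
    rw [hE] at hω
    have hone : ∀ x : K × Fin k, (1 : ℝ) ≤ offers G s b (N x.1) x.2 T ω / (θ + 1) + Φ x ω := by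
      intro x
      by_cases hX : offers G s b (N x.1) x.2 T ω ≤ θ
      · have hall : ∀ q, (node x.1 q, x.2) ∈ received G s b T ω := fun q =>
          (hω (node x.1 q) x.2).resolve_left (hN.ne_source _ _)
        have : Φ x ω = 1 := by simp [hΦ, clusterPotential, hX, hall]
        rw [this]
        have : (0 : ℝ) ≤ offers G s b (N x.1) x.2 T ω / (θ + 1) := by positivity
        linarith
      · have h1 : (θ : ℝ) + 1 ≤ offers G s b (N x.1) x.2 T ω := by
          exact_mod_cast Nat.lt_of_not_le hX
        have h2 : (1 : ℝ) ≤ offers G s b (N x.1) x.2 T ω / (θ + 1) := by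
          rw [le_div_iff₀ (by positivity)]
          linarith
        linarith [hΦ0 x ω]
    have hsum := Finset.sum_le_sum fun x (_ : x ∈ Finset.univ) => hone x
    rw [Finset.sum_add_distrib, ← Finset.sum_div, ← Nat.cast_sum] at hsum
    have hcard : ∑ _x : K × Fin k, (1 : ℝ) = W := by simp [hW]
    rw [hcard] at hsum
    have : ((∑ x : K × Fin k, offers G s b (N x.1) x.2 T ω : ℕ) : ℝ) ≤ T * β := by
      exact_mod_cast sum_offers_le hN b T ω
    rw [mul_one]
    refine hsum.trans (add_le_add_left ?_ _)
    gcongr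
  have hexp := bernExp_mono (fun _ => hp0) (fun _ => hp1) hpoint
  rw [bernExp_const_mul, bernExp_add, bernExp_const, bernExp_sum] at hexp
  have hΦsum : ∑ x, bernExp (fun _ => p) (Φ x) ≤ W * (1 - p ^ θ) ^ Fintype.card C := by
    refine (Finset.sum_le_sum fun x (_ : x ∈ Finset.univ) =>
      bernExp_clusterPotential_received_le hN hp0 hp1 b x.1 x.2 θ T).trans (le_of_eq ?_)
    simp [hW]
  have hW0 : 0 ≤ W := by positivity
  have hmain : W * (1 - 1 / (k : ℝ)) ≤ T * β / (θ + 1) + W * (1 - p ^ θ) ^ Fintype.card C :=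
    (mul_le_mul_of_nonneg_left hb hW0).trans (hexp.trans (by gcongr))
  have hθ : (0 : ℝ) < θ + 1 := by positivity
  have : (1 - 1 / (k : ℝ) - (1 - p ^ θ) ^ Fintype.card C) * W ≤ T * β / (θ + 1) := by linarith
  rw [le_div_iff₀ hθ] at this
  linarith

end RoutingUpper

/-! ### Few receptions carry little information -/

/-- Induction on the first entry: `none` leaves the budget `r` intact, and each of the |P| packets
uses one unit of it. The bound satisfies the resulting recursion. -/
lemma card_lists_le {P : Type} [Fintype P] (T r : ℕ) (A : Finset (List (Option P)))
    (hA : ∀ l ∈ A, l.length = T ∧ l.countP Option.isSome ≤ r) :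
    A.card ≤ (T * Fintype.card P + 1) ^ r := by
  induction T generalizing r A with
  | zero =>
    have : A ⊆ {[]} := fun l hl => by simpa using List.length_eq_zero_iff.mp (hA l hl).1
    simpa using Finset.card_le_card this
  | succ T ih =>
    have hcons : ∀ l ∈ A, l = l.headD none :: l.tail := by
      intro l hl
      have := (hA l hl).1
      cases l with
      | nil => simp at this
      | cons o l => rfl
    have hfib : A.card = ∑ o : Option P, (A.filter fun l => l.headD none = o).card :=
      Finset.card_eq_sum_card_fiberwise fun l _ => Finset.mem_coe.mpr (Finset.mem_univ _)
    have himg : ∀ o, (A.filter fun l => l.headD none = o).card =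
        ((A.filter fun l => l.headD none = o).image List.tail).card := by
      intro o
      refine (Finset.card_image_of_injOn ?_).symm
      intro l hl l' hl' h
      simp only [Finset.coe_filter, Set.mem_ofPred_eq] at hl hl'
      rw [hcons l hl.1, hcons l' hl'.1, hl.2, hl'.2, h]
    have htail : ∀ o, ∀ t ∈ (A.filter fun l => l.headD none = o).image List.tail,
        t.length = T ∧ (o :: t).countP Option.isSome ≤ r := by
      intro o t ht
      obtain ⟨l, hl, rfl⟩ := Finset.mem_image.mp ht
      obtain ⟨hlA, hlo⟩ := Finset.mem_filter.mp hl
      obtain ⟨h1, h2⟩ := hA l hlA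
      rw [hcons l hlA, hlo] at h1 h2
      exact ⟨by simpa using h1, h2⟩
    have hnone : (A.filter fun l => l.headD none = none).card ≤
        (T * Fintype.card P + 1) ^ r := by
      rw [himg]
      refine ih r _ fun t ht => ?_
      simpa using htail none t ht
    rw [hfib, Fintype.sum_option]
    cases r with
    | zero =>
      have hsome : ∀ y : P, (A.filter fun l => l.headD none = some y).card = 0 := by
        intro y
        rw [himg, Finset.card_eq_zero, Finset.eq_empty_iff_forall_notMem]
        intro t ht
        have := (htail _ t ht).2
        simp at this
      simp only [hsome, Finset.sum_const_zero, add_zero]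
      exact hnone
    | succ r =>
      have hsome : ∀ y : P, (A.filter fun l => l.headD none = some y).card ≤
          (T * Fintype.card P + 1) ^ r := by
        intro y
        rw [himg]
        refine ih r _ fun t ht => ?_
        simpa using htail (some y) t ht
      calc _ ≤ (T * Fintype.card P + 1) ^ (r + 1) +
            ∑ _y : P, (T * Fintype.card P + 1) ^ r :=
            add_le_add hnone (Finset.sum_le_sum fun y _ => hsome y)
        _ = (T * Fintype.card P + 1) ^ r * ((T + 1) * Fintype.card P + 1) := by
            simp only [Finset.sum_const, Finset.card_univ, smul_eq_mul]; ring
        _ ≤ ((T + 1) * Fintype.card P + 1) ^ r * ((T + 1) * Fintype.card P + 1) := by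
            gcongr; omega
        _ = _ := (pow_succ _ _).symm

lemma exists_bernExp_le {ι : Type} [Fintype ι] {q : ι → ℝ} (h0 : ∀ i, 0 ≤ q i) (h1 : ∀ i, q i ≤ 1)
    (f : (ι → Bool) → ℝ) : ∃ ω, bernExp q f ≤ f ω := by
  obtain ⟨ω, hω⟩ := Finite.exists_max f
  exact ⟨ω, (bernExp_mono h0 h1 hω).trans (bernExp_const _ _).le⟩

section CodingUpper

variable {V M P K C : Type} {k : ℕ} [Fintype K] {G : SimpleGraph V} {s : V}
  {node : K → C → V} {N : K → Set V} {β : ℕ} {p : ℝ}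

lemma sum_receptions_le (hN : IsClusterNetwork G s node N β) (q : C) (S : CodingSchedule V M P k)
    (m : Fin k → M) (T : ℕ) (ω : Faults V T) :
    ∑ κ, (history G s S m T ω (node κ q)).countP Option.isSome ≤ T * β := by
  induction T with
  | zero => simp [history]
  | succ T ih =>
    simp only [history, List.countP_cons, Finset.sum_add_distrib]
    rw [add_mul, one_mul]
    refine add_le_add (ih ω.init) ?_
    rw [← Finset.card_filter]
    set tx := fun u => S.send T u (initialKnowledge s m u) (history G s S m T ω.init u)
    refine le_trans (Finset.card_le_card fun κ hκ => ?_) (hN.card_le {u | (tx u).isSome})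
    simp only [Finset.mem_filter, Finset.mem_univ, true_and] at hκ ⊢
    obtain ⟨y, hy⟩ := Option.isSome_iff_exists.mp hκ
    rw [noisyReceive] at hy
    split_ifs at hy
    obtain ⟨-, u, hadj, hu, huniq⟩ := exists_of_receive_eq_some hy
    exact ⟨u, ⟨(hN.adj_iff κ q u).mp hadj, by simp [hu]⟩,
      fun w hw => huniq w ((hN.adj_iff κ q w).mpr hw.1) hw.2⟩

lemma history_length {V M P : Type} {k : ℕ} {G : SimpleGraph V} {s : V}
    (S : CodingSchedule V M P k) (m : Fin k → M) (T : ℕ) (ω : Faults V T)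
    (v : V) : (history G s S m T ω v).length = T := by
  induction T with
  | zero => rfl
  | succ T ih => exact congrArg (· + 1) (ih ω.init)

/-- By averaging, some fixed fault pattern decodes at least half of all message vectors, since 1 -
1/k ≥ 1/2. For these, some cluster has average reception count at most Tβ/|K|, so by Markov at least
half of them leave it with at most `r` receptions. Under a fixed fault pattern the history of a
non-source node determines what it decodes, so these vectors have distinct histories. -/
theorem card_messages_le [Fintype V] [Fintype M] [Fintype P] [Nonempty K]
    (hN : IsClusterNetwork G s node N β) (q : C) (hp0 : 0 ≤ p)
    (hp1 : p ≤ 1) (hk : 2 ≤ k) (S : CodingSchedule V M P k) {T : ℕ}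
    (hS : ∀ m, 1 - 1 / (k : ℝ) ≤ faultProb p {ω : Faults V T |
        ∀ u, S.decode u (initialKnowledge s m u) (history G s S m T ω u) = m})
    {r : ℕ} (hr : 2 * (T * β) ≤ (r + 1) * Fintype.card K) :
    Fintype.card M ^ k ≤ 4 * (T * Fintype.card P + 1) ^ r := by
  let A : Faults V T → Finset (Fin k → M) := fun ω => Finset.univ.filter fun m =>
    ∀ u, S.decode u (initialKnowledge s m u) (history G s S m T ω u) = m
  obtain ⟨ω, hω⟩ := exists_bernExp_le (fun _ => hp0) (fun _ => hp1)
    (fun ω : Faults V T => ((A ω).card : ℝ))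
  have hAcard : Fintype.card M ^ k ≤ 2 * (A ω).card := by
    have h1 : ∑ m : Fin k → M, (1 / 2 : ℝ) ≤ (A ω).card := by
      refine le_trans (Finset.sum_le_sum (g := fun m => faultProb p {ω : Faults V T |
          ∀ u, S.decode u (initialKnowledge s m u) (history G s S m T ω u) = m}) fun m _ => ?_)
        (le_trans (le_of_eq ?_) hω)
      · refine le_trans ?_ (hS m)
        have : 1 / (k : ℝ) ≤ 1 / 2 := one_div_le_one_div_of_le (by norm_num) (by exact_mod_cast hk)
        linarith
      · simp only [faultProb, bernoulliProb_eq_bernExp]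
        rw [← bernExp_sum]
        congr 1
        ext ω
        simp only [A, Finset.card_filter, Nat.cast_sum]
        refine Finset.sum_congr rfl fun m _ => ?_
        simp only [Set.mem_ofPred_eq]
        split_ifs <;> simp
    simp only [Finset.sum_const, Finset.card_univ, Fintype.card_pi, Finset.prod_const,
      Fintype.card_fin, nsmul_eq_mul] at h1
    have h2 : ((Fintype.card M ^ k : ℕ) : ℝ) ≤ ((2 * (A ω).card : ℕ) : ℝ) := by
      push_cast at h1 ⊢
      linarith
    exact_mod_cast h2
  let rc : K → (Fin k → M) → ℕ := fun κ m =>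
    (history G s S m T ω (node κ q)).countP Option.isSome
  obtain ⟨κ, hκ⟩ : ∃ κ, (∑ m ∈ A ω, rc κ m) * Fintype.card K ≤ (A ω).card * (T * β) := by
    by_contra! hcon
    have h1 := Finset.sum_lt_sum_of_nonempty (Finset.univ_nonempty (α := K)) fun κ _ => hcon κ
    rw [Finset.sum_const, Finset.card_univ, smul_eq_mul, ← Finset.sum_mul,
      Finset.sum_comm] at h1
    have h2 : ∑ m ∈ A ω, ∑ κ, rc κ m ≤ (A ω).card * (T * β) := by
      simpa using Finset.sum_le_card_nsmul (A ω) _ _ fun m _ => sum_receptions_le hN q S m T ω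
    have h3 := Nat.mul_le_mul_right (Fintype.card K) h2
    rw [mul_comm] at h1
    omega
  have hKpos : 0 < Fintype.card K := Fintype.card_pos
  have hmany : (A ω).card ≤ 2 * ((A ω).filter fun m => rc κ m ≤ r).card := by
    have h1 : ((A ω).filter fun m => ¬ rc κ m ≤ r).card * (r + 1) ≤ ∑ m ∈ A ω, rc κ m := by
      rw [← smul_eq_mul]
      refine (Finset.card_nsmul_le_sum _ _ _ fun m hm => ?_).trans
        (Finset.sum_le_sum_of_subset (Finset.filter_subset _ _))
      have := (Finset.mem_filter.mp hm).2
      omega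
    have h2 := Finset.card_filter_add_card_filter_not (s := A ω) (fun m => rc κ m ≤ r)
    have h3 := Nat.mul_le_mul_right (Fintype.card K) h1
    have h4 : 2 * ((A ω).filter fun m => ¬ rc κ m ≤ r).card * ((r + 1) * Fintype.card K) ≤
        (A ω).card * ((r + 1) * Fintype.card K) := by
      have h5 := Nat.mul_le_mul_left (A ω).card hr
      calc _ = 2 * (((A ω).filter fun m => ¬ rc κ m ≤ r).card * (r + 1) * Fintype.card K) := by
            ring
        _ ≤ 2 * ((A ω).card * (T * β)) := by omega
        _ = (A ω).card * (2 * (T * β)) := by ring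
        _ ≤ _ := h5
    have h5 := Nat.le_of_mul_le_mul_right h4 (by positivity)
    omega
  have hfew : ((A ω).filter fun m => rc κ m ≤ r).card ≤ (T * Fintype.card P + 1) ^ r := by
    rw [← Finset.card_image_of_injOn
      (f := fun m => history G s S m T ω (node κ q)) (s := (A ω).filter fun m => rc κ m ≤ r)]
    · refine card_lists_le T r _ fun l hl => ?_
      obtain ⟨m, hm, rfl⟩ := Finset.mem_image.mp hl
      exact ⟨history_length S m T ω _, (Finset.mem_filter.mp hm).2⟩
    · intro m hm m' hm' h
      simp only [A, Finset.coe_filter, Finset.mem_filter, Finset.mem_univ, true_and,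
        Set.mem_ofPred_eq] at hm hm' h
      have h1 := hm.1 (node κ q)
      have h2 := hm'.1 (node κ q)
      rw [initialKnowledge, if_neg (hN.ne_source κ q)] at h1 h2
      rw [← h1, ← h2, h]
  omega

end CodingUpper
/-! ### Throughput of cluster networks -/

/-- With θ of order L the potential bound (1 - p^θ)^|C| stays below 1/4 because |C| ≥ 2^L. A typical
cluster thus needs Ω(L) offers per message, while its share of the offers is only β/|K| ≤ C₀/L per
round. The two factors L multiply. -/
theorem exists_routingThroughput_le_of_cluster {p : ℝ} (hp0 : 0 < p) (hp1 : p < 1) (C₀ : ℕ)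
    (hC₀ : 0 < C₀) :
    ∃ c : ℝ, 0 < c ∧ ∀ (V K C : Type) [Fintype V] [Fintype K] [Fintype C] [Nonempty K]
      (G : SimpleGraph V) (s : V) (node : K → C → V) (N : K → Set V) (β L : ℕ),
      IsClusterNetwork G s node N β → 2 ≤ L → 2 ^ L ≤ Fintype.card C →
      β * L ≤ C₀ * Fintype.card K → routingThroughput G s p ≤ ENNReal.ofReal (c / L ^ 2) := by
  set γ := -Real.log p with hγ
  have hγ0 : 0 < γ := by rw [hγ]; linarith [Real.log_neg hp0 hp1]
  have hlog2 : 0 < Real.log 2 := Real.log_pos (by norm_num)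
  -- Chosen so that p^(Lg) = 2^(-L/2), leaving p^θ·|C| ≥ 2^(L/2) ≥ 2.
  set g := Real.log 2 / (2 * γ) with hg
  have hg0 : 0 < g := by positivity
  refine ⟨2 * C₀ / g, by positivity, ?_⟩
  intro V K C _ _ _ _ G s node N β L hN hL hC hβ
  have hL0 : (2 : ℝ) ≤ L := by exact_mod_cast hL
  set θ := ⌊L * g⌋₊ with hθ
  have hθle : (θ : ℝ) ≤ L * g := Nat.floor_le (by positivity)
  have hθlt : L * g < θ + 1 := Nat.lt_floor_add_one _
  have hpow : Real.exp (-(L * Real.log 2 / 2)) ≤ p ^ θ := by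
    have h1 : p ^ θ = Real.exp (-(γ * θ)) := by
      rw [hγ, ← Real.rpow_natCast, Real.rpow_def_of_pos hp0]
      congr 1
      ring
    rw [h1, Real.exp_le_exp, neg_le_neg_iff]
    calc γ * θ ≤ γ * (L * g) := mul_le_mul_of_nonneg_left hθle hγ0.le
      _ = L * Real.log 2 / 2 := by rw [hg]; field_simp
  have htwo : 2 ≤ p ^ θ * Fintype.card C := by
    have h1 : Real.exp (L * Real.log 2) ≤ Fintype.card C := by
      have : Real.exp (L * Real.log 2) = 2 ^ L := by
        rw [mul_comm, Real.exp_mul, Real.exp_log (by norm_num), Real.rpow_natCast]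
      rw [this]
      exact_mod_cast hC
    calc (2 : ℝ) = Real.exp (Real.log 2) := (Real.exp_log (by norm_num)).symm
      _ ≤ Real.exp (-(L * Real.log 2 / 2) + L * Real.log 2) := by
        rw [Real.exp_le_exp]
        nlinarith
      _ = Real.exp (-(L * Real.log 2 / 2)) * Real.exp (L * Real.log 2) := Real.exp_add _ _
      _ ≤ _ := mul_le_mul hpow h1 (Real.exp_pos _).le (by positivity)
  have hquarter : (1 - p ^ θ) ^ Fintype.card C ≤ 1 / 4 := by
    have h0 : 0 ≤ 1 - p ^ θ := by linarith [pow_le_one₀ (n := θ) hp0.le hp1.le]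
    calc (1 - p ^ θ) ^ Fintype.card C ≤ Real.exp (-(p ^ θ)) ^ Fintype.card C :=
          pow_le_pow_left₀ h0 (Real.one_sub_le_exp_neg _) _
      _ = Real.exp (-(p ^ θ * Fintype.card C)) := by
          rw [← Real.exp_nat_mul]; congr 1; ring
      _ ≤ Real.exp (-2) := by rw [Real.exp_le_exp]; linarith
      _ ≤ 1 / 4 := by
          rw [Real.exp_neg, ← one_div]
          refine one_div_le_one_div_of_le (by norm_num) ?_
          have h1 := Real.add_one_le_exp (1 : ℝ)
          have h2 : Real.exp 2 = Real.exp 1 * Real.exp 1 := by rw [← Real.exp_add]; norm_num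
          rw [h2]
          nlinarith
  refine limsup_throughput_le (by positivity) ?_
  filter_upwards [eventually_ge_atTop 4] with k hk T hT
  have hbound := RoutingFeasible.cluster_bound hN hp0.le hp1.le hT θ
  have hk4 : 1 / (k : ℝ) ≤ 1 / 4 := one_div_le_one_div_of_le (by norm_num) (by exact_mod_cast hk)
  have hK : (0 : ℝ) < Fintype.card K := by exact_mod_cast Fintype.card_pos
  have hβ' : (β : ℝ) * L ≤ C₀ * Fintype.card K := by exact_mod_cast hβ
  have hkpos : (0 : ℝ) < k := by exact_mod_cast (show 0 < k by omega)
  have h1 : 1 / 2 * (Fintype.card K * k * (L * g)) ≤ (T : ℝ) * β := by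
    refine le_trans ?_ hbound
    refine mul_le_mul (by linarith) ?_ (by positivity) (by linarith)
    exact mul_le_mul_of_nonneg_left hθlt.le (by positivity)
  have h2 : 1 / 2 * (Fintype.card K * k * (L * g)) * L ≤ T * (C₀ * Fintype.card K) :=
    calc _ ≤ (T : ℝ) * β * L := mul_le_mul_of_nonneg_right h1 (by positivity)
      _ = T * (β * L) := by ring
      _ ≤ _ := mul_le_mul_of_nonneg_left hβ' (by positivity)
  have h3 : (k : ℝ) * (g * L ^ 2) ≤ 2 * C₀ * T := by
    refine le_of_mul_le_mul_left ?_ hK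
    linarith
  have h4 : 2 * C₀ / g / L ^ 2 * (T : ℝ) = 2 * C₀ * T / (g * L ^ 2) := by
    field_simp
  rw [h4, le_div_iff₀ (by positivity)]
  exact h3

/-- A reception conveys at most its packet and its time, O(log(nk)) bits, so the k messages of at
least a·log₂(nk) bits need r = Ω(k) receptions. A cluster gets only O(T/L) of them on average. -/
theorem exists_codingThroughput_le_of_cluster {p : ℝ} (hp0 : 0 < p) (hp1 : p < 1) {a b : ℝ}
    (ha : 0 < a) (hab : a ≤ b) (C₀ : ℕ) :
    ∃ c : ℝ, 0 < c ∧ ∀ (V K C : Type) [Fintype V] [Fintype K] [Nonempty K] [Nonempty C]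
      (G : SimpleGraph V) (s : V) (node : K → C → V) (N : K → Set V) (β L : ℕ),
      IsClusterNetwork G s node N β → 0 < L → L ≤ Fintype.card V →
      β * L ≤ C₀ * Fintype.card K → codingThroughput G s p a b ≤ ENNReal.ofReal (c / L) := by
  have hb : 0 < b := ha.trans_le hab
  refine ⟨1 + 4 * (b + 2) * C₀ / a, by positivity, ?_⟩
  intro V K C _ _ _ _ G s node N β L hN hL hLn hβ
  have hL0 : (0 : ℝ) < L := by exact_mod_cast hL
  set n := Fintype.card V with hn
  refine limsup_throughput_le (by positivity) ?_
  filter_upwards [eventually_ge_atTop 2, eventually_ge_atTop ⌈4 / a⌉₊] with k hk hka T hT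
  have hk2 : (2 : ℝ) ≤ k := by exact_mod_cast hk
  have hka' : 4 ≤ k * a := by
    have := (Nat.le_ceil (4 / a)).trans (show ((⌈4 / a⌉₊ : ℕ) : ℝ) ≤ k by exact_mod_cast hka)
    rwa [div_le_iff₀ ha] at this
  have hrest : 0 ≤ 4 * (b + 2) * C₀ / a := by positivity
  -- If T ≥ kL the bound is immediate. Otherwise T < kL ≤ nk, so the time of a reception costs at
  -- most `x` bits.
  by_cases hTL : k * L ≤ T
  · have hTL' : (k : ℝ) * L ≤ T := by exact_mod_cast hTL
    rw [div_mul_eq_mul_div, le_div_iff₀ hL0]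
    nlinarith [mul_nonneg hrest (Nat.cast_nonneg (α := ℝ) T)]
  push Not at hTL
  obtain ⟨S, hS⟩ := hT
  have hK : 0 < Fintype.card K := Fintype.card_pos
  have hK' : (0 : ℝ) < Fintype.card K := by exact_mod_cast hK
  set r := 2 * (T * β) / Fintype.card K with hr
  have hrlt : 2 * (T * β) ≤ (r + 1) * Fintype.card K :=
    (Nat.lt_mul_of_div_lt (Nat.lt_succ_self _) hK).le
  have hcount := card_messages_le hN (Classical.arbitrary C) hp0.le hp1.le hk S hS hrlt
  simp only [Fintype.card_pi, Fintype.card_bool, Finset.prod_const, Finset.card_univ,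
    Fintype.card_fin] at hcount
  rw [← hn] at hcount
  set la := bitLength a n k with hla
  set lb := bitLength b n k with hlb
  set x := Real.logb 2 ((n : ℝ) * (k : ℝ)) with hx
  have hn1 : (1 : ℝ) ≤ n := by exact_mod_cast (show 1 ≤ n by omega)
  have hnk2 : (2 : ℝ) ≤ n * k := by nlinarith
  have hx1 : 1 ≤ x := by
    rw [hx, Real.le_logb_iff_rpow_le (by norm_num) (by linarith)]
    simpa using hnk2
  have hlax : a * x ≤ la := Nat.le_ceil _
  have hlbx : (lb : ℝ) ≤ b * x + 1 := (Nat.ceil_lt_add_one (by positivity)).le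
  have hTP : (T : ℝ) * 2 ^ lb + 1 ≤ 2 ^ (x + lb) := by
    have h1 : (T : ℝ) + 1 ≤ n * k := by
      have : T + 1 ≤ n * k := by
        calc T + 1 ≤ k * L := hTL
          _ ≤ k * n := Nat.mul_le_mul_left _ hLn
          _ = n * k := mul_comm _ _
      exact_mod_cast this
    have h2 : (2 : ℝ) ^ (x + lb) = n * k * 2 ^ lb := by
      rw [Real.rpow_add (by norm_num), hx, Real.rpow_logb (by norm_num) (by norm_num)
        (by linarith), Real.rpow_natCast]
    rw [h2]
    have h3 : (1 : ℝ) ≤ 2 ^ lb := one_le_pow₀ (by norm_num)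
    nlinarith
  have hexp : (k : ℝ) * la ≤ 2 + r * (x + lb) := by
    have h1 : ((2 : ℝ) ^ la) ^ k ≤ 4 * (T * 2 ^ lb + 1) ^ r := by exact_mod_cast hcount
    have h2 : (2 : ℝ) ^ ((k : ℝ) * la) ≤ 2 ^ (2 + r * (x + lb)) := by
      calc (2 : ℝ) ^ ((k : ℝ) * la) = ((2 : ℝ) ^ la) ^ k := by
            rw [mul_comm, Real.rpow_mul (by norm_num), Real.rpow_natCast, Real.rpow_natCast]
        _ ≤ 4 * (T * 2 ^ lb + 1) ^ r := h1
        _ ≤ 4 * ((2 : ℝ) ^ (x + lb)) ^ r := by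
            gcongr
        _ = 2 ^ (2 + r * (x + lb)) := by
            rw [Real.rpow_add (by norm_num) 2 (r * (x + lb)), mul_comm (r : ℝ),
              Real.rpow_mul (by norm_num) (x + lb) r, Real.rpow_natCast]
            norm_num
    exact (Real.rpow_le_rpow_left_iff (by norm_num)).mp h2
  have hrle : (r : ℝ) * L ≤ 2 * T * C₀ := by
    have h1 : r * Fintype.card K ≤ 2 * (T * β) := Nat.div_mul_le_self _ _
    have h2 : r * L * Fintype.card K ≤ 2 * T * C₀ * Fintype.card K := by
      calc r * L * Fintype.card K = r * Fintype.card K * L := by ring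
        _ ≤ 2 * (T * β) * L := Nat.mul_le_mul_right _ h1
        _ = 2 * T * (β * L) := by ring
        _ ≤ 2 * T * (C₀ * Fintype.card K) := Nat.mul_le_mul_left _ hβ
        _ = _ := by ring
    exact_mod_cast Nat.le_of_mul_le_mul_right h2 hK
  have hmain : (k : ℝ) * a ≤ 2 * ((b + 2) * r) := by
    have h1 : (k : ℝ) * (a * x) ≤ 2 + r * ((b + 2) * x) := by
      refine (mul_le_mul_of_nonneg_left hlax (by positivity)).trans (hexp.trans ?_)
      gcongr
      nlinarith
    -- `k ≥ 4 / a` absorbs the additive 2, which comes from the factor 4 in the count.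
    have h2 : 2 ≤ k * a * x / 2 := by nlinarith
    have h3 : (k * a) * x ≤ (2 * ((b + 2) * r)) * x := by linarith
    exact le_of_mul_le_mul_right h3 (by linarith)
  have hfin : (k : ℝ) * L * a ≤ 4 * (b + 2) * C₀ * T := by
    calc (k : ℝ) * L * a = k * a * L := by ring
      _ ≤ 2 * ((b + 2) * r) * L := mul_le_mul_of_nonneg_right hmain hL0.le
      _ = 2 * (b + 2) * (r * L) := by ring
      _ ≤ 2 * (b + 2) * (2 * T * C₀) := mul_le_mul_of_nonneg_left hrle (by positivity)
      _ = _ := by ring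
  rw [div_mul_eq_mul_div, le_div_iff₀ hL0, add_mul, one_mul]
  have h5 : (k : ℝ) * L ≤ 4 * (b + 2) * C₀ / a * T := by
    rw [div_mul_eq_mul_div, le_div_iff₀ ha]
    exact hfin
  linarith [Nat.cast_nonneg (α := ℝ) T]

/-! ### The random bipartite graph -/

/-- Convexity of t ↦ t^s on the nonnegative reals: the secant is at least as steep as the tangent at
the left end. -/
lemma mul_pow_le_pow_sub_pow {x y : ℝ} (hy : 0 ≤ y) (hxy : y ≤ x) (s : ℕ) :
    s * y ^ (s - 1) * (x - y) ≤ x ^ s - y ^ s := by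
  induction s with
  | zero => simp
  | succ s ih =>
    have h1 : (s : ℝ) * y ^ s * (x - y) ≤ x * (x ^ s - y ^ s) := by
      cases s with
      | zero => simp
      | succ s =>
        rw [Nat.add_sub_cancel] at ih
        calc ((s + 1 : ℕ) : ℝ) * y ^ (s + 1) * (x - y)
            = y * (((s + 1 : ℕ) : ℝ) * y ^ s * (x - y)) := by ring
          _ ≤ y * (x ^ (s + 1) - y ^ (s + 1)) := mul_le_mul_of_nonneg_left ih hy
          _ ≤ x * (x ^ (s + 1) - y ^ (s + 1)) :=
              mul_le_mul_of_nonneg_right hxy (sub_nonneg.mpr (pow_le_pow_left₀ hy hxy _))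
    rw [Nat.add_sub_cancel]
    push_cast
    linarith [pow_succ x s, pow_succ y s, mul_comm x (x ^ s), mul_comm y (y ^ s)]

/-- Over all classes, a fixed set of `s` broadcasting senders reaches on average at most two
receivers with the same index. -/
lemma sum_isolation_prob_le (L s : ℕ) :
    ∑ i ∈ Finset.range L, (s : ℝ) * (1 / 2) ^ (i + 1) * (1 - (1 / 2) ^ (i + 1)) ^ (s - 1) ≤ 2 := by
  set F : ℕ → ℝ := fun i => (1 - (1 / 2) ^ (i + 1)) ^ s with hF
  have hq : ∀ i : ℕ, (0 : ℝ) < (1 / 2) ^ (i + 1) ∧ ((1 : ℝ) / 2) ^ (i + 1) ≤ 1 := fun i =>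
    ⟨by positivity, pow_le_one₀ (by norm_num) (by norm_num)⟩
  -- For q = 2^(-(i+1)) the next class has probability q/2, so the points 1 - q and 1 - q/2 differ
  -- by q/2. The convexity inequality turns each term into twice an increment of `F`, and the sum
  -- telescopes.
  have hstep : ∀ i, (s : ℝ) * (1 / 2) ^ (i + 1) * (1 - (1 / 2) ^ (i + 1)) ^ (s - 1) ≤
      2 * (F (i + 1) - F i) := by
    intro i
    have h := mul_pow_le_pow_sub_pow (x := 1 - (1 / 2) ^ (i + 1 + 1)) (y := 1 - (1 / 2) ^ (i + 1))
      (by linarith [(hq i).2]) (by rw [pow_succ _ (i + 1)]; linarith [(hq i).1]) s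
    rw [pow_succ _ (i + 1)] at h
    simp only [hF, pow_succ _ (i + 1)]
    linarith
  refine (Finset.sum_le_sum fun i _ => hstep i).trans ?_
  rw [← Finset.mul_sum, Finset.sum_range_sub]
  have h1 : F L ≤ 1 := pow_le_one₀ (by linarith [(hq L).2]) (by linarith [(hq L).1])
  have h2 : 0 ≤ F 0 := pow_nonneg (by linarith [(hq 0).2]) _
  linarith

lemma bernExp_existsUnique_le {J : Type} [Fintype J] {q : ℝ} (hq0 : 0 ≤ q) (hq1 : q ≤ 1)
    (S : Finset J) :
    bernExp (fun _ : J => q) (fun ω => if ∃! j, j ∈ S ∧ ω j = true then 1 else 0) ≤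
      S.card * q * (1 - q) ^ (S.card - 1) := by
  refine (bernExp_mono (fun _ => hq0) (fun _ => hq1) (g := fun ω => ∑ j ∈ S, ∏ i ∈ S,
    (fun i (c : Bool) => if i = j then (if c then (1 : ℝ) else 0) else if c then 0 else 1) i (ω i))
    fun ω => ?_).trans (le_of_eq ?_)
  · have hnn : ∀ j ∈ S, (0 : ℝ) ≤ ∏ i ∈ S,
        if i = j then (if ω i then (1 : ℝ) else 0) else if ω i then 0 else 1 := fun j _ =>
      Finset.prod_nonneg fun i _ => by split_ifs <;> norm_num
    split_ifs with h
    · obtain ⟨j, ⟨hjS, hj⟩, huniq⟩ := h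
      refine le_trans (le_of_eq ?_) (Finset.single_le_sum hnn hjS)
      refine (Finset.prod_eq_one fun i hi => ?_).symm
      by_cases hij : i = j
      · simp [hij, hj]
      · rw [if_neg hij, if_neg fun hω => hij (huniq i ⟨hi, hω⟩)]
    · exact Finset.sum_nonneg hnn
  · rw [bernExp_sum]
    have : ∀ j ∈ S, bernExp (fun _ : J => q) (fun ω => ∏ i ∈ S,
        (fun i (c : Bool) => if i = j then (if c then (1 : ℝ) else 0) else if c then 0 else 1)
          i (ω i)) = q * (1 - q) ^ (S.card - 1) := by
      intro j hj
      rw [bernExp_prod_finset _ S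
        (fun i (c : Bool) => if i = j then (if c then (1 : ℝ) else 0) else if c then 0 else 1),
        ← Finset.mul_prod_erase S _ hj, ← Finset.card_erase_of_mem hj, ← Finset.prod_const]
      congr 1
      · simp
      · refine Finset.prod_congr rfl fun i hi => ?_
        simp [Finset.ne_of_mem_erase hi]
    rw [Finset.sum_congr rfl this, Finset.sum_const, nsmul_eq_mul]
    ring

/-- Every receiver has a neighbour, and every set of senders reaches at most `5 m` receivers. -/
def IsGoodBipartite (m : ℕ) (H : Receivers m × Fin m → Bool) : Prop :=
  (∀ κ, ∃ j, H (κ, j) = true) ∧ ∀ S : Finset (Fin m),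
    (Finset.univ.filter fun κ => ∃! j, j ∈ S ∧ H (κ, j) = true).card ≤ 5 * m

/-- Chernoff bound with weight 2 per isolated receiver. The rows of `H` are independent, so the mean
weight is at most exp of the sum of isolation probabilities, that is e^(2m) ≤ 8^m. The result 4^(-m)
beats the 2^m sender sets. -/
lemma wctProb_many_isolated_le (m : ℕ) (S : Finset (Fin m)) :
    wctProb m {H | ¬ (Finset.univ.filter fun κ => ∃! j, j ∈ S ∧ H (κ, j) = true).card ≤ 5 * m} ≤
      (1 / 2) ^ (5 * m) * 8 ^ m := by
  set q : Receivers m × Fin m → ℝ := fun e => (1 / 2 : ℝ) ^ (e.1.1.val + 1) with hq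
  have hq0 : ∀ e, 0 ≤ q e := fun e => by positivity
  have hq1 : ∀ e, q e ≤ 1 := fun e => pow_le_one₀ (by norm_num) (by norm_num)
  have hcount : ∀ H : Receivers m × Fin m → Bool,
      ∏ κ, (fun (_ : Receivers m) (η : Fin m → Bool) =>
        if ∃! j, j ∈ S ∧ η j = true then (2 : ℝ) else 1) κ (fun j => H (κ, j)) =
      2 ^ (Finset.univ.filter fun κ => ∃! j, j ∈ S ∧ H (κ, j) = true).card := by
    intro H
    rw [← Finset.prod_const, Finset.prod_filter]
  have hexp : bernExp q (fun H => ∏ κ, (fun (_ : Receivers m) (η : Fin m → Bool) =>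
        if ∃! j, j ∈ S ∧ η j = true then (2 : ℝ) else 1) κ (fun j => H (κ, j))) ≤ 8 ^ m := by
    refine (bernExp_prod_block q (fun (_ : Receivers m) (η : Fin m → Bool) =>
      if ∃! j, j ∈ S ∧ η j = true then (2 : ℝ) else 1)).le.trans ?_
    have hfac : ∀ κ : Receivers m, bernExp (fun j => q (κ, j)) (fun η : Fin m → Bool =>
        if ∃! j, j ∈ S ∧ η j = true then (2 : ℝ) else 1) ≤
        Real.exp (S.card * (1 / 2) ^ (κ.1.val + 1) *
          (1 - (1 / 2) ^ (κ.1.val + 1)) ^ (S.card - 1)) := by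
      intro κ
      have h1 := bernExp_existsUnique_le (q := (1 / 2) ^ (κ.1.val + 1)) (by positivity)
        (pow_le_one₀ (by norm_num) (by norm_num)) S
      have h2 : bernExp (fun j => q (κ, j)) (fun η : Fin m → Bool =>
          if ∃! j, j ∈ S ∧ η j = true then (2 : ℝ) else 1) =
          1 + bernExp (fun _ : Fin m => (1 / 2 : ℝ) ^ (κ.1.val + 1)) (fun ω =>
            if ∃! j, j ∈ S ∧ ω j = true then 1 else 0) := by
        have h3 := bernExp_add (fun _ : Fin m => (1 / 2 : ℝ) ^ (κ.1.val + 1)) (fun _ => 1)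
          (fun ω => if ∃! j, j ∈ S ∧ ω j = true then 1 else 0)
        rw [bernExp_const] at h3
        rw [← h3]
        congr 1
        ext η
        split_ifs <;> norm_num
      rw [h2]
      refine le_trans ?_ (Real.add_one_le_exp _)
      linarith
    refine (Finset.prod_le_prod (fun κ _ => bernExp_nonneg (fun j => hq0 _) (fun j => hq1 _)
      fun η => by split_ifs <;> norm_num) fun κ _ => hfac κ).trans ?_
    rw [← Real.exp_sum, Fintype.sum_prod_type]
    simp only [Finset.sum_const, Finset.card_univ, Fintype.card_fin, nsmul_eq_mul]
    rw [← Finset.mul_sum, Fin.sum_univ_eq_sum_range (fun i =>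
      (S.card : ℝ) * (1 / 2) ^ (i + 1) * (1 - (1 / 2) ^ (i + 1)) ^ (S.card - 1)),
      Real.exp_nat_mul]
    refine pow_le_pow_left₀ (Real.exp_pos _).le ?_ m
    refine (Real.exp_le_exp.mpr (sum_isolation_prob_le _ _)).trans ?_
    have h1 := Real.exp_one_lt_d9
    have h2 : Real.exp 2 = Real.exp 1 * Real.exp 1 := by rw [← Real.exp_add]; norm_num
    rw [h2]
    nlinarith [Real.exp_pos 1]
  refine (bernoulliProb_le_bernExp hq0 hq1 (f := fun H => (1 / 2) ^ (5 * m) *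
    ∏ κ, (fun (_ : Receivers m) (η : Fin m → Bool) =>
        if ∃! j, j ∈ S ∧ η j = true then (2 : ℝ) else 1) κ (fun j => H (κ, j)))
    (fun H => ?_) fun H hH => ?_).trans ?_
  · rw [hcount]; positivity
  · rw [hcount]
    simp only [Set.mem_ofPred_eq, not_le] at hH
    calc (1 : ℝ) = (1 / 2) ^ (5 * m) * 2 ^ (5 * m) := by rw [← mul_pow]; norm_num
      _ ≤ _ := by
        refine mul_le_mul_of_nonneg_left ?_ (by positivity)
        exact pow_le_pow_right₀ (by norm_num) hH.le
  · rw [bernExp_const_mul]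
    exact mul_le_mul_of_nonneg_left hexp (by positivity)

lemma two_pow_numClasses_sq_le {m : ℕ} (hm : m ≠ 0) : 2 ^ numClasses m * 2 ^ numClasses m ≤ m := by
  rw [← pow_add]
  refine le_trans (Nat.pow_le_pow_right (by norm_num) ?_) (Nat.pow_log_le_self 2 hm)
  unfold numClasses
  omega

lemma numClasses_le (m : ℕ) : numClasses m ≤ m :=
  (Nat.div_le_self _ _).trans (Nat.log_le_self 2 m)

/-- Every class has edge probability at least 2^(-L) ≥ 1/√m because 4^L ≤ m. This is the purpose of
halving the logarithm in `numClasses`. -/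
lemma wctProb_isolated_receiver_le {m : ℕ} (hm : m ≠ 0) (κ : Receivers m) :
    wctProb m {H | ∀ j, H (κ, j) = false} ≤ Real.exp (-Real.sqrt m) := by
  set q : Receivers m × Fin m → ℝ := fun e => (1 / 2 : ℝ) ^ (e.1.1.val + 1) with hq
  have hq0 : ∀ e, 0 ≤ q e := fun e => by positivity
  have hq1 : ∀ e, q e ≤ 1 := fun e => pow_le_one₀ (by norm_num) (by norm_num)
  have hinj : Function.Injective fun j : Fin m => (κ, j) := fun _ _ h => by simpa using h
  refine (bernoulliProb_le_bernExp hq0 hq1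
    (f := fun H => ∏ j, (fun (_ : Fin m) (c : Bool) => if c then (0 : ℝ) else 1) j (H (κ, j)))
    (fun H => Finset.prod_nonneg fun j _ => ?_) fun H hH => ?_).trans ?_
  · show (0 : ℝ) ≤ if H (κ, j) then 0 else 1
    split_ifs <;> norm_num
  · refine (Finset.prod_eq_one fun j _ => ?_).symm.le
    have : H (κ, j) = false := hH j
    simp [this]
  · refine (bernExp_prod_injective q hinj
      (fun (_ : Fin m) (c : Bool) => if c then (0 : ℝ) else 1)).le.trans ?_
    simp only [hq, if_true, Bool.false_eq_true, if_false, mul_zero, mul_one, zero_add,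
      Finset.prod_const, Finset.card_univ, Fintype.card_fin]
    have hle : ((1 : ℝ) / 2) ^ (κ.1.val + 1) ≤ 1 := pow_le_one₀ (by norm_num) (by norm_num)
    calc (1 - ((1 : ℝ) / 2) ^ (κ.1.val + 1)) ^ m
        ≤ Real.exp (-(1 / 2) ^ (κ.1.val + 1)) ^ m :=
          pow_le_pow_left₀ (by linarith) (Real.one_sub_le_exp_neg _) _
      _ = Real.exp (-(m * (1 / 2) ^ (κ.1.val + 1))) := by
          rw [← Real.exp_nat_mul]; congr 1; ring
      _ ≤ Real.exp (-Real.sqrt m) := by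
          rw [Real.exp_le_exp, neg_le_neg_iff]
          have h2 : (2 : ℝ) ^ (κ.1.val + 1) ≤ Real.sqrt m := by
            refine Real.le_sqrt_of_sq_le ?_
            have h3 : 2 ^ (κ.1.val + 1) ≤ 2 ^ numClasses m :=
              Nat.pow_le_pow_right (by norm_num) κ.1.isLt
            have h4 := (Nat.mul_le_mul h3 h3).trans (two_pow_numClasses_sq_le hm)
            rw [sq]
            exact_mod_cast h4
          have h5 : Real.sqrt m * Real.sqrt m = m := Real.mul_self_sqrt (by positivity)
          rw [one_div, inv_pow, ← div_eq_mul_inv, le_div_iff₀ (by positivity)]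
          calc Real.sqrt m * 2 ^ (κ.1.val + 1) ≤ Real.sqrt m * Real.sqrt m :=
                mul_le_mul_of_nonneg_left h2 (Real.sqrt_nonneg _)
            _ = m := h5

theorem tendsto_wctProb_isGoodBipartite :
    Tendsto (fun m => wctProb m {H | IsGoodBipartite m H}) atTop (𝓝 1) := by
  have hlower : ∀ᶠ m : ℕ in atTop,
      1 - (Real.sqrt m ^ 4 * Real.exp (-Real.sqrt m) + (1 / 2 : ℝ) ^ m) ≤
        wctProb m {H | IsGoodBipartite m H} := by
    filter_upwards [eventually_ne_atTop 0] with m hm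
    have hq0 : ∀ e : Receivers m × Fin m, (0 : ℝ) ≤ (1 / 2 : ℝ) ^ (e.1.1.val + 1) := fun e => by
      positivity
    have hq1 : ∀ e : Receivers m × Fin m, (1 / 2 : ℝ) ^ (e.1.1.val + 1) ≤ 1 := fun e =>
      pow_le_one₀ (by norm_num) (by norm_num)
    rw [wctProb, bernoulliProb_compl]
    refine sub_le_sub_left ?_ 1
    have hunion := bernoulliProb_iUnion_le hq0 hq1
      (Finset.univ : Finset (Receivers m ⊕ Finset (Fin m)))
      (E := {H | IsGoodBipartite m H}ᶜ)
      (Sum.elim (fun κ => {H | ∀ j, H (κ, j) = false}) (fun S => {H |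
        ¬ (Finset.univ.filter fun κ => ∃! j, j ∈ S ∧ H (κ, j) = true).card ≤ 5 * m})) ?_
    · refine hunion.trans ?_
      rw [Fintype.sum_sum_type]
      refine add_le_add ?_ ?_
      · refine (Finset.sum_le_sum fun κ _ => wctProb_isolated_receiver_le hm κ).trans ?_
        rw [Finset.sum_const, nsmul_eq_mul]
        refine mul_le_mul_of_nonneg_right ?_ (Real.exp_pos _).le
        have h1 : Real.sqrt m ^ 4 = m * m := by
          have : Real.sqrt m * Real.sqrt m = m := Real.mul_self_sqrt (by positivity)
          calc Real.sqrt m ^ 4 = (Real.sqrt m * Real.sqrt m) * (Real.sqrt m * Real.sqrt m) := by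
                ring
            _ = m * m := by rw [this]
        rw [h1]
        have h2 : (Finset.univ : Finset (Receivers m)).card ≤ m * m := by
          simpa using Nat.mul_le_mul_right m (numClasses_le m)
        exact_mod_cast h2
      · refine (Finset.sum_le_sum fun S _ => wctProb_many_isolated_le m S).trans (le_of_eq ?_)
        rw [Finset.sum_const, nsmul_eq_mul, Finset.card_univ, Fintype.card_finset,
          Fintype.card_fin, pow_mul]
        push_cast
        rw [← mul_pow, ← mul_pow]
        norm_num
    · intro H hH
      simp only [Set.mem_compl_iff, Set.mem_ofPred_eq, IsGoodBipartite, not_and_or,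
        not_forall] at hH
      rcases hH with ⟨κ, hκ⟩ | ⟨S, hS⟩
      · exact ⟨Sum.inl κ, Finset.mem_univ _, fun j => by
          have := not_exists.mp hκ j
          simpa using this⟩
      · exact ⟨Sum.inr S, Finset.mem_univ _, hS⟩
  have hlim : Tendsto (fun m : ℕ => 1 - (Real.sqrt m ^ 4 * Real.exp (-Real.sqrt m) +
      (1 / 2 : ℝ) ^ m)) atTop (𝓝 (1 - (0 + 0))) := by
    refine tendsto_const_nhds.sub (Tendsto.add ?_ ?_)
    · exact (Real.tendsto_pow_mul_exp_neg_atTop_nhds_zero 4).comp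
        (Real.tendsto_sqrt_atTop.comp tendsto_natCast_atTop_atTop)
    · exact tendsto_pow_atTop_nhds_zero_of_lt_one (by norm_num) (by norm_num)
  rw [add_zero, sub_zero] at hlim
  refine tendsto_of_tendsto_of_tendsto_of_le_of_le' hlim tendsto_const_nhds hlower
    (Eventually.of_forall fun m => bernoulliProb_le_one (fun e => by positivity)
      (fun e => pow_le_one₀ (by norm_num) (by norm_num)) _)

/-! ### The clustered network as a cluster network -/

/-- The `j`-th sender. -/
def wctSender (m : ℕ) (j : Fin m) : WCTNode m := Sum.inr (Sum.inl j)

/-- The nodes of the cluster of a receiver. -/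
def wctReceiver (m : ℕ) (κ : Receivers m) (q : Fin (clusterSize m)) : WCTNode m :=
  Sum.inr (Sum.inr (κ, q))

section Embedded

variable {m : ℕ} {H : Receivers m × Fin m → Bool} {V : Type}

/-- Only the neighbourhoods of the receivers matter, so the same argument covers the network itself
and its padded versions. -/
lemma isClusterNetwork_of_adj_iff (hH : IsGoodBipartite m H) (ι : WCTNode m ↪ V)
    {G : SimpleGraph V} (hG : ∀ κ q u, G.Adj (ι (wctReceiver m κ q)) u ↔
      ∃ j, H (κ, j) = true ∧ u = ι (wctSender m j)) :
    IsClusterNetwork G (ι (wctSource m)) (fun κ q => ι (wctReceiver m κ q))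
      (fun κ => {u | ∃ j, H (κ, j) = true ∧ u = ι (wctSender m j)}) (5 * m) where
  injective κ q q' h := by simpa [wctReceiver] using ι.injective h
  ne_source κ q h := by simpa [wctReceiver, wctSource] using ι.injective h
  adj_iff := hG
  card_le S := by
    refine (Finset.card_le_card fun κ hκ => ?_).trans
      (hH.2 (Finset.univ.filter fun j => ι (wctSender m j) ∈ S))
    simp only [Finset.mem_filter, Finset.mem_univ, true_and, Set.mem_ofPred_eq] at hκ ⊢
    obtain ⟨u, ⟨⟨j, hj, rfl⟩, huS⟩, huniq⟩ := hκ
    refine ⟨j, ⟨huS, hj⟩, fun j' hj' => ?_⟩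
    have := huniq (ι (wctSender m j')) ⟨⟨j', hj'.2, rfl⟩, hj'.1⟩
    simpa [wctSender] using ι.injective this

lemma wctGraph_adj_receiver (H : Receivers m × Fin m → Bool) (κ : Receivers m)
    (q : Fin (clusterSize m)) (u : WCTNode m) :
    (wctGraph m H).Adj (wctReceiver m κ q) u ↔ ∃ j, H (κ, j) = true ∧ u = wctSender m j := by
  rcases u with u | j | ⟨κ', q'⟩
  · simp [wctGraph, wctReceiver, wctSender]
  · simp [wctGraph, wctReceiver, wctSender]
  · simp [wctGraph, wctReceiver, wctSender]

lemma wctGraph_adj_source (H : Receivers m × Fin m → Bool) (j : Fin m) :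
    (wctGraph m H).Adj (wctSource m) (wctSender m j) := by
  simp [wctGraph, wctSource, wctSender]

lemma wctGraph_reachable (hH : IsGoodBipartite m H) (u : WCTNode m) :
    (wctGraph m H).Reachable (wctSource m) u := by
  rcases u with u | j | ⟨κ, q⟩
  · exact SimpleGraph.Reachable.refl _
  · exact (wctGraph_adj_source H j).reachable
  · obtain ⟨j, hj⟩ := hH.1 κ
    exact (wctGraph_adj_source H j).reachable.trans
      ((wctGraph_adj_receiver H κ q _).mpr ⟨j, hj, rfl⟩).symm.reachable

lemma connected_of_reachable {G : SimpleGraph V} (s : V) (h : ∀ u, G.Reachable s u) :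
    G.Connected :=
  { preconnected := fun u v => (h u).symm.trans (h v), nonempty := ⟨s⟩ }

lemma wctGraph_connected (hH : IsGoodBipartite m H) : (wctGraph m H).Connected :=
  connected_of_reachable (wctSource m) (wctGraph_reachable hH)

/-- The clustered network, with all further nodes attached to the source. -/
def paddedGraph (m : ℕ) (H : Receivers m × Fin m → Bool) (ι : WCTNode m ↪ V) : SimpleGraph V :=
  (wctGraph m H).map ι ⊔ SimpleGraph.fromRel fun x y => x = ι (wctSource m) ∧ y ∉ Set.range ι

lemma paddedGraph_adj_receiver (H : Receivers m × Fin m → Bool) (ι : WCTNode m ↪ V)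
    (κ : Receivers m) (q : Fin (clusterSize m)) (u : V) :
    (paddedGraph m H ι).Adj (ι (wctReceiver m κ q)) u ↔
      ∃ j, H (κ, j) = true ∧ u = ι (wctSender m j) := by
  have hne : ι (wctReceiver m κ q) ≠ ι (wctSource m) := fun h => by
    simpa [wctReceiver, wctSource] using ι.injective h
  rw [paddedGraph, SimpleGraph.sup_adj, SimpleGraph.map_adj, SimpleGraph.fromRel_adj]
  constructor
  · rintro (⟨x, y, hxy, hx, rfl⟩ | ⟨-, ⟨h, -⟩ | ⟨-, h⟩⟩)
    · rw [ι.injective hx, wctGraph_adj_receiver] at hxy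
      obtain ⟨j, hj, rfl⟩ := hxy
      exact ⟨j, hj, rfl⟩
    · exact absurd h hne
    · exact absurd ⟨_, rfl⟩ h
  · rintro ⟨j, hj, rfl⟩
    exact Or.inl ⟨_, _, (wctGraph_adj_receiver H κ q _).mpr ⟨j, hj, rfl⟩, rfl, rfl⟩

lemma paddedGraph_connected (hH : IsGoodBipartite m H) (ι : WCTNode m ↪ V) :
    (paddedGraph m H ι).Connected := by
  refine connected_of_reachable (ι (wctSource m)) fun u => ?_
  by_cases hu : u ∈ Set.range ι
  · obtain ⟨x, rfl⟩ := hu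
    have h := (wctGraph_reachable hH x).map (SimpleGraph.Embedding.map ι (wctGraph m H)).toHom
    exact h.mono le_sup_left
  · refine SimpleGraph.Adj.reachable ?_
    rw [paddedGraph, SimpleGraph.sup_adj, SimpleGraph.fromRel_adj]
    exact Or.inr ⟨fun h => hu ⟨_, h⟩, Or.inl ⟨rfl, hu⟩⟩

end Embedded

/-! ### Sizes -/

lemma card_wctNode (m : ℕ) :
    Fintype.card (WCTNode m) = 1 + (m + numClasses m * m * clusterSize m) := by
  simp

lemma le_card_wctNode (m : ℕ) : m ≤ Fintype.card (WCTNode m) := by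
  rw [card_wctNode]; omega

lemma card_wctNode_le (m : ℕ) : Fintype.card (WCTNode m) ≤ (m + 1) ^ 2 := by
  rw [card_wctNode]
  have h : numClasses m * clusterSize m ≤ m := Nat.mul_div_le _ _
  have h2 : numClasses m * m * clusterSize m ≤ m * m := by
    calc numClasses m * m * clusterSize m = m * (numClasses m * clusterSize m) := by ring
      _ ≤ m * m := Nat.mul_le_mul_left _ h
  nlinarith

lemma two_pow_numClasses_le_clusterSize {m : ℕ} (hm : 4 ≤ m) :
    2 ^ numClasses m ≤ clusterSize m := by
  have hL : 0 < numClasses m := by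
    have : 2 ≤ Nat.log 2 m := Nat.le_log_of_pow_le (by norm_num) (by simpa using hm)
    unfold numClasses
    omega
  rw [clusterSize, Nat.le_div_iff_mul_le hL]
  exact (Nat.mul_le_mul_left _ Nat.lt_two_pow_self.le).trans (two_pow_numClasses_sq_le (by omega))

/-- The slack `m ^ 4` accommodates both the network itself, with at most (m+1)² nodes, and padding
up to the next square. -/
lemma log_le_numClasses {m n : ℕ} (hm : 4 ≤ m) (hn : 1 ≤ n) (hnm : n ≤ m ^ 4) :
    Real.log n ≤ 16 * numClasses m := by
  have hlog : Nat.log 2 m + 1 ≤ 4 * numClasses m := by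
    have : 2 ≤ Nat.log 2 m := Nat.le_log_of_pow_le (by norm_num) (by simpa using hm)
    unfold numClasses
    omega
  have h1 : (n : ℝ) ≤ (2 ^ (4 * numClasses m)) ^ 4 := by
    have h2 : m ≤ 2 ^ (4 * numClasses m) :=
      (Nat.lt_pow_succ_log_self (by norm_num) m).le.trans
        (Nat.pow_le_pow_right (by norm_num) hlog)
    exact_mod_cast hnm.trans (Nat.pow_le_pow_left h2 4)
  have h3 : Real.log n ≤ 4 * ((4 * numClasses m : ℕ) * Real.log 2) := by
    refine (Real.log_le_log (by exact_mod_cast hn) h1).trans (le_of_eq ?_)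
    rw [Real.log_pow, Real.log_pow]
    norm_num
  have h4 : Real.log 2 ≤ 1 := by linarith [Real.log_two_lt_d9]
  push_cast at h3
  nlinarith [Nat.cast_nonneg (α := ℝ) (numClasses m)]

lemma decayConst_le_log {n : ℕ} (hn : 2 ≤ n) : (decayConst n : ℝ) ≤ 32 * Real.log n := by
  have h1 : ((2 : ℝ)) ^ Nat.log 2 n ≤ n := by
    exact_mod_cast Nat.pow_log_le_self 2 (show n ≠ 0 by omega)
  have h2 : Nat.log 2 n * Real.log 2 ≤ Real.log n := by
    rw [← Real.log_pow]
    exact Real.log_le_log (by positivity) h1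
  have h3 : Real.log 2 ≤ Real.log n := Real.log_le_log (by norm_num) (by exact_mod_cast hn)
  have h4 : 1 / 2 ≤ Real.log 2 := by linarith [Real.log_two_gt_d9]
  rw [decayConst]
  push_cast
  nlinarith [Nat.cast_nonneg (α := ℝ) (Nat.log 2 n)]

/-! ### Two-sided bounds -/

theorem exists_throughput_ge {p : ℝ} (hp0 : 0 < p) (hp1 : p < 1) {a b : ℝ} (ha : 0 < a)
    (hab : a ≤ b) :
    ∃ c : ℝ, 0 < c ∧ ∀ (V : Type) [Fintype V] (G : SimpleGraph V) (s : V), G.Connected →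
      2 ≤ Fintype.card V →
      ENNReal.ofReal (c / Real.log (Fintype.card V) ^ 2) ≤ routingThroughput G s p ∧
      ENNReal.ofReal (c / Real.log (Fintype.card V)) ≤ codingThroughput G s p a b := by
  obtain ⟨c₁, hc₁, h₁⟩ := exists_routingThroughput_ge hp0 hp1
  obtain ⟨c₂, hc₂, h₂⟩ := exists_codingThroughput_ge hp0 hp1 ha hab
  have hc₁' : (0 : ℝ) < c₁ := by exact_mod_cast hc₁
  have hc₂' : (0 : ℝ) < c₂ := by exact_mod_cast hc₂
  refine ⟨min (1 / (c₁ * 32 ^ 2)) (1 / (c₂ * 32)), by positivity, fun V _ G s hG hV => ?_⟩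
  set l := Real.log (Fintype.card V) with hl
  have hl0 : 0 < l := Real.log_pos (by exact_mod_cast hV)
  have hd := decayConst_le_log hV
  rw [← hl] at hd
  have hd0 : (0 : ℝ) < decayConst (Fintype.card V) := by
    exact_mod_cast (show 0 < decayConst (Fintype.card V) by unfold decayConst; omega)
  have hinv : ∀ K : ℕ, 0 < (K : ℝ) → (K : ℝ≥0∞)⁻¹ = ENNReal.ofReal (1 / K) := fun K hK => by
    rw [one_div, ENNReal.ofReal_inv_of_pos hK, ENNReal.ofReal_natCast]
  constructor
  · refine le_trans ?_ (h₁ V G s hG)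
    rw [hinv _ (by push_cast; positivity)]
    refine ENNReal.ofReal_le_ofReal ?_
    calc min (1 / (c₁ * 32 ^ 2 : ℝ)) (1 / (c₂ * 32)) / l ^ 2 ≤ 1 / (c₁ * 32 ^ 2) / l ^ 2 := by
          gcongr
          exact min_le_left _ _
      _ = 1 / (c₁ * (32 * l) ^ 2) := by rw [div_div, mul_pow, mul_assoc]
      _ ≤ _ := by
          push_cast
          gcongr
  · refine le_trans ?_ (h₂ V G s hG)
    rw [hinv _ (by push_cast; positivity)]
    refine ENNReal.ofReal_le_ofReal ?_
    calc min (1 / (c₁ * 32 ^ 2 : ℝ)) (1 / (c₂ * 32)) / l ≤ 1 / (c₂ * 32) / l := by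
          gcongr
          exact min_le_right _ _
      _ = 1 / (c₂ * (32 * l)) := by rw [div_div, mul_assoc]
      _ ≤ _ := by
          push_cast
          gcongr

theorem exists_throughput_le {p : ℝ} (hp0 : 0 < p) (hp1 : p < 1) {a b : ℝ} (ha : 0 < a)
    (hab : a ≤ b) :
    ∃ c : ℝ, 0 < c ∧ ∀ (m : ℕ) (H : Receivers m × Fin m → Bool) (V : Type) [Fintype V]
      (G : SimpleGraph V) (ι : WCTNode m ↪ V), 16 ≤ m → IsGoodBipartite m H →
      (∀ κ q u, G.Adj (ι (wctReceiver m κ q)) u ↔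
        ∃ j, H (κ, j) = true ∧ u = ι (wctSender m j)) → Fintype.card V ≤ m ^ 4 →
      routingThroughput G (ι (wctSource m)) p ≤
        ENNReal.ofReal (c / Real.log (Fintype.card V) ^ 2) ∧
      codingThroughput G (ι (wctSource m)) p a b ≤
        ENNReal.ofReal (c / Real.log (Fintype.card V)) := by
  obtain ⟨c₁, hc₁, h₁⟩ := exists_routingThroughput_le_of_cluster hp0 hp1 5 (by norm_num)
  obtain ⟨c₂, hc₂, h₂⟩ := exists_codingThroughput_le_of_cluster hp0 hp1 ha hab 5
  refine ⟨max (c₁ * 16 ^ 2) (c₂ * 16), by positivity, ?_⟩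
  intro m H V _ G ι hm hH hG hV
  have hN := isClusterNetwork_of_adj_iff hH ι hG
  have hL : 2 ≤ numClasses m := by
    have : 4 ≤ Nat.log 2 m := Nat.le_log_of_pow_le (by norm_num) (by simpa using hm)
    unfold numClasses
    omega
  have hmV : m ≤ Fintype.card V :=
    (le_card_wctNode m).trans (Fintype.card_le_of_embedding ι)
  have hsize := two_pow_numClasses_le_clusterSize (m := m) (by omega)
  have hne : Nonempty (Receivers m) := ⟨(⟨0, by omega⟩, ⟨0, by omega⟩)⟩
  have hne' : Nonempty (Fin (clusterSize m)) :=
    ⟨⟨0, lt_of_lt_of_le (by positivity) hsize⟩⟩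
  have hβ : 5 * m * numClasses m ≤ 5 * Fintype.card (Receivers m) := by
    simp only [Fintype.card_prod, Fintype.card_fin]
    exact le_of_eq (by ring)
  have hlog := log_le_numClasses (m := m) (n := Fintype.card V) (by omega) (by omega) hV
  set l := Real.log (Fintype.card V) with hl
  have hl0 : 0 < l := Real.log_pos (by exact_mod_cast (show 1 < Fintype.card V by omega))
  have hL0 : (0 : ℝ) < numClasses m := by exact_mod_cast (show 0 < numClasses m by omega)
  constructor
  · refine (h₁ V _ _ G _ _ _ _ _ hN hL (by simpa using hsize) hβ).trans
      (ENNReal.ofReal_le_ofReal ?_)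
    calc c₁ / (numClasses m : ℝ) ^ 2 = c₁ * 16 ^ 2 / (16 * numClasses m) ^ 2 := by
          field_simp
      _ ≤ c₁ * 16 ^ 2 / l ^ 2 := by gcongr
      _ ≤ _ := by
          gcongr
          exact le_max_left _ _
  · refine (h₂ V _ _ G _ _ _ _ _ hN (by omega) ((numClasses_le m).trans hmV) hβ).trans
      (ENNReal.ofReal_le_ofReal ?_)
    calc c₂ / (numClasses m : ℝ) = c₂ * 16 / (16 * numClasses m) := by
          field_simp
      _ ≤ c₂ * 16 / l := by gcongr
      _ ≤ _ := by
          gcongr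
          exact le_max_right _ _

lemma worst_le_eventually {p : ℝ} (hp0 : 0 < p) (hp1 : p < 1) {a b : ℝ} (ha : 0 < a)
    (hab : a ≤ b) :
    ∃ c : ℝ, 0 < c ∧ ∀ᶠ n : ℕ in atTop,
      worstRoutingThroughput p n ≤ ENNReal.ofReal (c / Real.log n ^ 2) ∧
      worstCodingThroughput p a b n ≤ ENNReal.ofReal (c / Real.log n) := by
  obtain ⟨c, hc, h⟩ := exists_throughput_le hp0 hp1 ha hab
  refine ⟨c, hc, ?_⟩
  -- Probabilistic method: an event of positive probability is nonempty.
  have hex : ∀ᶠ m : ℕ in atTop, ∃ H, IsGoodBipartite m H := by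
    filter_upwards [tendsto_wctProb_isGoodBipartite.eventually_const_lt zero_lt_one] with m hm
    by_contra hcon
    push Not at hcon
    simp [wctProb, bernoulliProb, hcon] at hm
  -- For m = ⌊√n⌋ - 1 the network has at most (m+1)² ≤ n nodes, so it embeds into `Fin n`; also n <
  -- (m+2)² ≤ m^4.
  have hm : Tendsto (fun n : ℕ => Nat.sqrt n - 1) atTop atTop := by
    refine (tendsto_sub_atTop_nat 1).comp (tendsto_atTop.mpr fun x => ?_)
    filter_upwards [eventually_ge_atTop (x * x)] with n hn
    exact Nat.le_sqrt.mpr hn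
  filter_upwards [hm.eventually hex, hm.eventually_ge_atTop 16] with n hn hm16
  set m := Nat.sqrt n - 1 with hmdef
  obtain ⟨H, hH⟩ := hn
  have hmn : (m + 1) ^ 2 ≤ n := by
    rw [show m + 1 = Nat.sqrt n by omega, sq]
    exact Nat.sqrt_le n
  have hnm : n ≤ m ^ 4 := by
    have h1 : n < (m + 2) * (m + 2) := by
      have := Nat.lt_succ_sqrt n
      rwa [show (Nat.sqrt n).succ = m + 2 by omega] at this
    have h2 : m + 2 ≤ m ^ 2 := by nlinarith
    calc n ≤ (m + 2) * (m + 2) := h1.le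
      _ ≤ m ^ 2 * m ^ 2 := Nat.mul_le_mul h2 h2
      _ = m ^ 4 := by ring
  obtain ⟨ι⟩ : Nonempty (WCTNode m ↪ Fin n) :=
    Function.Embedding.nonempty_of_card_le
      ((card_wctNode_le m).trans (by simpa using hmn))
  have hb := h m H (Fin n) (paddedGraph m H ι) ι hm16 hH (paddedGraph_adj_receiver H ι)
    (by simpa using hnm)
  rw [Fintype.card_fin] at hb
  let t : Topologies n := ⟨(paddedGraph m H ι, ι (wctSource m)), paddedGraph_connected hH ι⟩
  exact ⟨(iInf_le _ t).trans hb.1, (iInf_le _ t).trans hb.2⟩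

lemma le_worst {p : ℝ} (hp0 : 0 < p) (hp1 : p < 1) {a b : ℝ} (ha : 0 < a) (hab : a ≤ b) :
    ∃ c : ℝ, 0 < c ∧ ∀ n : ℕ, 2 ≤ n →
      ENNReal.ofReal (c / Real.log n ^ 2) ≤ worstRoutingThroughput p n ∧
      ENNReal.ofReal (c / Real.log n) ≤ worstCodingThroughput p a b n := by
  obtain ⟨c, hc, h⟩ := exists_throughput_ge hp0 hp1 ha hab
  refine ⟨c, hc, fun n hn => ?_⟩
  have h' := fun t : Topologies n => h (Fin n) t.1.1 t.1.2 t.2 (by simpa using hn)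
  simp only [Fintype.card_fin] at h'
  exact ⟨le_iInf fun t => (h' t).1, le_iInf fun t => (h' t).2⟩

theorem wct_attains_both_orders {p : ℝ} (hp0 : 0 < p) (hp1 : p < 1) {a b : ℝ} (ha : 0 < a)
    (hab : a ≤ b) :
    ∃ c C : ℝ, 0 < c ∧ 0 < C ∧
      Tendsto (fun m : ℕ => wctProb m {H | (wctGraph m H).Connected ∧
        ENNReal.ofReal (c / Real.log (Fintype.card (WCTNode m)) ^ 2) ≤
          routingThroughput (wctGraph m H) (wctSource m) p ∧
        routingThroughput (wctGraph m H) (wctSource m) p ≤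
          ENNReal.ofReal (C / Real.log (Fintype.card (WCTNode m)) ^ 2) ∧
        ENNReal.ofReal (c / Real.log (Fintype.card (WCTNode m))) ≤
          codingThroughput (wctGraph m H) (wctSource m) p a b ∧
        codingThroughput (wctGraph m H) (wctSource m) p a b ≤
          ENNReal.ofReal (C / Real.log (Fintype.card (WCTNode m)))}) atTop (𝓝 1) := by
  obtain ⟨c, hc, hlow⟩ := exists_throughput_ge hp0 hp1 ha hab
  obtain ⟨C, hC, hupp⟩ := exists_throughput_le hp0 hp1 ha hab
  refine ⟨c, C, hc, hC, ?_⟩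
  have hq0 : ∀ (m : ℕ) (e : Receivers m × Fin m), (0 : ℝ) ≤ (1 / 2 : ℝ) ^ (e.1.1.val + 1) :=
    fun m e => by positivity
  have hq1 : ∀ (m : ℕ) (e : Receivers m × Fin m), (1 / 2 : ℝ) ^ (e.1.1.val + 1) ≤ 1 :=
    fun m e => pow_le_one₀ (by norm_num) (by norm_num)
  refine tendsto_of_tendsto_of_tendsto_of_le_of_le' tendsto_wctProb_isGoodBipartite
    tendsto_const_nhds ?_
    (Eventually.of_forall fun m => bernoulliProb_le_one (hq0 m) (hq1 m) _)
  filter_upwards [eventually_ge_atTop 16] with m hm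
  refine bernoulliProb_mono (hq0 m) (hq1 m) fun H hH => ?_
  have hconn := wctGraph_connected hH
  have hcard2 : 2 ≤ Fintype.card (WCTNode m) := le_trans (by omega) (le_card_wctNode m)
  have hcard4 : Fintype.card (WCTNode m) ≤ m ^ 4 := by
    refine (card_wctNode_le m).trans ?_
    have : m + 1 ≤ m ^ 2 := by nlinarith
    calc (m + 1) ^ 2 ≤ (m ^ 2) ^ 2 := Nat.pow_le_pow_left this 2
      _ = m ^ 4 := by ring
  have h1 := hlow (WCTNode m) (wctGraph m H) (wctSource m) hconn hcard2
  have h2 := hupp m H (WCTNode m) (wctGraph m H) (Function.Embedding.refl _) hm hH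
    (wctGraph_adj_receiver H) hcard4
  exact ⟨hconn, h1.1, h2.1, h1.2, h2.2⟩


end NoisyRadio

end

theorem mainTheorem1 (p : ℝ) (hp0 : 0 < p) (hp1 : p < 1) (a b : ℝ) (ha : 0 < a) (hab : a ≤ b) :
    -- the smallest coding throughput is of order `1 / log n`
    (∃ c C : ℝ, 0 < c ∧ 0 < C ∧ ∀ᶠ n : ℕ in atTop,
      ENNReal.ofReal (c / Real.log n) ≤ NoisyRadio.worstCodingThroughput p a b n ∧
      NoisyRadio.worstCodingThroughput p a b n ≤ ENNReal.ofReal (C / Real.log n)) ∧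
    -- the smallest adaptive routing throughput is of order `1 / log² n`
    (∃ c C : ℝ, 0 < c ∧ 0 < C ∧ ∀ᶠ n : ℕ in atTop,
      ENNReal.ofReal (c / Real.log n ^ 2) ≤ NoisyRadio.worstRoutingThroughput p n ∧
      NoisyRadio.worstRoutingThroughput p n ≤ ENNReal.ofReal (C / Real.log n ^ 2)) ∧
    -- both orders are attained on the (random) clustered network, asymptotically almost surely
    (∃ c C : ℝ, 0 < c ∧ 0 < C ∧
      Tendsto (fun m : ℕ => NoisyRadio.wctProb m {H |
        (NoisyRadio.wctGraph m H).Connected ∧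
        ENNReal.ofReal (c / Real.log (Fintype.card (NoisyRadio.WCTNode m)) ^ 2) ≤
          NoisyRadio.routingThroughput (NoisyRadio.wctGraph m H) (NoisyRadio.wctSource m) p ∧
        NoisyRadio.routingThroughput (NoisyRadio.wctGraph m H) (NoisyRadio.wctSource m) p ≤
          ENNReal.ofReal (C / Real.log (Fintype.card (NoisyRadio.WCTNode m)) ^ 2) ∧
        ENNReal.ofReal (c / Real.log (Fintype.card (NoisyRadio.WCTNode m))) ≤
          NoisyRadio.codingThroughput (NoisyRadio.wctGraph m H) (NoisyRadio.wctSource m) p a b ∧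
        NoisyRadio.codingThroughput (NoisyRadio.wctGraph m H) (NoisyRadio.wctSource m) p a b ≤
          ENNReal.ofReal (C / Real.log (Fintype.card (NoisyRadio.WCTNode m)))})
        atTop (𝓝 1)) ∧
    -- the worst case topology gap is of order `log n`
    (∃ c C : ℝ, 0 < c ∧ 0 < C ∧ ∀ᶠ n : ℕ in atTop,
      ENNReal.ofReal (c * Real.log n) ≤ NoisyRadio.worstCaseTopologyGap p a b n ∧
      NoisyRadio.worstCaseTopologyGap p a b n ≤ ENNReal.ofReal (C * Real.log n)) := by
  obtain ⟨c, hc, hlow⟩ := NoisyRadio.le_worst hp0 hp1 ha hab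
  obtain ⟨C, hC, hupp⟩ := NoisyRadio.worst_le_eventually hp0 hp1 ha hab
  refine ⟨⟨c, C, hc, hC, ?_⟩, ⟨c, C, hc, hC, ?_⟩,
    NoisyRadio.wct_attains_both_orders hp0 hp1 ha hab,
    ⟨c / C, C / c, by positivity, by positivity, ?_⟩⟩
  · filter_upwards [hupp, eventually_ge_atTop 2] with n hn hn2
    exact ⟨(hlow n hn2).2, hn.2⟩
  · filter_upwards [hupp, eventually_ge_atTop 2] with n hn hn2
    exact ⟨(hlow n hn2).1, hn.1⟩
  · filter_upwards [hupp, eventually_ge_atTop 2] with n hn hn2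
    have hl : 0 < Real.log n := Real.log_pos (by exact_mod_cast hn2)
    -- The gap bounds are quotients of opposite bounds: lower coding over upper routing, and upper
    -- coding over lower routing.
    have hdiv : ∀ x y : ℝ, 0 < y → ENNReal.ofReal (x / y * Real.log n) =
        ENNReal.ofReal (x / Real.log n) / ENNReal.ofReal (y / Real.log n ^ 2) := by
      intro x y hy
      rw [← ENNReal.ofReal_div_of_pos (by positivity)]
      congr 1
      field_simp
    rw [NoisyRadio.worstCaseTopologyGap, hdiv c C hC, hdiv C c hc]
    exact ⟨ENNReal.div_le_div (hlow n hn2).2 hn.1, ENNReal.div_le_div hn.2 (hlow n hn2).1⟩
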